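/- **Theorem 2.2.** Let $a<b$ be real numbers, let $\kappa>0$, $G_c>0$, $\rho>0$, and let $\eta_\varepsilon\ge 0$ ($\varepsilon>0$) satisfy $\eta_\varepsilon=o(\varepsilon)$ as $\varepsilon\to0^+$. Let $$\mathcal W=\{w\in L^1(\mathbb R_+): w'\in H^1(\mathbb R_+),\ w(0)=1,\ w'(0)=0\},\qquad \mathcal K(w)=\int_{\mathbb R_+}\bigl(w+|w'|^2+\rho\,|w''|^2\bigr)\,dx .$$ Then $\mathcal K$ has a minimizer $w_*$ in $\{w\in\mathcal W: 0\le w\le 1\}$. Put $c_\rho=2\,\mathcal K(w_*)$ and $\psi_\varepsilon(v)=(v-1)^2+\eta_\varepsilon$, and define $\mathcal F_\varepsilon:L^1(a,b)\times L^1(a,b)\to[0,+\infty]$ by $$\mathcal F_\varepsilon(u,v)=\int_{(a,b)}\bigl(\kappa\,\psi_\varepsilon(v)\,|u'|_+^2+\kappa\,|u'|_-^2\bigr)\,dx+\frac{G_c}{c_\rho}\int_{(a,b)}\bigl(\varepsilon^{-1}v+\varepsilon|v'|^2+\rho\,\varepsilon^3|v''|^2\bigr)\,dx$$ if $u\in H^1(a,b)$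 and $v\in H^2((a,b);[0,1])$, and $\mathcal F_\varepsilon(u,v)=+\infty$ otherwise, where $|u'|_+=\max(u',0)$ and $|u'|_-=\max(-u',0)$. Then, as $\varepsilon\to0^+$, $\mathcal F_\varepsilon$ $\Gamma$-converges with respect to the strong topology of $L^1(a,b)\times L^1(a,b)$ to $$\mathcal F(u,v)=\int_{(a,b)\setminus J_u}\kappa\,|u'|^2\,dx+G_c\,\#J_u$$ if $u\in SBV^2(a,b)$, the jump $[\![u]\!]=u^+-u^-$ (right limit minus left limit) is positive at every point of the jump set $J_u$, and $v=0$ a.e. in $(a,b)$, and $\mathcal F(u,v)=+\infty$ otherwise. Here $SBV^2(a,b)$ is the set of $u\in SBV(a,b)$ whose absolutely continuous derivative $u'$ is in $L^2(a,b)$ and for which $J_u$ is finite. -/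

import Mathlib

open MeasureTheory Set Filter Topology
open scoped ENNReal ContDiff

noncomputable section

namespace PhaseField

/-! ### Weak derivatives and Sobolev spaces on an open subset of the line -/

/-- Test functions on an open set `I ⊆ ℝ`: the elements of `C_c^∞(I)`. -/
structure IsTest (I : Set ℝ) (φ : ℝ → ℝ) : Prop where
  smooth : ContDiff ℝ ∞ φ
  compact : HasCompactSupport φ
  support : tsupport φ ⊆ I

/-- `g ∈ L¹_loc(I)` is the weak derivative of `f ∈ L¹_loc(I)` on the open set `I`. -/
structure HasWeakDeriv (I : Set ℝ) (f g : ℝ → ℝ) : Prop where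
  locInt : LocallyIntegrableOn f I
  locInt_deriv : LocallyIntegrableOn g I
  byParts : ∀ φ : ℝ → ℝ, IsTest I φ →
    ∫ x in I, f x * deriv φ x = -∫ x in I, g x * φ x

open Classical in
/-- The weak derivative of `f` on `I` (it is unique up to a null set); `0` if there is none. -/
def weakDeriv (I : Set ℝ) (f : ℝ → ℝ) : ℝ → ℝ :=
  if h : ∃ g, HasWeakDeriv I f g then h.choose else 0

/-- `f ∈ H¹(I)`. -/
structure MemH1 (I : Set ℝ) (f : ℝ → ℝ) : Prop where
  memLp : MemLp f 2 (volume.restrict I)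
  exists_deriv : ∃ g, HasWeakDeriv I f g
  memLp_deriv : MemLp (weakDeriv I f) 2 (volume.restrict I)

/-- `f ∈ H²(I)`. -/
structure MemH2 (I : Set ℝ) (f : ℝ → ℝ) : Prop where
  memH1 : MemH1 I f
  memH1_deriv : MemH1 I (weakDeriv I f)

/-! ### The optimal profile problem on the half line -/

/-- The boundary value at `0` of (the continuous representative of) a function on `ℝ₊` is `c`. -/
def HasTraceZero (f : ℝ → ℝ) (c : ℝ) : Prop :=
  ∃ g : ℝ → ℝ, ContinuousOn g (Ici 0) ∧ f =ᵐ[volume.restrict (Ioi 0)] g ∧ g 0 = c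

/-- The space `{w ∈ L¹(ℝ₊) : w' ∈ H¹(ℝ₊), w(0) = 1, w'(0) = 0}`. -/
structure MemW (w : ℝ → ℝ) : Prop where
  integrable : IntegrableOn w (Ioi 0)
  exists_deriv : ∃ g, HasWeakDeriv (Ioi 0) w g
  memH1_deriv : MemH1 (Ioi 0) (weakDeriv (Ioi 0) w)
  trace : HasTraceZero w 1
  trace_deriv : HasTraceZero (weakDeriv (Ioi 0) w) 0

/-- The transition energy `∫_{ℝ₊} (w + |w'|² + ρ |w''|²) dx` with unit internal length. The
integrand is integrable for every `w` with `MemW w`. -/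
def transitionEnergy (ρ : ℝ) (w : ℝ → ℝ) : ℝ :=
  ∫ x in Ioi (0 : ℝ), (w x + weakDeriv (Ioi 0) w x ^ 2
    + ρ * weakDeriv (Ioi 0) (weakDeriv (Ioi 0) w) x ^ 2)

/-- The competitors of the optimal profile problem: `w` in the space above with `0 ≤ w ≤ 1`. -/
def IsAdmissibleProfile (w : ℝ → ℝ) : Prop :=
  MemW w ∧ ∀ᵐ x ∂volume.restrict (Ioi (0 : ℝ)), 0 ≤ w x ∧ w x ≤ 1

/-- `w` minimizes the transition energy among the admissible profiles. -/
def IsOptimalProfile (ρ : ℝ) (w : ℝ → ℝ) : Prop :=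
  IsAdmissibleProfile w ∧
    ∀ z, IsAdmissibleProfile z → transitionEnergy ρ w ≤ transitionEnergy ρ z

/-! ### Jumps and special functions of bounded variation on an interval -/

/-- `p` is the approximate limit of `u` at `x` from the right. -/
def HasRightApproxLim (u : ℝ → ℝ) (x p : ℝ) : Prop :=
  Tendsto (fun r : ℝ => r⁻¹ * ∫ y in Ioo x (x + r), |u y - p|) (𝓝[>] 0) (𝓝 0)

/-- `q` is the approximate limit of `u` at `x` from the left. -/
def HasLeftApproxLim (u : ℝ → ℝ) (x q : ℝ) : Prop :=
  Tendsto (fun r : ℝ => r⁻¹ * ∫ y in Ioo (x - r) x, |u y - q|) (𝓝[>] 0) (𝓝 0)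

/-- The jump set `J_u ⊆ (a,b)`: both one-sided approximate limits exist, and they differ. -/
def jumpSet (a b : ℝ) (u : ℝ → ℝ) : Set ℝ :=
  {x | x ∈ Ioo a b ∧ ∃ p q, HasRightApproxLim u x p ∧ HasLeftApproxLim u x q ∧ p ≠ q}

open Classical in
/-- The jump `⟦u⟧(x) = u⁺(x) - u⁻(x)`, right limit minus left limit (`0` if one is missing). -/
def jump (u : ℝ → ℝ) (x : ℝ) : ℝ :=
  if h : (∃ p, HasRightApproxLim u x p) ∧ ∃ q, HasLeftApproxLim u x q then
    h.1.choose - h.2.choose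
  else 0

/-- `u ∈ SBV(a,b)` with absolutely continuous density `g`: `u ∈ L¹(a,b)`, and the distributional
derivative of `u` is the finite measure `g dx + ∑_{x ∈ J_u} ⟦u⟧(x) δ_x` (no Cantor part). -/
structure HasSBVDeriv (a b : ℝ) (u g : ℝ → ℝ) : Prop where
  integrable : IntegrableOn u (Ioo a b)
  integrable_density : IntegrableOn g (Ioo a b)
  summable_jump : Summable fun x : jumpSet a b u => |jump u x|
  byParts : ∀ φ : ℝ → ℝ, IsTest (Ioo a b) φ →
    ∫ x in Ioo a b, u x * deriv φ x
      = -((∫ x in Ioo a b, g x * φ x) + ∑' x : jumpSet a b u, jump u x * φ x)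

open Classical in
/-- The density `u'` of the absolutely continuous part of the derivative of `u ∈ SBV(a,b)`
(unique up to a null set); `0` if `u` is not in `SBV(a,b)`. -/
def sbvDensity (a b : ℝ) (u : ℝ → ℝ) : ℝ → ℝ :=
  if h : ∃ g, HasSBVDeriv a b u g then h.choose else 0

/-- `u ∈ SBV²(a,b)`: `u ∈ SBV(a,b)`, `u' ∈ L²(a,b)` and `J_u` is finite. -/
structure MemSBV2 (a b : ℝ) (u : ℝ → ℝ) : Prop where
  memSBV : ∃ g, HasSBVDeriv a b u g
  memLp_density : MemLp (sbvDensity a b u) 2 (volume.restrict (Ioo a b))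
  finite_jumpSet : (jumpSet a b u).Finite

/-! ### The functionals and their limit -/

/-- The Lebesgue space `L¹(a,b)` with its norm topology. -/
abbrev L1 (a b : ℝ) : Type := Lp ℝ 1 (volume.restrict (Ioo a b))

/-- The degradation function `ψ(v) = (v - 1)² + η`. -/
def degradation (η v : ℝ) : ℝ := (v - 1) ^ 2 + η

/-- `∫_{(a,b)} (κ ψ(v) |u'|₊² + κ |u'|₋²) dx`. -/
def elasticEnergy (a b κ η : ℝ) (u v : ℝ → ℝ) : ℝ≥0∞ :=
  ∫⁻ x in Ioo a b, ENNReal.ofReal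
    (κ * degradation η (v x) * max (weakDeriv (Ioo a b) u x) 0 ^ 2
      + κ * max (-weakDeriv (Ioo a b) u x) 0 ^ 2)

/-- `∫_{(a,b)} (ε⁻¹ v + ε |v'|² + ρ ε³ |v''|²) dx`. -/
def surfaceIntegral (a b ρ ε : ℝ) (v : ℝ → ℝ) : ℝ≥0∞ :=
  ∫⁻ x in Ioo a b, ENNReal.ofReal
    (ε⁻¹ * v x + ε * weakDeriv (Ioo a b) v x ^ 2
      + ρ * ε ^ 3 * weakDeriv (Ioo a b) (weakDeriv (Ioo a b) v) x ^ 2)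

open Classical in
/-- The fourth-order `AT₁` functional on `L¹(a,b) × L¹(a,b)` with internal length `ε`, residual
stiffness `η` and normalizing constant `c`: finite exactly for `u ∈ H¹(a,b)` and
`v ∈ H²((a,b);[0,1])`. -/
def phaseFieldEnergy (a b κ Gc ρ c ε η : ℝ) (p : L1 a b × L1 a b) : ℝ≥0∞ :=
  if MemH1 (Ioo a b) p.1 ∧ MemH2 (Ioo a b) p.2 ∧
      ∀ᵐ x ∂volume.restrict (Ioo a b), 0 ≤ p.2 x ∧ p.2 x ≤ 1 then
    elasticEnergy a b κ η p.1 p.2 + ENNReal.ofReal (Gc / c) * surfaceIntegral a b ρ ε p.2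
  else ⊤

open Classical in
/-- The sharp crack energy: `∫_{(a,b) ∖ J_u} κ |u'|² dx + G_c #J_u` if `u ∈ SBV²(a,b)`, `⟦u⟧ > 0`
on `J_u` and `v = 0` a.e., and `+∞` otherwise. -/
def sharpCrackEnergy (a b κ Gc : ℝ) (p : L1 a b × L1 a b) : ℝ≥0∞ :=
  if MemSBV2 a b p.1 ∧ (∀ x ∈ jumpSet a b p.1, 0 < jump p.1 x) ∧
      ∀ᵐ x ∂volume.restrict (Ioo a b), p.2 x = 0 then
    (∫⁻ x in Ioo a b \ jumpSet a b p.1, ENNReal.ofReal (κ * sbvDensity a b p.1 x ^ 2))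
      + ENNReal.ofReal Gc * ((jumpSet a b p.1).encard : ℝ≥0∞)
  else ⊤

/-! ### Γ-convergence -/

/-- `Γ`-convergence of a family `F ε` to `F₀` as `ε → 0⁺`: along every sequence `ε n → 0⁺`, the
liminf inequality holds and every point has a recovery sequence. (For a metrizable `X`, such as
`L¹ × L¹`, this is the same as the topological definition.) -/
def GammaConverges {X : Type*} [TopologicalSpace X] (F : ℝ → X → ℝ≥0∞) (F₀ : X → ℝ≥0∞) : Prop :=
  ∀ ε : ℕ → ℝ, (∀ n, 0 < ε n) → Tendsto ε atTop (𝓝 0) →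
    (∀ (x : X) (y : ℕ → X), Tendsto y atTop (𝓝 x) →
      F₀ x ≤ liminf (fun n => F (ε n) (y n)) atTop) ∧
    (∀ x : X, ∃ y : ℕ → X, Tendsto y atTop (𝓝 x) ∧
      limsup (fun n => F (ε n) (y n)) atTop ≤ F₀ x)

end PhaseField

end

/-! Lower bound. At bounded energy the term `ε⁻¹ v` forces `v → 0` in L¹, so `v` can stay near `1`
only in thin places. If `v` exceeds `M < 1` somewhere near a point, cut it off at a fixed distance
and rescale by `ε`. At its maximum point the slope vanishes, so after division by the maximum the
two halves are admissible profiles, and the energy is at least twice the optimal one times `M ^ 2`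
(`two_mul_transitionEnergy_le`). The cutoff costs only a factor `1 + C ε`, because each derivative
falling on it leaves a spare power of `ε` (`surfaceDensity_mul_le`). Hence the points where `v`
approaches `1` (`crackSet`) are finite in number, and each pays `Gc` after normalization
(`card_mul_le`).

Off these points `v ≤ M < 1` locally, so the degraded strain `(1 - v) u'` controls `u'`, and its
weak L² limit `g` is the derivative of the limit `u₀` there (`exists_strain`). The distribution `u₀'
- g` lives on a finite set, and since `u₀` and `g` are integrable it can only be a sum of point
masses (`integral_eq_zero_of_vanish`, `exists_ae_eq_piecewisePrimitive`); thus `u₀` is in SBV².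
Compression is not degraded, so the negative part of `u'` stays bounded in L² and cannot
concentrate: no jump is negative (`jump_coeff_nonneg`). All limits are taken along an ultrafilter,
which replaces the extraction of subsequences.

Upper bound. Each jump is replaced by a linear ramp of width `δ`, with `v = 1` on the ramp and a
rescaled optimal profile on either side (`exists_phaseField`, `exists_displacement`). The ramps
increase, so they are in tension and pay only the residual stiffness, of order `η / δ`; the plateau
costs `2 δ / ε`. Since `η = o(ε)` there is room for `η ≪ δ ≪ ε`, and both errors vanish.

Existence of the profile. As a function of `Q = w''` the energy is uniformly convex in L², so
minimizing sequences are Cauchy (`IsProfileData.midpoint`), and Fatou's lemma shows that their limit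
is a minimizer. -/

noncomputable section

namespace PhaseField

/-! ### Test functions -/

namespace IsTest

variable {I J : Set ℝ} {φ χ : ℝ → ℝ}

lemma mono (h : IsTest I φ) (hIJ : I ⊆ J) : IsTest J φ :=
  ⟨h.smooth, h.compact, h.support.trans hIJ⟩

lemma continuous (h : IsTest I φ) : Continuous φ := h.smooth.continuous

lemma hasDerivAt (h : IsTest I φ) (x : ℝ) : HasDerivAt φ (deriv φ x) x :=
  (h.smooth.differentiable (by simp) x).hasDerivAt

lemma deriv (h : IsTest I φ) : IsTest I (deriv φ) :=
  ⟨h.smooth.deriv', h.compact.deriv, tsupport_deriv_subset.trans h.support⟩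

lemma add (h : IsTest I φ) (h' : IsTest I χ) : IsTest I (fun x => φ x + χ x) :=
  ⟨h.smooth.add h'.smooth, h.compact.add h'.compact,
    (tsupport_add φ χ).trans (union_subset h.support h'.support)⟩

lemma mul_left (h : IsTest I φ) (hχ : ContDiff ℝ ∞ χ) : IsTest I (fun x => χ x * φ x) :=
  ⟨hχ.mul h.smooth, h.compact.mul_left, (tsupport_mul_subset_right).trans h.support⟩

lemma const_mul (h : IsTest I φ) (c : ℝ) : IsTest I (fun x => c * φ x) :=
  h.mul_left contDiff_const

lemma sub (h : IsTest I φ) (h' : IsTest I χ) : IsTest I (fun x => φ x - χ x) := by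
  simpa [sub_eq_add_neg] using h.add (h'.const_mul (-1))

lemma bounded (h : IsTest I φ) : ∃ C, 0 < C ∧ ∀ x, |φ x| ≤ C := by
  obtain ⟨C, hC⟩ := h.compact.exists_bound_of_continuous h.continuous
  exact ⟨max C 1, by positivity, fun x => (hC x).trans (le_max_left _ _)⟩

lemma eq_zero (h : IsTest I φ) {x : ℝ} (hx : x ∉ I) : φ x = 0 :=
  image_eq_zero_of_notMem_tsupport fun h' => hx (h.support h')

lemma setIntegral_eq (h : IsTest I φ) (f : ℝ → ℝ) :
    ∫ x in I, f x * φ x = ∫ x, f x * φ x :=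
  setIntegral_eq_integral_of_forall_compl_eq_zero fun x hx => by simp [h.eq_zero hx]

lemma integrable_mul (h : IsTest I φ) {f : ℝ → ℝ} (hf : LocallyIntegrableOn f I) :
    Integrable (fun x => f x * φ x) := by
  have h1 : IntegrableOn (fun x => f x * φ x) (tsupport φ) :=
    (hf.integrableOn_compact_subset h.support h.compact).mul_continuousOn
      h.continuous.continuousOn h.compact
  refine (integrableOn_iff_integrable_of_support_subset ?_).1 h1
  intro x hx
  exact subset_tsupport _ (right_ne_zero_of_mul hx)

/-- A bump function equal to `1` near `t`, supported in `(t - r, t + r)`. -/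
lemma exists_bump (t : ℝ) {r : ℝ} (hr : 0 < r) : ∃ ζ : ℝ → ℝ, IsTest (Ioo (t - r) (t + r)) ζ ∧
    (∀ x, 0 ≤ ζ x ∧ ζ x ≤ 1) ∧ ∀ x, |x - t| ≤ r / 2 → ζ x = 1 := by
  let f : ContDiffBump t := ⟨r / 2, 3 * r / 4, by positivity, by linarith⟩
  refine ⟨f, ⟨f.contDiff, f.hasCompactSupport, ?_⟩, fun x => ⟨f.nonneg, f.le_one⟩, fun x hx => ?_⟩
  · rw [f.tsupport_eq, Real.closedBall_eq_Icc]
    exact Icc_subset_Ioo (by simp [f]; linarith) (by simp [f]; linarith)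
  · exact f.one_of_mem_closedBall (by simpa [Real.dist_eq] using hx)

lemma exists_bump_subset (hI : IsOpen I) {t : ℝ} (ht : t ∈ I) : ∃ ζ : ℝ → ℝ, IsTest I ζ ∧
    (∀ x, 0 ≤ ζ x ∧ ζ x ≤ 1) ∧ ζ =ᶠ[𝓝 t] fun _ => 1 := by
  obtain ⟨r, hr, h⟩ := Metric.isOpen_iff.1 hI t ht
  obtain ⟨ζ, h1, h2, h3⟩ := exists_bump t hr
  refine ⟨ζ, h1.mono (by rwa [← Real.ball_eq_Ioo]), h2, ?_⟩
  filter_upwards [Metric.closedBall_mem_nhds t (half_pos hr)] with x hx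
  exact h3 x (by simpa [Real.dist_eq] using hx)

lemma exists_integral_eq_one (hI : IsOpen I) (hne : I.Nonempty) :
    ∃ ζ : ℝ → ℝ, IsTest I ζ ∧ ∫ x, ζ x = 1 := by
  obtain ⟨t, ht⟩ := hne
  obtain ⟨ζ, h1, h2, h3⟩ := exists_bump_subset hI ht
  have hpos : 0 < ∫ x, ζ x := by
    refine h1.continuous.integral_pos_of_hasCompactSupport_nonneg_nonzero (x := t) h1.compact
      (fun x => (h2 x).1) ?_
    rw [h3.eq_of_nhds]; simp
  refine ⟨_, h1.const_mul (∫ x, ζ x)⁻¹, ?_⟩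
  rw [integral_const_mul, inv_mul_cancel₀ hpos.ne']

end IsTest

lemma ae_eq_zero_of_integral_test {I : Set ℝ} (hI : IsOpen I) {f : ℝ → ℝ}
    (hf : LocallyIntegrableOn f I) (h : ∀ φ, IsTest I φ → ∫ x in I, f x * φ x = 0) :
    f =ᵐ[volume.restrict I] 0 := by
  rw [EventuallyEq, ae_restrict_iff' hI.measurableSet]
  refine hI.ae_eq_zero_of_integral_contDiff_smul_eq_zero hf fun φ h1 h2 h3 => ?_
  have ht : IsTest I φ := ⟨h1, h2, h3⟩
  rw [← h φ ht, ht.setIntegral_eq]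
  simp [mul_comm]

/-! ### Affine changes of variables -/

lemma map_affine (t : ℝ) {s : ℝ} (hs : s ≠ 0) :
    Measure.map (fun x : ℝ => s * x + t) volume = ENNReal.ofReal |s⁻¹| • volume := by
  have : (fun x : ℝ => s * x + t) = (fun x => x + t) ∘ (fun x => s * x) := rfl
  rw [this, ← Measure.map_map (by fun_prop) (by fun_prop), Real.map_volume_mul_left hs,
    Measure.map_smul, map_add_right_eq_self]

/-- The affine map `x ↦ s x + t` as a homeomorphism. -/
def affineHomeo (t : ℝ) {s : ℝ} (hs : s ≠ 0) : ℝ ≃ₜ ℝ :=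
  (Homeomorph.mulLeft₀ s hs).trans (Homeomorph.addRight t)

lemma measurableEmbedding_affine (t : ℝ) {s : ℝ} (hs : s ≠ 0) :
    MeasurableEmbedding (fun x : ℝ => s * x + t) := (affineHomeo t hs).measurableEmbedding

lemma quasiMeasurePreserving_affine (t : ℝ) {s : ℝ} (hs : s ≠ 0) :
    Measure.QuasiMeasurePreserving (fun x : ℝ => s * x + t) :=
  ⟨by fun_prop, by rw [map_affine t hs]; exact Measure.smul_absolutelyContinuous⟩

lemma integral_comp_affine (f : ℝ → ℝ) (t : ℝ) {s : ℝ} (hs : s ≠ 0) :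
    ∫ x, f (s * x + t) = |s⁻¹| * ∫ x, f x := by
  rw [← (measurableEmbedding_affine t hs).integral_map, map_affine t hs, integral_smul_measure,
    ENNReal.toReal_ofReal (abs_nonneg _), smul_eq_mul]

lemma lintegral_comp_affine (f : ℝ → ℝ≥0∞) (t : ℝ) {s : ℝ} (hs : s ≠ 0) :
    ∫⁻ x, f (s * x + t) = ENNReal.ofReal |s⁻¹| * ∫⁻ x, f x := by
  rw [← (measurableEmbedding_affine t hs).lintegral_map, map_affine t hs, lintegral_smul_measure,
    smul_eq_mul]

lemma memLp_comp_affine {f : ℝ → ℝ} {p : ℝ≥0∞} (hf : MemLp f p) (t : ℝ) {s : ℝ} (hs : s ≠ 0) :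
    MemLp (fun x => f (s * x + t)) p := by
  have := (measurableEmbedding_affine t hs).memLp_map_measure_iff (g := f) (p := p) (μ := volume)
  rw [map_affine t hs] at this
  exact this.1 (hf.smul_measure ENNReal.ofReal_ne_top)

lemma locallyIntegrable_comp_affine {f : ℝ → ℝ} (hf : LocallyIntegrable f) (t : ℝ) {s : ℝ}
    (hs : s ≠ 0) : LocallyIntegrable (fun x => f (s * x + t)) := by
  rw [locallyIntegrable_iff]
  intro K hK
  have h1 : IntegrableOn f ((fun x => s * x + t) '' K) :=
    hf.integrableOn_isCompact (hK.image (by fun_prop))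
  have h2 : IntegrableOn f ((fun x => s * x + t) '' K)
      (Measure.map (fun x : ℝ => s * x + t) volume) := by
    rw [map_affine t hs, IntegrableOn, Measure.restrict_smul]
    exact h1.smul_measure ENNReal.ofReal_ne_top
  have h3 := (measurableEmbedding_affine t hs).integrableOn_map_iff.1 h2
  rwa [preimage_image_eq _ (measurableEmbedding_affine t hs).injective] at h3

lemma intervalIntegrable_of_locallyIntegrable {g : ℝ → ℝ} (hg : LocallyIntegrable g) (x y : ℝ) :
    IntervalIntegrable g volume x y :=
  (hg.integrableOn_isCompact isCompact_uIcc).intervalIntegrable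

/-! ### Weak derivatives -/

namespace HasWeakDeriv

variable {I J : Set ℝ} {f g f' g' : ℝ → ℝ}

lemma congr (h : HasWeakDeriv I f g) (hf : f =ᵐ[volume.restrict I] f')
    (hg : g =ᵐ[volume.restrict I] g') : HasWeakDeriv I f' g' := by
  have key : ∀ {p q : ℝ → ℝ}, p =ᵐ[volume.restrict I] q → LocallyIntegrableOn p I →
      LocallyIntegrableOn q I := by
    intro p q hpq hp x hx
    obtain ⟨s, hs, hps⟩ := hp x hx
    obtain ⟨t, ht, hts⟩ := mem_nhdsWithin.1 hs
    refine ⟨t ∩ I, mem_nhdsWithin.2 ⟨t, ht, hts.1, subset_rfl⟩, ?_⟩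
    exact (hps.mono_set hts.2).congr (ae_mono (Measure.restrict_mono_set _ inter_subset_right) hpq)
  refine ⟨key hf h.1, key hg h.2, fun φ hφ => ?_⟩
  have e1 : ∫ x in I, f x * deriv φ x = ∫ x in I, f' x * deriv φ x :=
    integral_congr_ae (hf.mul (EventuallyEq.refl _ (deriv φ)))
  have e2 : ∫ x in I, g x * φ x = ∫ x in I, g' x * φ x :=
    integral_congr_ae (hg.mul (EventuallyEq.refl _ φ))
  rw [← e1, ← e2, h.3 φ hφ]

lemma unique (hI : IsOpen I) (h : HasWeakDeriv I f g) (h' : HasWeakDeriv I f g') :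
    g =ᵐ[volume.restrict I] g' := by
  have := ae_eq_zero_of_integral_test hI (f := fun x => g x - g' x) (h.2.sub h'.2) fun φ hφ => by
    have h1 := h.3 φ hφ
    have h2 := h'.3 φ hφ
    simp only [sub_mul]
    rw [integral_sub (hφ.integrable_mul h.2).integrableOn (hφ.integrable_mul h'.2).integrableOn]
    linarith
  filter_upwards [this] with x hx
  simpa [sub_eq_zero] using hx

lemma mono (h : HasWeakDeriv I f g) (hJI : J ⊆ I) : HasWeakDeriv J f g := by
  refine ⟨h.1.mono_set hJI, h.2.mono_set hJI, fun φ hφ => ?_⟩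
  have := h.3 φ (hφ.mono hJI)
  rwa [(hφ.mono hJI).deriv.setIntegral_eq, (hφ.mono hJI).setIntegral_eq, ← hφ.deriv.setIntegral_eq,
    ← hφ.setIntegral_eq] at this

lemma add (h : HasWeakDeriv I f g) (h' : HasWeakDeriv I f' g') :
    HasWeakDeriv I (fun x => f x + f' x) (fun x => g x + g' x) := by
  refine ⟨h.1.add h'.1, h.2.add h'.2, fun φ hφ => ?_⟩
  simp only [add_mul]
  rw [integral_add (hφ.deriv.integrable_mul h.1).integrableOn
    (hφ.deriv.integrable_mul h'.1).integrableOn, integral_add (hφ.integrable_mul h.2).integrableOn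
    (hφ.integrable_mul h'.2).integrableOn, h.3 φ hφ, h'.3 φ hφ]
  ring

lemma const_mul (h : HasWeakDeriv I f g) (c : ℝ) :
    HasWeakDeriv I (fun x => c * f x) (fun x => c * g x) := by
  refine ⟨h.1.smul c, h.2.smul c, fun φ hφ => ?_⟩
  simp only [mul_assoc]
  rw [integral_const_mul, integral_const_mul, h.3 φ hφ]
  ring

lemma sub (h : HasWeakDeriv I f g) (h' : HasWeakDeriv I f' g') :
    HasWeakDeriv I (fun x => f x - f' x) (fun x => g x - g' x) := by
  simpa [sub_eq_add_neg] using h.add (h'.const_mul (-1))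

lemma sum {ι : Type*} (s : Finset ι) {f g : ι → ℝ → ℝ} (h : ∀ i ∈ s, HasWeakDeriv I (f i) (g i)) :
    HasWeakDeriv I (fun x => ∑ i ∈ s, f i x) (fun x => ∑ i ∈ s, g i x) := by
  classical
  induction s using Finset.induction_on with
  | empty =>
    refine ⟨?_, ?_, fun φ hφ => by simp⟩ <;>
    · simp only [Finset.sum_empty]
      exact (locallyIntegrable_const (0 : ℝ)).locallyIntegrableOn _
  | insert i s hi ih =>
    simp only [Finset.sum_insert hi]
    exact (h i (Finset.mem_insert_self _ _)).add (ih fun j hj => h j (Finset.mem_insert_of_mem hj))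

/-- Leibniz rule against a test function; the product extends by zero to the whole line. -/
lemma mul_test {ζ : ℝ → ℝ} (hζ : IsTest I ζ) (h : HasWeakDeriv I f g) :
    HasWeakDeriv univ (fun x => f x * ζ x) (fun x => g x * ζ x + f x * deriv ζ x) := by
  have i1 := hζ.integrable_mul h.1
  have i2 := hζ.integrable_mul h.2
  have i3 := hζ.deriv.integrable_mul h.1
  refine ⟨i1.locallyIntegrable.locallyIntegrableOn _,
    (i2.add i3).locallyIntegrable.locallyIntegrableOn _, fun φ hφ => ?_⟩
  have t1 : IsTest I (fun x => φ x * ζ x) := hζ.mul_left hφ.smooth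
  have t2 : IsTest I (fun x => deriv φ x * ζ x) := hζ.mul_left hφ.deriv.smooth
  have t3 : IsTest I (fun x => φ x * deriv ζ x) := hζ.deriv.mul_left hφ.smooth
  have h1 := h.3 _ t1
  have hd : deriv (fun x => φ x * ζ x) = fun x => deriv φ x * ζ x + φ x * deriv ζ x := by
    funext x
    exact ((hφ.hasDerivAt x).mul (hζ.hasDerivAt x)).deriv
  rw [t1.setIntegral_eq, t1.deriv.setIntegral_eq, hd] at h1
  simp only [mul_add] at h1
  rw [integral_add (t2.integrable_mul h.1) (t3.integrable_mul h.1)] at h1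
  simp only [setIntegral_univ]
  have e1 : ∀ x, (g x * ζ x + f x * deriv ζ x) * φ x
      = g x * (φ x * ζ x) + f x * (φ x * deriv ζ x) := fun x => by ring
  have e2 : ∀ x, f x * ζ x * deriv φ x = f x * (deriv φ x * ζ x) := fun x => by ring
  simp only [e1, e2]
  rw [integral_add (t1.integrable_mul h.2) (t3.integrable_mul h.1)]
  linarith

/-- Negative `s` matters as well: `s = -1` reflects a phase field about its maximum point, while
positive `s` passes between the scale `ε` and the unit scale. -/
lemma comp_affine (h : HasWeakDeriv univ f g) (t : ℝ) {s : ℝ} (hs : s ≠ 0) :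
    HasWeakDeriv univ (fun x => f (s * x + t)) (fun x => s * g (s * x + t)) := by
  refine ⟨(locallyIntegrable_comp_affine (locallyIntegrableOn_univ.1 h.1) t
    hs).locallyIntegrableOn _, ((locallyIntegrable_comp_affine (locallyIntegrableOn_univ.1 h.2) t
    hs).smul s).locallyIntegrableOn _, fun φ hφ => ?_⟩
  have hφ' : IsTest univ (fun y => φ (s⁻¹ * y + -(s⁻¹ * t))) := by
    refine ⟨hφ.smooth.comp (by fun_prop), ?_, subset_univ _⟩
    exact hφ.compact.comp_homeomorph
      ((Homeomorph.mulLeft₀ s⁻¹ (inv_ne_zero hs)).trans (Homeomorph.addRight (-(s⁻¹ * t))))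
  have h1 := h.3 _ hφ'
  have hd : deriv (fun y => φ (s⁻¹ * y + -(s⁻¹ * t)))
      = fun y => s⁻¹ * deriv φ (s⁻¹ * y + -(s⁻¹ * t)) := by
    funext y
    have h3 : HasDerivAt (fun y : ℝ => s⁻¹ * y + -(s⁻¹ * t)) s⁻¹ y := by
      simpa using ((hasDerivAt_id y).const_mul s⁻¹).add_const (-(s⁻¹ * t))
    rw [mul_comm s⁻¹ (deriv φ _)]
    exact ((hφ.hasDerivAt _).comp y h3).deriv
  have hs' : ∀ x, s⁻¹ * (s * x + t) + -(s⁻¹ * t) = x := fun x => by field_simp; ring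
  rw [hd] at h1
  simp only [setIntegral_univ] at h1 ⊢
  have e1 := integral_comp_affine (fun y => f y * (s⁻¹ * deriv φ (s⁻¹ * y + -(s⁻¹ * t)))) t hs
  have e2 := integral_comp_affine (fun y => g y * φ (s⁻¹ * y + -(s⁻¹ * t))) t hs
  simp only [hs'] at e1 e2
  rw [h1] at e1
  have e3 : ∀ x, f (s * x + t) * (s⁻¹ * deriv φ x) = s⁻¹ * (f (s * x + t) * deriv φ x) :=
    fun x => by ring
  simp only [e3, mul_assoc s] at e1 ⊢
  rw [integral_const_mul] at e1 ⊢
  rw [e2]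
  rw [inv_mul_eq_iff_eq_mul₀ hs] at e1
  rw [e1, mul_neg, mul_neg]

end HasWeakDeriv

/-! ### Primitives and the du Bois-Reymond lemma -/

/-- The primitive of `g` with value `c` at `0`. -/
def primitive (c : ℝ) (g : ℝ → ℝ) (x : ℝ) : ℝ := c + ∫ t in (0 : ℝ)..x, g t

lemma continuous_primitive (c : ℝ) {g : ℝ → ℝ} (hg : LocallyIntegrable g) :
    Continuous (primitive c g) :=
  continuous_const.add (intervalIntegral.continuous_primitive
    (intervalIntegrable_of_locallyIntegrable hg) 0)

@[simp] lemma primitive_zero (c : ℝ) (g : ℝ → ℝ) : primitive c g 0 = c := by simp [primitive]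

/-- Integration by parts for absolutely continuous functions on an interval `[-R, R]` whose interior
contains the support of the test function, so that the boundary terms vanish. -/
lemma hasWeakDeriv_primitive (c : ℝ) {g : ℝ → ℝ} (hg : LocallyIntegrable g) :
    HasWeakDeriv univ (primitive c g) g := by
  have hc := continuous_primitive c hg
  refine ⟨hc.locallyIntegrable.locallyIntegrableOn _, hg.locallyIntegrableOn _, fun φ hφ => ?_⟩
  obtain ⟨R, hR, hsub⟩ : ∃ R, 0 < R ∧ tsupport φ ⊆ Ioo (-R) R := by
    obtain ⟨R, hR, h⟩ := hφ.compact.isCompact.isBounded.subset_ball_lt 0 0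
    exact ⟨R, hR, by simpa [Real.ball_eq_Ioo] using h⟩
  have t : IsTest (Ioo (-R) R) φ := ⟨hφ.smooth, hφ.compact, hsub⟩
  have key : ∀ {p χ : ℝ → ℝ}, IsTest (Ioo (-R) R) χ → ∫ x, p x * χ x = ∫ x in (-R)..R, p x * χ x := by
    intro p χ hχ
    rw [← hχ.setIntegral_eq, intervalIntegral.integral_of_le (by linarith),
      integral_Ioc_eq_integral_Ioo]
  have ac1 : AbsolutelyContinuousOnInterval (primitive c g) (-R) R := by
    have h1 := (intervalIntegrable_of_locallyIntegrable hg (-R) R).absolutelyContinuousOnInterval_intervalIntegral (c := 0)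
      (by rw [uIcc_of_le (by linarith)]; constructor <;> linarith)
    have h2 : AbsolutelyContinuousOnInterval (fun _ : ℝ => c) (-R) R :=
      (LipschitzWith.const c).lipschitzOnWith.absolutelyContinuousOnInterval (K := 0)
    exact h2.add h1
  have ac2 : AbsolutelyContinuousOnInterval φ (-R) R := by
    obtain ⟨K, hK⟩ := (hφ.smooth.of_le (m := 1) (by simp)).lipschitzWith_of_hasCompactSupport
      hφ.compact (by simp)
    exact hK.lipschitzOnWith.absolutelyContinuousOnInterval
  have hd := ac1.integral_mul_deriv_eq_deriv_mul ac2
  rw [t.eq_zero (by simp : R ∉ Ioo (-R) R), t.eq_zero (by simp : -R ∉ Ioo (-R) R)] at hd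
  have hae : ∀ᵐ x, deriv (primitive c g) x = g x := by
    filter_upwards [_root_.LocallyIntegrable.ae_hasDerivAt_integral hg] with x hx
    exact ((hx 0).const_add c).deriv
  rw [setIntegral_univ, setIntegral_univ, key t.deriv, key t, hd]
  simp only [mul_zero, sub_self, zero_sub, neg_inj]
  refine intervalIntegral.integral_congr_ae ?_
  filter_upwards [hae] with x hx _
  rw [hx]

/-- du Bois-Reymond lemma: a function with vanishing weak derivative is constant. -/
lemma ae_eq_const_of_integral_deriv {I : Set ℝ} (hI : IsOpen I) (hc : I.OrdConnected)
    {f : ℝ → ℝ} (hf : LocallyIntegrableOn f I)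
    (h : ∀ φ, IsTest I φ → ∫ x in I, f x * deriv φ x = 0) :
    ∃ c, ∀ᵐ x ∂volume.restrict I, f x = c := by
  rcases I.eq_empty_or_nonempty with rfl | hne
  · exact ⟨0, by simp⟩
  obtain ⟨ζ, hζ, hζ1⟩ := IsTest.exists_integral_eq_one hI hne
  refine ⟨∫ x, f x * ζ x, ?_⟩
  set c := ∫ x, f x * ζ x
  have hlc : LocallyIntegrableOn (fun _ : ℝ => c) I :=
    (locallyIntegrable_const c).locallyIntegrableOn _
  have := ae_eq_zero_of_integral_test hI (f := fun x => f x - c) (hf.sub hlc) fun φ hφ => by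
    set m := ∫ x, φ x
    -- Subtracting `m * ζ` makes the integral zero, so the primitive `Ψ` of `ψ` is again compactly
    -- supported and can itself serve as a test function.
    have hψ : IsTest I (fun x => φ x - m * ζ x) := hφ.sub (hζ.const_mul m)
    set ψ := fun x => φ x - m * ζ x with hψdef
    have hiφ : Integrable φ := hφ.continuous.integrable_of_hasCompactSupport hφ.compact
    have hiζ : Integrable ζ := hζ.continuous.integrable_of_hasCompactSupport hζ.compact
    have hi : Integrable ψ := hψ.continuous.integrable_of_hasCompactSupport hψ.compact
    have hψ0 : ∫ x, ψ x = 0 := by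
      rw [hψdef, integral_sub hiφ (hiζ.const_mul m), integral_const_mul, hζ1]
      simp [m]
    obtain ⟨A, B, hle, hA, hB, hAB⟩ : ∃ A B, A ≤ B ∧ A ∈ I ∧ B ∈ I ∧ tsupport ψ ⊆ Icc A B := by
      rcases (tsupport ψ).eq_empty_or_nonempty with h0 | h0
      · obtain ⟨x, hx⟩ := hne
        exact ⟨x, x, le_rfl, hx, hx, by simp [h0]⟩
      · have hk : IsCompact (tsupport ψ) := hψ.compact
        exact ⟨_, _, csInf_le_csSup h0 hk.bddBelow hk.bddAbove, hψ.support (hk.sInf_mem h0), hψ.support (hk.sSup_mem h0),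
          fun x hx => ⟨csInf_le hk.bddBelow hx, le_csSup hk.bddAbove hx⟩⟩
    have hz : ∀ x ∉ Icc A B, ψ x = 0 := fun x hx =>
      image_eq_zero_of_notMem_tsupport fun h' => hx (hAB h')
    have hzA : ψ A = 0 := by
      by_contra h'
      have h4 : ∃ᶠ y in 𝓝[<] A, ψ y = 0 := by
        refine Eventually.frequently ?_
        filter_upwards [self_mem_nhdsWithin] with y hy
        exact hz y fun h5 => absurd h5.1 (not_le.2 hy)
      exact h4 ((hψ.continuous.continuousAt.eventually_ne h').filter_mono nhdsWithin_le_nhds)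
    let Ψ : ℝ → ℝ := fun x => ∫ t in A..x, ψ t
    have hΨd : ∀ x, HasDerivAt Ψ (ψ x) x := fun x =>
      intervalIntegral.integral_hasDerivAt_right (hi.intervalIntegrable)
        (hψ.continuous.stronglyMeasurableAtFilter _ _) hψ.continuous.continuousAt
    have hΨ0 : ∀ x ∉ Icc A B, Ψ x = 0 := by
      intro x hx
      rw [mem_Icc, not_and_or, not_le, not_le] at hx
      rcases hx with hx | hx
      · refine (intervalIntegral.integral_congr (g := fun _ => 0) fun t ht => ?_).trans (by simp)
        rcases eq_or_ne t A with rfl | htA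
        · exact hzA
        · refine hz t fun h' => ?_
          rw [uIcc_of_ge hx.le] at ht
          exact htA (le_antisymm ht.2 h'.1)
      · rw [← hψ0]
        simp only [Ψ]
        rw [intervalIntegral.integral_of_le (hle.trans hx.le)]
        refine setIntegral_eq_integral_of_forall_compl_eq_zero fun y hy => ?_
        rcases eq_or_ne y A with rfl | hyA
        · exact hzA
        · exact hz y fun h' => hy ⟨lt_of_le_of_ne h'.1 hyA.symm, h'.2.trans hx.le⟩
    have hsm : ContDiff ℝ ∞ Ψ := by
      rw [contDiff_infty_iff_deriv]
      exact ⟨fun x => (hΨd x).differentiableAt, by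
        rw [show deriv Ψ = ψ from funext fun x => (hΨd x).deriv]; exact hψ.smooth⟩
    have hts : tsupport Ψ ⊆ Icc A B := closure_minimal
      (fun x hx => by_contra fun h' => hx (hΨ0 x h')) isClosed_Icc
    have hΨ : IsTest I Ψ := ⟨hsm, HasCompactSupport.intro isCompact_Icc hΨ0,
      hts.trans (hc.out hA hB)⟩
    have h1 := h Ψ hΨ
    rw [show deriv Ψ = ψ from funext fun x => (hΨd x).deriv, hψ.setIntegral_eq] at h1
    have e : ∀ x, f x * ψ x = f x * φ x - m * (f x * ζ x) := fun x => by simp [hψdef]; ring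
    simp only [e] at h1
    rw [integral_sub (hφ.integrable_mul hf) ((hζ.integrable_mul hf).const_mul m),
      integral_const_mul] at h1
    rw [hφ.setIntegral_eq]
    simp only [sub_mul]
    rw [integral_sub (hφ.integrable_mul hf) (hiφ.const_mul c), integral_const_mul]
    linarith
  filter_upwards [this] with x hx
  simpa [sub_eq_zero] using hx

/-- The difference of `f` and a primitive has zero weak derivative. The representative `g'` is
locally integrable on the whole line because `primitive` integrates from `0`, which need not lie in
`I`. -/
lemma HasWeakDeriv.exists_ae_eq_primitive {I : Set ℝ} (hI : IsOpen I) (hc : I.OrdConnected)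
    {f g g' : ℝ → ℝ} (h : HasWeakDeriv I f g) (hg' : LocallyIntegrable g')
    (hgg' : g =ᵐ[volume.restrict I] g') :
    ∃ c, f =ᵐ[volume.restrict I] primitive c g' := by
  have h1 := (h.congr (EventuallyEq.refl _ f) hgg').sub
    ((hasWeakDeriv_primitive 0 hg').mono (subset_univ I))
  obtain ⟨c, hc⟩ := ae_eq_const_of_integral_deriv hI hc h1.1 fun φ hφ => by simpa using h1.3 φ hφ
  refine ⟨c, ?_⟩
  filter_upwards [hc] with x hx
  simp only [primitive, zero_add] at hx ⊢
  linarith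

/-! ### The chosen weak derivative -/

lemma hasWeakDeriv_weakDeriv {I : Set ℝ} {f : ℝ → ℝ} (h : ∃ g, HasWeakDeriv I f g) :
    HasWeakDeriv I f (weakDeriv I f) := by
  rw [weakDeriv, dif_pos h]
  exact h.choose_spec

lemma HasWeakDeriv.weakDeriv_ae_eq {I : Set ℝ} (hI : IsOpen I) {f g : ℝ → ℝ}
    (h : HasWeakDeriv I f g) : weakDeriv I f =ᵐ[volume.restrict I] g :=
  (hasWeakDeriv_weakDeriv ⟨g, h⟩).unique hI h

/-- An equality of functions, not only almost everywhere: the choice is made from the predicate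
`HasWeakDeriv I f`, which depends only on the class of `f`. This permits rewriting inside an
iterated weak derivative. -/
lemma weakDeriv_congr {I : Set ℝ} {f f' : ℝ → ℝ} (h : f =ᵐ[volume.restrict I] f') :
    weakDeriv I f = weakDeriv I f' := by
  have : HasWeakDeriv I f = HasWeakDeriv I f' := funext fun g => propext
    ⟨fun h1 => h1.congr h (EventuallyEq.refl _ _), fun h1 => h1.congr h.symm (EventuallyEq.refl _ _)⟩
  unfold weakDeriv
  rw [this]

lemma MemH1.of_hasWeakDeriv {I : Set ℝ} (hI : IsOpen I) {f g : ℝ → ℝ}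
    (hf : MemLp f 2 (volume.restrict I)) (hg : MemLp g 2 (volume.restrict I))
    (h : HasWeakDeriv I f g) : MemH1 I f :=
  ⟨hf, ⟨g, h⟩, hg.ae_eq (h.weakDeriv_ae_eq hI).symm⟩

lemma MemH1.hasWeakDeriv {I : Set ℝ} {f : ℝ → ℝ} (h : MemH1 I f) :
    HasWeakDeriv I f (weakDeriv I f) := hasWeakDeriv_weakDeriv h.exists_deriv

lemma MemH1.congr {I : Set ℝ} {f f' : ℝ → ℝ} (hf : MemH1 I f) (h : f =ᵐ[volume.restrict I] f') :
    MemH1 I f' := by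
  obtain ⟨h1, ⟨g, hg⟩, h2⟩ := hf
  exact ⟨h1.ae_eq h, ⟨g, hg.congr h (EventuallyEq.refl _ _)⟩, weakDeriv_congr h ▸ h2⟩

/-! ### Square-integrable functions -/

section SquareIntegrable

variable {α : Type*} [MeasurableSpace α] {μ : Measure α} {f g : α → ℝ}

lemma norm_toLp_sq (hf : MemLp f 2 μ) : ‖hf.toLp f‖ ^ 2 = ∫ x, f x ^ 2 ∂μ := by
  rw [← real_inner_self_eq_norm_sq, L2.inner_def]
  refine integral_congr_ae ?_
  filter_upwards [hf.coeFn_toLp] with x hx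
  simp [hx, sq]

lemma inner_toLp (hf : MemLp f 2 μ) (hg : MemLp g 2 μ) :
    inner ℝ (hf.toLp f) (hg.toLp g) = ∫ x, f x * g x ∂μ := by
  rw [L2.inner_def]
  refine integral_congr_ae ?_
  filter_upwards [hf.coeFn_toLp, hg.coeFn_toLp] with x hx hy
  simp [hx, hy, mul_comm]

lemma norm_toLp_eq_sqrt (hf : MemLp f 2 μ) : ‖hf.toLp f‖ = √(∫ x, f x ^ 2 ∂μ) := by
  rw [← norm_toLp_sq hf, Real.sqrt_sq (norm_nonneg _)]

lemma abs_integral_mul_le_sqrt (hf : MemLp f 2 μ) (hg : MemLp g 2 μ) :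
    |∫ x, f x * g x ∂μ| ≤ √(∫ x, f x ^ 2 ∂μ) * √(∫ x, g x ^ 2 ∂μ) := by
  rw [← inner_toLp hf hg, ← norm_toLp_eq_sqrt hf, ← norm_toLp_eq_sqrt hg]
  exact abs_real_inner_le_norm _ _

end SquareIntegrable

/-! ### Profiles parametrized by their second derivative -/

/-- The profile on the half line with value `1` and slope `0` at `0` and second derivative `Q`. -/
def profile (Q : ℝ → ℝ) : ℝ → ℝ := primitive 1 (primitive 0 Q)

/-- The integrand of the transition energy of `profile Q`. -/
def profileDensity (ρ : ℝ) (Q : ℝ → ℝ) (x : ℝ) : ℝ :=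
  profile Q x + primitive 0 Q x ^ 2 + ρ * Q x ^ 2

/-- The second derivatives of the admissible profiles. -/
structure IsProfileData (ρ : ℝ) (Q : ℝ → ℝ) : Prop where
  memLp : MemLp Q 2
  eq_zero : ∀ x ≤ 0, Q x = 0
  mem_Icc : ∀ x, 0 < x → profile Q x ∈ Icc 0 1
  integrableOn : IntegrableOn (profileDensity ρ Q) (Ioi 0)

/-- Used to read off traces: the identity extends to the endpoint `0` by continuity. -/
lemma eqOn_Ici_of_ae_eq {f g : ℝ → ℝ} (h : f =ᵐ[volume.restrict (Ioi 0)] g)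
    (hf : ContinuousOn f (Ici 0)) (hg : ContinuousOn g (Ici 0)) : EqOn f g (Ici 0) := by
  rw [restrict_Ioi_eq_restrict_Ici] at h
  exact Measure.eqOn_of_ae_eq h hf hg (by simp [closure_Ioi])

lemma memW_of_hasWeakDeriv {V P Q : ℝ → ℝ} (hV : IntegrableOn V (Ioi 0))
    (hP : MemLp P 2 (volume.restrict (Ioi 0))) (hQ : MemLp Q 2 (volume.restrict (Ioi 0)))
    (hVP : HasWeakDeriv (Ioi 0) V P) (hPQ : HasWeakDeriv (Ioi 0) P Q)
    (hVc : HasTraceZero V 1) (hPc : HasTraceZero P 0) :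
    MemW V ∧ weakDeriv (Ioi 0) V =ᵐ[volume.restrict (Ioi 0)] P ∧
      weakDeriv (Ioi 0) (weakDeriv (Ioi 0) V) =ᵐ[volume.restrict (Ioi 0)] Q := by
  have h1 := hVP.weakDeriv_ae_eq isOpen_Ioi
  have h2 : weakDeriv (Ioi 0) (weakDeriv (Ioi 0) V) =ᵐ[volume.restrict (Ioi 0)] Q := by
    rw [weakDeriv_congr h1]
    exact hPQ.weakDeriv_ae_eq isOpen_Ioi
  refine ⟨⟨hV, ⟨P, hVP⟩, (MemH1.of_hasWeakDeriv isOpen_Ioi hP hQ hPQ).congr h1.symm, hVc, ?_⟩,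
    h1, h2⟩
  obtain ⟨g, hg, hPg, h0⟩ := hPc
  exact ⟨g, hg, h1.trans hPg, h0⟩

lemma transitionEnergy_eq {ρ : ℝ} {V V' P Q : ℝ → ℝ}
    (hV : V =ᵐ[volume.restrict (Ioi 0)] V')
    (h1 : weakDeriv (Ioi 0) V =ᵐ[volume.restrict (Ioi 0)] P)
    (h2 : weakDeriv (Ioi 0) (weakDeriv (Ioi 0) V) =ᵐ[volume.restrict (Ioi 0)] Q) :
    transitionEnergy ρ V = ∫ x in Ioi 0, (V' x + P x ^ 2 + ρ * Q x ^ 2) := by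
  refine integral_congr_ae ?_
  filter_upwards [hV, h1, h2] with x hx hx1 hx2
  rw [hx, hx1, hx2]

lemma hasWeakDeriv_profile {Q : ℝ → ℝ} (hQ : LocallyIntegrable Q) :
    HasWeakDeriv univ (profile Q) (primitive 0 Q) :=
  hasWeakDeriv_primitive 1 (continuous_primitive 0 hQ).locallyIntegrable

lemma continuous_profile {Q : ℝ → ℝ} (hQ : LocallyIntegrable Q) : Continuous (profile Q) :=
  continuous_primitive 1 (continuous_primitive 0 hQ).locallyIntegrable

namespace IsProfileData

variable {ρ : ℝ} {Q : ℝ → ℝ}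

lemma locallyIntegrable (h : IsProfileData ρ Q) : LocallyIntegrable Q :=
  h.memLp.locallyIntegrable (by norm_num)

/-- The three terms of the density are nonnegative on the half line, so their sum dominates each of
them. -/
lemma integrableOn_parts (hρ : 0 < ρ) (h : IsProfileData ρ Q) :
    IntegrableOn (profile Q) (Ioi 0) ∧ MemLp (primitive 0 Q) 2 (volume.restrict (Ioi 0)) := by
  have hm : AEStronglyMeasurable (primitive 0 Q) (volume.restrict (Ioi 0)) :=
    (continuous_primitive 0 h.locallyIntegrable).aestronglyMeasurable
  constructor
  · refine h.integrableOn.mono' (continuous_profile h.locallyIntegrable).aestronglyMeasurable ?_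
    filter_upwards [ae_restrict_mem measurableSet_Ioi] with x hx
    rw [Real.norm_of_nonneg (h.mem_Icc x hx).1, profileDensity]
    nlinarith [sq_nonneg (primitive 0 Q x), mul_nonneg hρ.le (sq_nonneg (Q x))]
  · rw [memLp_two_iff_integrable_sq hm]
    refine h.integrableOn.mono' (hm.pow 2) ?_
    filter_upwards [ae_restrict_mem measurableSet_Ioi] with x hx
    rw [Real.norm_of_nonneg (sq_nonneg _), profileDensity]
    nlinarith [(h.mem_Icc x hx).1, mul_nonneg hρ.le (sq_nonneg (Q x))]

lemma isAdmissibleProfile (hρ : 0 < ρ) (h : IsProfileData ρ Q) :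
    IsAdmissibleProfile (profile Q) ∧
      transitionEnergy ρ (profile Q) = ∫ x in Ioi 0, profileDensity ρ Q x := by
  have hl := h.locallyIntegrable
  obtain ⟨h1, h2⟩ := h.integrableOn_parts hρ
  obtain ⟨h3, h4, h5⟩ := memW_of_hasWeakDeriv h1 h2 (h.memLp.restrict _)
    ((hasWeakDeriv_profile hl).mono (subset_univ _))
    ((hasWeakDeriv_primitive 0 hl).mono (subset_univ _))
    ⟨_, (continuous_profile hl).continuousOn, EventuallyEq.refl _ _, primitive_zero _ _⟩
    ⟨_, (continuous_primitive 0 hl).continuousOn, EventuallyEq.refl _ _, primitive_zero _ _⟩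
  refine ⟨⟨h3, ?_⟩, transitionEnergy_eq (EventuallyEq.refl _ _) h4 h5⟩
  filter_upwards [ae_restrict_mem measurableSet_Ioi] with x hx using h.mem_Icc x hx

lemma density_nonneg (hρ : 0 < ρ) (h : IsProfileData ρ Q) {x : ℝ} (hx : 0 < x) :
    0 ≤ profileDensity ρ Q x := by
  have := (h.mem_Icc x hx).1
  unfold profileDensity
  positivity

end IsProfileData

/-- Converse of `IsProfileData.isAdmissibleProfile`: integrating `w''` twice, with the constants
fixed by the traces, recovers `w`. The minimization can therefore be carried out over `Q = w''`
alone. -/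
lemma IsAdmissibleProfile.exists_isProfileData {ρ : ℝ} {w : ℝ → ℝ} (h : IsAdmissibleProfile w) :
    ∃ Q, IsProfileData ρ Q ∧ transitionEnergy ρ w = ∫ x in Ioi 0, profileDensity ρ Q x := by
  obtain ⟨⟨hw, hex, hH1, ⟨gw, hgw, hwg, hgw0⟩, ⟨gp, hgp, hpg, hgp0⟩⟩, hb⟩ := h
  have hwP := hasWeakDeriv_weakDeriv hex
  have hPQ := hH1.hasWeakDeriv
  set P0 := weakDeriv (Ioi 0) w
  set Q0 := weakDeriv (Ioi 0) P0
  set Q := (Ioi (0 : ℝ)).indicator Q0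
  have hQ : MemLp Q 2 := (memLp_indicator_iff_restrict measurableSet_Ioi).2 hH1.memLp_deriv
  have hl : LocallyIntegrable Q := hQ.locallyIntegrable (by norm_num)
  have hQQ : Q0 =ᵐ[volume.restrict (Ioi 0)] Q := (indicator_ae_eq_restrict measurableSet_Ioi).symm
  obtain ⟨c, hc⟩ := hPQ.exists_ae_eq_primitive isOpen_Ioi ordConnected_Ioi hl hQQ
  have hc0 : c = 0 := by
    have := eqOn_Ici_of_ae_eq (hc.symm.trans hpg) (continuous_primitive c hl).continuousOn hgp
      self_mem_Ici
    simpa [hgp0] using this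
  subst hc0
  have hPl := (continuous_primitive 0 hl).locallyIntegrable (μ := volume)
  obtain ⟨d, hd⟩ := hwP.exists_ae_eq_primitive isOpen_Ioi ordConnected_Ioi hPl hc
  have hd1 : d = 1 := by
    have := eqOn_Ici_of_ae_eq (hd.symm.trans hwg) (continuous_primitive d hPl).continuousOn hgw
      self_mem_Ici
    simpa [hgw0] using this
  subst hd1
  change w =ᵐ[_] profile Q at hd
  have hbd : ∀ x, 0 < x → profile Q x ∈ Icc (0 : ℝ) 1 := by
    -- The bounds are known only almost everywhere, but a continuous function that agrees almost
    -- everywhere with its truncation agrees with it everywhere.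
    have h1 : profile Q =ᵐ[volume.restrict (Ioi 0)] fun x => min (max (profile Q x) 0) 1 := by
      filter_upwards [hd, hb] with x hx hx'
      rw [← hx, max_eq_left hx'.1, min_eq_left hx'.2]
    have hcont := continuous_profile hl
    have h2 := eqOn_Ici_of_ae_eq h1 hcont.continuousOn (by fun_prop)
    intro x hx
    rw [h2 hx.le]
    exact ⟨le_min (le_max_right _ _) zero_le_one, min_le_right _ _⟩
  refine ⟨Q, ⟨hQ, fun x hx => indicator_of_notMem (by simpa using hx) _, hbd, ?_⟩,
    transitionEnergy_eq hd hc hQQ⟩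
  exact ((hw.congr hd).add (hH1.memLp.ae_eq hc).integrable_sq).add
    ((hQ.restrict _).integrable_sq.const_mul ρ)

lemma hasWeakDeriv_const (c : ℝ) : HasWeakDeriv univ (fun _ => c) (fun _ => 0) := by
  have := hasWeakDeriv_primitive c (g := fun _ => 0) (locallyIntegrable_const 0)
  convert this using 2
  simp [primitive]

lemma IsTest.hasWeakDeriv {φ : ℝ → ℝ} {I : Set ℝ} (h : IsTest I φ) :
    HasWeakDeriv univ φ (_root_.deriv φ) := by
  simpa using (hasWeakDeriv_const 1).mul_test (h.mono (subset_univ I))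

lemma IsTest.memLp {φ : ℝ → ℝ} {I : Set ℝ} (h : IsTest I φ) (p : ℝ≥0∞) : MemLp φ p :=
  h.continuous.memLp_of_hasCompactSupport h.compact

/-- A bump function centred at `0` works: `0` is a maximum point, so the slope vanishes there. -/
lemma exists_isAdmissibleProfile : ∃ w, IsAdmissibleProfile w := by
  obtain ⟨ζ, h1, h2, h3⟩ := IsTest.exists_bump 0 one_pos
  have h0 : ζ 0 = 1 := h3 0 (by simp)
  have hd0 : deriv ζ 0 = 0 := IsLocalMax.deriv_eq_zero
    (Eventually.of_forall fun x => by rw [h0]; exact (h2 x).2)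
  refine ⟨ζ, (memW_of_hasWeakDeriv (memLp_one_iff_integrable.1 (h1.memLp 1)).integrableOn
    ((h1.deriv.memLp 2).restrict _) ((h1.deriv.deriv.memLp 2).restrict _)
    (h1.hasWeakDeriv.mono (subset_univ _)) (h1.deriv.hasWeakDeriv.mono (subset_univ _))
    ⟨_, h1.continuous.continuousOn, EventuallyEq.refl _ _, h0⟩
    ⟨_, h1.deriv.continuous.continuousOn, EventuallyEq.refl _ _, hd0⟩).1, ae_of_all _ h2⟩

/-! ### Existence of an optimal profile -/

lemma primitive_midpoint (c : ℝ) {f g : ℝ → ℝ} (hf : LocallyIntegrable f)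
    (hg : LocallyIntegrable g) (x : ℝ) :
    primitive c (fun t => (f t + g t) / 2) x = (primitive c f x + primitive c g x) / 2 := by
  simp only [primitive]
  rw [intervalIntegral.integral_div, intervalIntegral.integral_add
    (intervalIntegrable_of_locallyIntegrable hf 0 x) (intervalIntegrable_of_locallyIntegrable hg 0 x)]
  ring

lemma profile_midpoint {f g : ℝ → ℝ} (hf : LocallyIntegrable f)
    (hg : LocallyIntegrable g) (x : ℝ) :
    profile (fun t => (f t + g t) / 2) x = (profile f x + profile g x) / 2 := by
  unfold profile
  rw [funext (primitive_midpoint 0 hf hg)]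
  exact primitive_midpoint 1 (continuous_primitive 0 hf).locallyIntegrable
    (continuous_primitive 0 hg).locallyIntegrable x

/-- Uniform convexity of the transition energy in the second derivative. -/
lemma IsProfileData.midpoint {ρ : ℝ} (hρ : 0 < ρ) {Q R : ℝ → ℝ} (hQ : IsProfileData ρ Q)
    (hR : IsProfileData ρ R) :
    IsProfileData ρ (fun t => (Q t + R t) / 2) ∧
      (∫ x in Ioi 0, profileDensity ρ (fun t => (Q t + R t) / 2) x)
          + ρ / 4 * ∫ x, (Q x - R x) ^ 2
        ≤ ((∫ x in Ioi 0, profileDensity ρ Q x) + ∫ x in Ioi 0, profileDensity ρ R x) / 2 := by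
  have hQl := hQ.locallyIntegrable
  have hRl := hR.locallyIntegrable
  have hm : MemLp (fun t => (Q t + R t) / 2) 2 := by
    simpa [div_eq_inv_mul] using (hQ.memLp.add hR.memLp).const_mul (2⁻¹ : ℝ)
  have hml : LocallyIntegrable (fun t => (Q t + R t) / 2) := hm.locallyIntegrable (by norm_num)
  have hle : ∀ x, profileDensity ρ (fun t => (Q t + R t) / 2) x + ρ / 4 * (Q x - R x) ^ 2
      ≤ (profileDensity ρ Q x + profileDensity ρ R x) / 2 := by
    intro x
    simp only [profileDensity, profile_midpoint hQl hRl, primitive_midpoint 0 hQl hRl]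
    nlinarith [sq_nonneg (primitive 0 Q x - primitive 0 R x)]
  have hb : ∀ x, 0 < x → profile (fun t => (Q t + R t) / 2) x ∈ Icc (0 : ℝ) 1 := by
    intro x hx
    rw [profile_midpoint hQl hRl]
    have h1 := hQ.mem_Icc x hx
    have h2 := hR.mem_Icc x hx
    constructor <;> linarith [h1.1, h1.2, h2.1, h2.2]
  have hi : IntegrableOn (fun x => (profileDensity ρ Q x + profileDensity ρ R x) / 2) (Ioi 0) :=
    (hQ.integrableOn.add hR.integrableOn).div_const 2
  have hmi : IntegrableOn (profileDensity ρ (fun t => (Q t + R t) / 2)) (Ioi 0) := by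
    refine hi.mono' ?_ ?_
    · exact (((continuous_profile hml).aestronglyMeasurable).add
        ((continuous_primitive 0 hml).aestronglyMeasurable.pow 2)).add
        ((hm.restrict _).1.pow 2 |>.const_mul ρ)
    · filter_upwards [ae_restrict_mem measurableSet_Ioi] with x hx
      have h0 := (hb x hx).1
      rw [Real.norm_of_nonneg (by unfold profileDensity; positivity)]
      have := hle x
      have : 0 ≤ ρ / 4 * (Q x - R x) ^ 2 := by positivity
      linarith
  have hd : Integrable (fun x => (Q x - R x) ^ 2) := (hQ.memLp.sub hR.memLp).integrable_sq
  refine ⟨⟨hm, fun x hx => by simp [hQ.eq_zero x hx, hR.eq_zero x hx], hb, hmi⟩, ?_⟩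
  have hset : ∫ x, (Q x - R x) ^ 2 = ∫ x in Ioi 0, (Q x - R x) ^ 2 :=
    (setIntegral_eq_integral_of_forall_compl_eq_zero fun x hx => by
      have : x ≤ 0 := by simpa using hx
      simp [hQ.eq_zero x this, hR.eq_zero x this]).symm
  rw [hset, ← integral_const_mul, ← integral_add hmi (hd.integrableOn.const_mul _),
    ← integral_add hQ.integrableOn hR.integrableOn, ← integral_div]
  exact integral_mono (hmi.add (hd.integrableOn.const_mul _)) hi hle

/-- Cauchy–Schwarz on `(0, x]`. It turns L² convergence of second derivatives into pointwise
convergence of slopes and profiles. -/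
lemma abs_primitive_sub_le {f g : ℝ → ℝ} (hf : MemLp f 2) (hg : MemLp g 2) (c : ℝ) {x : ℝ}
    (hx : 0 ≤ x) :
    |primitive c f x - primitive c g x| ≤ √x * √(∫ t, (f t - g t) ^ 2) := by
  have hfl := hf.locallyIntegrable (μ := volume) (by norm_num)
  have hgl := hg.locallyIntegrable (μ := volume) (by norm_num)
  have h1 : primitive c f x - primitive c g x
      = ∫ t, (Ioc 0 x).indicator (fun _ => (1 : ℝ)) t * (f t - g t) := by
    simp only [primitive]
    rw [add_sub_add_left_eq_sub, ← intervalIntegral.integral_sub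
      (intervalIntegrable_of_locallyIntegrable hfl 0 x)
      (intervalIntegrable_of_locallyIntegrable hgl 0 x), intervalIntegral.integral_of_le hx,
      ← integral_indicator measurableSet_Ioc]
    congr with t
    by_cases ht : t ∈ Ioc 0 x <;> simp [ht]
  have h2 : MemLp ((Ioc 0 x).indicator (fun _ => (1 : ℝ))) 2 :=
    memLp_indicator_const 2 measurableSet_Ioc 1 (Or.inr (by simp))
  rw [h1]
  refine (abs_integral_mul_le_sqrt h2 (hf.sub hg)).trans_eq ?_
  congr 2
  have : ∀ t, (Ioc 0 x).indicator (fun _ => (1 : ℝ)) t ^ 2 = (Ioc 0 x).indicator (fun _ => 1) t := by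
    intro t
    by_cases ht : t ∈ Ioc 0 x <;> simp [ht]
  simp only [this]
  rw [integral_indicator measurableSet_Ioc]
  simp [hx]

/-- The direct method: a minimizing sequence is Cauchy by uniform convexity. -/
theorem exists_isOptimalProfile {ρ : ℝ} (hρ : 0 < ρ) : ∃ w, IsOptimalProfile ρ w := by
  set S := {e | ∃ Q, IsProfileData ρ Q ∧ e = ∫ x in Ioi 0, profileDensity ρ Q x} with hS
  have hne : S.Nonempty := by
    obtain ⟨w, hw⟩ := exists_isAdmissibleProfile
    obtain ⟨Q, hQ, -⟩ := hw.exists_isProfileData (ρ := ρ)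
    exact ⟨_, Q, hQ, rfl⟩
  have hbdd : BddBelow S := by
    refine ⟨0, ?_⟩
    rintro e ⟨Q, hQ, rfl⟩
    exact setIntegral_nonneg measurableSet_Ioi fun x hx => hQ.density_nonneg hρ hx
  set m := sInf S
  have hex : ∀ n : ℕ, ∃ Q, IsProfileData ρ Q ∧
      ∫ x in Ioi 0, profileDensity ρ Q x < m + 1 / ((n : ℝ) + 1) := by
    intro n
    obtain ⟨e, ⟨Q, hQ, rfl⟩, he⟩ := exists_lt_of_csInf_lt hne
      (lt_add_of_pos_right m (Nat.one_div_pos_of_nat (α := ℝ) (n := n)))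
    exact ⟨Q, hQ, he⟩
  choose Q hQ hQm using hex
  have hlow : ∀ R, IsProfileData ρ R → m ≤ ∫ x in Ioi 0, profileDensity ρ R x :=
    fun R hR => csInf_le hbdd ⟨R, hR, rfl⟩
  -- The midpoint of two almost minimizers still has energy at least `m`, so the convexity gain `ρ /
  -- 4 * ∫ (Q n - Q k) ^ 2` is at most their excess over `m`.
  have hcau : ∀ N n k : ℕ, N ≤ n → N ≤ k →
      ∫ x, (Q n x - Q k x) ^ 2 ≤ 4 / ρ * (1 / ((N : ℝ) + 1)) := by
    intro N n k hn hk
    obtain ⟨h1, h2⟩ := (hQ n).midpoint hρ (hQ k)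
    have h3 := hlow _ h1
    have h4 := hQm n
    have h5 := hQm k
    have h6 := Nat.one_div_le_one_div (α := ℝ) hn
    have h7 := Nat.one_div_le_one_div (α := ℝ) hk
    rw [div_mul_eq_mul_div, le_div_iff₀ hρ]
    linarith
  let q : ℕ → Lp ℝ 2 (volume : Measure ℝ) := fun n => (hQ n).memLp.toLp (Q n)
  have hdist : ∀ n k, dist (q n) (q k) = √(∫ x, (Q n x - Q k x) ^ 2) := by
    intro n k
    rw [dist_eq_norm, ← MemLp.toLp_sub, norm_toLp_eq_sqrt]
    rfl
  have hlim0 : Tendsto (fun N : ℕ => √(4 / ρ * (1 / ((N : ℝ) + 1)))) atTop (𝓝 0) := by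
    have := (Real.continuous_sqrt.tendsto _).comp
      ((tendsto_one_div_add_atTop_nhds_zero_nat (𝕜 := ℝ)).const_mul (4 / ρ))
    simpa [Function.comp_def] using this
  have hc : CauchySeq q := cauchySeq_of_le_tendsto_0 _
    (fun n k N hn hk => by rw [hdist]; exact Real.sqrt_le_sqrt (hcau N n k hn hk)) hlim0
  obtain ⟨q0, hq0⟩ := cauchySeq_tendsto_of_complete hc
  obtain ⟨ns, hns, hae⟩ := (tendstoInMeasure_of_tendsto_Lp hq0).exists_seq_tendsto_ae
  -- An L² limit is only an almost everywhere class; the indicator restores the exact vanishing on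
  -- the nonpositive axis.
  set R := (Ioi (0 : ℝ)).indicator q0
  have hR2 : MemLp R 2 := (Lp.memLp q0).indicator measurableSet_Ioi
  have haeR : ∀ᵐ x, Tendsto (fun k => Q (ns k) x) atTop (𝓝 (R x)) := by
    have h1 : ∀ᵐ x, ∀ k, q (ns k) x = Q (ns k) x := ae_all_iff.2 fun k => MemLp.coeFn_toLp _
    filter_upwards [hae, h1] with x hx hx'
    simp only [hx'] at hx
    by_cases h0 : x ∈ Ioi (0 : ℝ)
    · simpa [R, h0] using hx
    · simp only [R, indicator_of_notMem h0]
      simp [fun k => (hQ k).eq_zero x (by simpa using h0)]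
  have hRq : R =ᵐ[volume] q0 := by
    have h1 : ∀ᵐ x, ∀ k, q (ns k) x = Q (ns k) x := ae_all_iff.2 fun k => MemLp.coeFn_toLp _
    filter_upwards [hae, haeR, h1] with x hx hx' h1
    simp only [h1] at hx
    exact tendsto_nhds_unique hx' hx
  have hl2 : Tendsto (fun n => √(∫ x, (Q n x - R x) ^ 2)) atTop (𝓝 0) := by
    have h1 := tendsto_iff_dist_tendsto_zero.1 hq0
    refine h1.congr fun n => ?_
    have h2 : q0 = hR2.toLp R := by
      apply Lp.ext
      exact hRq.symm.trans (MemLp.coeFn_toLp _).symm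
    rw [h2, dist_eq_norm, ← MemLp.toLp_sub, norm_toLp_eq_sqrt]
    rfl
  have hRl : LocallyIntegrable R := hR2.locallyIntegrable (by norm_num)
  have hPt : ∀ x, 0 ≤ x → Tendsto (fun n => primitive 0 (Q n) x) atTop (𝓝 (primitive 0 R x)) := by
    intro x hx
    rw [tendsto_iff_dist_tendsto_zero]
    refine squeeze_zero (fun _ => dist_nonneg)
      (fun n => abs_primitive_sub_le (hQ n).memLp hR2 0 hx) ?_
    simpa using hl2.const_mul (√x)
  have hWt : ∀ x, 0 ≤ x → Tendsto (fun n => profile (Q n) x) atTop (𝓝 (profile R x)) := by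
    intro x hx
    rw [tendsto_iff_dist_tendsto_zero]
    refine squeeze_zero (g := fun n => (√x * √(∫ x, (Q n x - R x) ^ 2)) * |x - 0|)
      (fun _ => dist_nonneg) (fun n => ?_) ?_
    · have hc1 := continuous_primitive 0 (hQ n).locallyIntegrable
      have hc2 := continuous_primitive 0 hRl
      rw [Real.dist_eq, profile, profile, primitive, primitive, add_sub_add_left_eq_sub,
        ← intervalIntegral.integral_sub (hc1.intervalIntegrable _ _) (hc2.intervalIntegrable _ _),
        ← Real.norm_eq_abs]
      refine intervalIntegral.norm_integral_le_of_norm_le_const fun t ht => ?_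
      rw [uIoc_of_le hx] at ht
      refine (abs_primitive_sub_le (hQ n).memLp hR2 0 ht.1.le).trans ?_
      gcongr
      exact ht.2
    · simpa using (hl2.const_mul (√x)).mul_const |x - 0|
  have hb : ∀ x, 0 < x → profile R x ∈ Icc (0 : ℝ) 1 := fun x hx =>
    isClosed_Icc.mem_of_tendsto (hWt x hx.le) (Eventually.of_forall fun n => (hQ n).mem_Icc x hx)
  have hmeas : AEStronglyMeasurable (profileDensity ρ R) (volume.restrict (Ioi 0)) :=
    (((continuous_profile hRl).aestronglyMeasurable).add
        ((continuous_primitive 0 hRl).aestronglyMeasurable.pow 2)).add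
        ((hR2.restrict _).1.pow 2 |>.const_mul ρ)
  have hnn : ∀ x, 0 < x → 0 ≤ profileDensity ρ R x := fun x hx => by
    have := (hb x hx).1
    unfold profileDensity
    positivity
  -- Fatou's lemma along an almost everywhere convergent subsequence of the `Q n`. It yields both
  -- the integrability of the limit density and its minimality.
  have hfatou : ∫⁻ x in Ioi 0, ENNReal.ofReal (profileDensity ρ R x) ≤ ENNReal.ofReal m := by
    have hconv : ∀ᵐ x ∂volume.restrict (Ioi (0 : ℝ)),
        ENNReal.ofReal (profileDensity ρ R x)
          = liminf (fun k => ENNReal.ofReal (profileDensity ρ (Q (ns k)) x)) atTop := by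
      filter_upwards [ae_restrict_mem measurableSet_Ioi, ae_restrict_of_ae haeR] with x hx hx'
      refine (Tendsto.liminf_eq ?_).symm
      refine (ENNReal.continuous_ofReal.tendsto _).comp ?_
      exact (((hWt x (le_of_lt hx)).comp hns.tendsto_atTop).add
        (((hPt x (le_of_lt hx)).comp hns.tendsto_atTop).pow 2)).add ((hx'.pow 2).const_mul ρ)
    rw [lintegral_congr_ae hconv]
    refine (lintegral_liminf_le' fun k =>
      ((hQ (ns k)).integrableOn.1.aemeasurable.ennreal_ofReal)).trans ?_
    have h1 : ∀ k, ∫⁻ x in Ioi 0, ENNReal.ofReal (profileDensity ρ (Q (ns k)) x)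
        ≤ ENNReal.ofReal (m + 1 / ((ns k : ℝ) + 1)) := by
      intro k
      rw [← ofReal_integral_eq_lintegral_ofReal (hQ (ns k)).integrableOn]
      · exact ENNReal.ofReal_le_ofReal (hQm (ns k)).le
      · filter_upwards [ae_restrict_mem measurableSet_Ioi] with x hx
        exact (hQ _).density_nonneg hρ hx
    refine (liminf_le_liminf (Eventually.of_forall h1)).trans_eq (Tendsto.liminf_eq ?_)
    refine (ENNReal.continuous_ofReal.tendsto _).comp ?_
    simpa using ((tendsto_one_div_add_atTop_nhds_zero_nat (𝕜 := ℝ)).comp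
      hns.tendsto_atTop).const_add m
  have hnn' : 0 ≤ᵐ[volume.restrict (Ioi 0)] profileDensity ρ R := by
    filter_upwards [ae_restrict_mem measurableSet_Ioi] with x hx using hnn x hx
  have hRd : IsProfileData ρ R := by
    refine ⟨hR2, fun x hx => indicator_of_notMem (by simpa using hx) _, hb, hmeas, ?_⟩
    rw [hasFiniteIntegral_iff_ofReal hnn']
    exact hfatou.trans_lt ENNReal.ofReal_lt_top
  have hm0 : 0 ≤ m := le_csInf hne fun e ⟨Q, hQ, he⟩ => he ▸
    setIntegral_nonneg measurableSet_Ioi fun x hx => hQ.density_nonneg hρ hx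
  obtain ⟨ha, he⟩ := hRd.isAdmissibleProfile hρ
  refine ⟨_, ha, fun z hz => ?_⟩
  obtain ⟨Z, hZ, hZe⟩ := hz.exists_isProfileData (ρ := ρ)
  rw [he, hZe]
  refine le_trans ?_ (hlow Z hZ)
  rw [← ofReal_integral_eq_lintegral_ofReal hRd.integrableOn hnn'] at hfatou
  exact (ENNReal.ofReal_le_ofReal_iff hm0).1 hfatou

/-! ### Energy of a localized transition -/

/-- The integrand `ε⁻¹ s + ε p² + ρ ε³ q²` of the surface energy. -/
def surfaceDensity (ρ ε s p q : ℝ) : ℝ := ε⁻¹ * s + ε * p ^ 2 + ρ * ε ^ 3 * q ^ 2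

lemma surfaceDensity_nonneg {ρ ε s : ℝ} (hρ : 0 < ρ) (hε : 0 < ε) (hs : 0 ≤ s) (p q : ℝ) :
    0 ≤ surfaceDensity ρ ε s p q := by
  unfold surfaceDensity
  positivity

lemma memLp_mul_test {I : Set ℝ} (hI : IsOpen I) {f ζ : ℝ → ℝ} (hf : MemLp f 2 (volume.restrict I))
    (hζ : IsTest I ζ) : MemLp (fun x => f x * ζ x) 2 := by
  obtain ⟨C, -, hC⟩ := hζ.bounded
  have h1 : MemLp (fun x => f x * ζ x) 2 (volume.restrict I) := by
    refine hf.of_le_mul (c := C) (hf.1.mul hζ.continuous.aestronglyMeasurable) (ae_of_all _ fun x => ?_)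
    rw [norm_mul, mul_comm]
    exact mul_le_mul_of_nonneg_right (hC x) (norm_nonneg _)
  rw [← memLp_indicator_iff_restrict hI.measurableSet] at h1
  have h2 : I.indicator (fun x => f x * ζ x) = fun x => f x * ζ x := by
    funext x
    by_cases hx : x ∈ I
    · rw [indicator_of_mem hx]
    · rw [indicator_of_notMem hx, hζ.eq_zero hx, mul_zero]
  rwa [h2] at h1

lemma eq_of_ae_eq {f g : ℝ → ℝ} (h : f =ᵐ[volume] g) (hf : Continuous f) (hg : Continuous g) :
    f = g := (hf.ae_eq_iff_eq volume hg).1 h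

lemma integral_Ioi_add_neg {D : ℝ → ℝ} (hD : Integrable D) (x₀ : ℝ) :
    (∫ y in Ioi 0, D (y + x₀)) + ∫ y in Ioi 0, D (-y + x₀) = ∫ x, D x := by
  have h1 := integral_comp_neg_Ioi (c := 0) (fun y => D (y + x₀))
  have h2 : Integrable (fun y => D (y + x₀)) := hD.comp_add_right x₀
  rw [h1, neg_zero, add_comm, ← compl_Iic, integral_add_compl measurableSet_Iic h2,
    integral_add_right_eq_self]

lemma transitionEnergy_nonneg {ρ : ℝ} (hρ : 0 < ρ) {w : ℝ → ℝ} (hw : IsAdmissibleProfile w) :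
    0 ≤ transitionEnergy ρ w := by
  refine integral_nonneg_of_ae ?_
  filter_upwards [hw.2] with x hx
  have := hx.1
  simp only [Pi.zero_apply]
  positivity

/-- A compactly supported phase field on the line exceeding `M` pays for two transitions. -/
lemma two_mul_transitionEnergy_le {ρ : ℝ} (hρ : 0 < ρ) {w : ℝ → ℝ} (hw : IsOptimalProfile ρ w)
    {V V1 V2 : ℝ → ℝ} (h1 : HasWeakDeriv univ V V1) (h2 : HasWeakDeriv univ V1 V2)
    (hL1 : MemLp V1 2) (hL2 : MemLp V2 2) (hb : ∀ᵐ x, 0 ≤ V x ∧ V x ≤ 1)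
    (hsupp : HasCompactSupport V) {M : ℝ} (hM : 0 < M) (hVM : ¬ ∀ᵐ x, V x ≤ M) :
    2 * transitionEnergy ρ w * M ^ 2 ≤ ∫ x, (V x + V1 x ^ 2 + ρ * V2 x ^ 2) := by
  have hl2 : LocallyIntegrable V2 := hL2.locallyIntegrable (by norm_num)
  obtain ⟨c, hc⟩ := h2.exists_ae_eq_primitive isOpen_univ ordConnected_univ hl2 (EventuallyEq.refl _ _)
  rw [Measure.restrict_univ] at hc
  set P := primitive c V2
  have hPc : Continuous P := continuous_primitive c hl2
  obtain ⟨d, hd⟩ := h1.exists_ae_eq_primitive isOpen_univ ordConnected_univ hPc.locallyIntegrable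
    (by rwa [Measure.restrict_univ])
  rw [Measure.restrict_univ] at hd
  set W := primitive d P
  have hWc : Continuous W := continuous_primitive d hPc.locallyIntegrable
  have hWP : HasWeakDeriv univ W P := hasWeakDeriv_primitive d hPc.locallyIntegrable
  have hPV : HasWeakDeriv univ P V2 := hasWeakDeriv_primitive c hl2
  have hWd : ∀ x, HasDerivAt W (P x) x := fun x =>
    (intervalIntegral.integral_hasDerivAt_right (hPc.intervalIntegrable _ _)
      (hPc.stronglyMeasurableAtFilter _ _) hPc.continuousAt).const_add d
  have hW0 : ∀ x, 0 ≤ W x := by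
    have : W = fun x => max (W x) 0 := eq_of_ae_eq (by
      filter_upwards [hd, hb] with x hx hx'
      rw [← hx, max_eq_left hx'.1]) hWc (by fun_prop)
    intro x
    rw [this]
    exact le_max_right _ _
  have hW1 : ∀ x, W x ≤ 1 := by
    have : W = fun x => min (W x) 1 := eq_of_ae_eq (by
      filter_upwards [hd, hb] with x hx hx'
      rw [← hx, min_eq_left hx'.2]) hWc (by fun_prop)
    intro x
    rw [this]
    exact min_le_right _ _
  have hWsupp : HasCompactSupport W := by
    refine HasCompactSupport.intro hsupp fun x hx => ?_
    have hopen : IsOpen (tsupport V)ᶜ := (isClosed_tsupport V).isOpen_compl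
    have h0 : W =ᵐ[volume.restrict (tsupport V)ᶜ] fun _ => 0 := by
      filter_upwards [ae_restrict_of_ae hd, ae_restrict_mem hopen.measurableSet] with x hx hx'
      rw [← hx, image_eq_zero_of_notMem_tsupport hx']
    exact Measure.eqOn_open_of_ae_eq h0 hopen hWc.continuousOn continuousOn_const hx
  obtain ⟨x₀, hx₀⟩ := hWc.exists_forall_ge_of_hasCompactSupport hWsupp
  set m := W x₀
  have hMm : M < m := by
    by_contra! h'
    refine hVM ?_
    filter_upwards [hd] with x hx
    rw [hx]
    exact (hx₀ x).trans h'
  have hm : 0 < m := hM.trans hMm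
  have hm1 : m ≤ 1 := hW1 x₀
  -- Zero slope at the maximum: both halves of `W` starting at `x₀`, divided by `m`, satisfy the
  -- boundary conditions of an admissible profile.
  have hP0 : P x₀ = 0 := IsLocalMax.hasDerivAt_eq_zero (Eventually.of_forall hx₀) (hWd x₀)
  have hPL : MemLp P 2 := hL1.ae_eq hc
  have hWi : Integrable W := hWc.integrable_of_hasCompactSupport hWsupp
  set D : ℝ → ℝ := fun x => m⁻¹ * W x + (m⁻¹ * P x) ^ 2 + ρ * (m⁻¹ * V2 x) ^ 2 with hDdef
  have hDi : Integrable D := ((hWi.const_mul _).add (hPL.const_mul m⁻¹).integrable_sq).add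
    ((hL2.const_mul m⁻¹).integrable_sq.const_mul ρ)
  -- `s = 1` gives the half to the right of `x₀`, `s = -1` the reflected left half.
  have key : ∀ s : ℝ, s ^ 2 = 1 →
      transitionEnergy ρ w ≤ ∫ y in Ioi 0, D (s * y + x₀) := by
    intro s hs
    have hs0 : s ≠ 0 := by rintro rfl; norm_num at hs
    have a1 := ((hWP.comp_affine x₀ hs0).const_mul m⁻¹).mono (subset_univ (Ioi 0))
    have a2 := (((hPV.comp_affine x₀ hs0).const_mul s).const_mul m⁻¹).mono (subset_univ (Ioi 0))
    have m1 : MemLp (fun y => m⁻¹ * (s * P (s * y + x₀))) 2 (volume.restrict (Ioi 0)) :=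
      (((memLp_comp_affine hPL x₀ hs0).const_mul s).const_mul m⁻¹).restrict _
    have m2 : MemLp (fun y => m⁻¹ * (s * (s * V2 (s * y + x₀)))) 2 (volume.restrict (Ioi 0)) :=
      ((((memLp_comp_affine hL2 x₀ hs0).const_mul s).const_mul s).const_mul m⁻¹).restrict _
    have m0 : IntegrableOn (fun y => m⁻¹ * W (s * y + x₀)) (Ioi 0) :=
      ((memLp_one_iff_integrable.1 (memLp_comp_affine (memLp_one_iff_integrable.2 hWi) x₀
        hs0)).const_mul _).integrableOn
    obtain ⟨b1, b2, b3⟩ := memW_of_hasWeakDeriv m0 m1 m2 a1 a2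
      ⟨_, (by fun_prop), EventuallyEq.refl _ _, by simp [m, hm.ne']⟩
      ⟨_, (by fun_prop), EventuallyEq.refl _ _, by simp [hP0]⟩
    refine (hw.2 _ ⟨b1, ae_of_all _ fun y => ⟨mul_nonneg (inv_nonneg.2 hm.le) (hW0 _), ?_⟩⟩).trans_eq ?_
    · rw [inv_mul_le_iff₀ hm, mul_one]
      exact hx₀ _
    · rw [transitionEnergy_eq (EventuallyEq.refl _ _) b2 b3]
      refine integral_congr_ae (ae_of_all _ fun y => ?_)
      have e2 : s ^ 4 = 1 := by rw [show s ^ 4 = (s ^ 2) ^ 2 by ring, hs]; norm_num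
      simp only [hDdef]
      linear_combination (m⁻¹ * P (s * y + x₀)) ^ 2 * hs + ρ * (m⁻¹ * V2 (s * y + x₀)) ^ 2 * e2
  have k1 := key 1 (by norm_num)
  have k2 := key (-1) (by norm_num)
  simp only [one_mul, neg_one_mul] at k1 k2
  have k3 := integral_Ioi_add_neg hDi x₀
  have hK := transitionEnergy_nonneg hρ hw.1
  have hE : Integrable (fun x => W x + P x ^ 2 + ρ * V2 x ^ 2) :=
    (hWi.add hPL.integrable_sq).add (hL2.integrable_sq.const_mul ρ)
  -- Undoing the normalization loses only in the linear term, which becomes `m * W` with `m ≤ 1`.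
  have hle : m ^ 2 * ∫ x, D x ≤ ∫ x, (W x + P x ^ 2 + ρ * V2 x ^ 2) := by
    rw [← integral_const_mul]
    refine integral_mono (hDi.const_mul _) hE fun x => ?_
    have e : m ^ 2 * D x = m * W x + P x ^ 2 + ρ * V2 x ^ 2 := by
      simp only [hDdef]; field_simp
    simp only [e]
    nlinarith [hW0 x]
  have hcongr : ∫ x, (V x + V1 x ^ 2 + ρ * V2 x ^ 2) = ∫ x, (W x + P x ^ 2 + ρ * V2 x ^ 2) := by
    refine integral_congr_ae ?_
    filter_upwards [hc, hd] with x hx hx'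
    rw [hx, hx']
  rw [hcongr]
  refine le_trans ?_ hle
  have hsq : M ^ 2 ≤ m ^ 2 := by gcongr
  nlinarith [sq_nonneg m]

/-- Apply the unit-scale bound to `x ↦ V (ε x)`: each derivative brings a factor `ε` and the
Jacobian brings `ε⁻¹`, which gives the weights `ε⁻¹`, `ε`, `ε ^ 3`. -/
lemma two_mul_transitionEnergy_le_surface {ρ : ℝ} (hρ : 0 < ρ) {w : ℝ → ℝ}
    (hw : IsOptimalProfile ρ w)
    {V V1 V2 : ℝ → ℝ} (h1 : HasWeakDeriv univ V V1) (h2 : HasWeakDeriv univ V1 V2)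
    (hL1 : MemLp V1 2) (hL2 : MemLp V2 2) (hb : ∀ᵐ x, 0 ≤ V x ∧ V x ≤ 1)
    (hsupp : HasCompactSupport V) {M : ℝ} (hM : 0 < M) (hVM : ¬ ∀ᵐ x, V x ≤ M)
    {ε : ℝ} (hε : 0 < ε) :
    2 * transitionEnergy ρ w * M ^ 2 ≤ ∫ x, surfaceDensity ρ ε (V x) (V1 x) (V2 x) := by
  have hq := quasiMeasurePreserving_affine 0 hε.ne'
  have hinv : ∀ x, ε * (ε⁻¹ * x + 0) + 0 = x := fun x => by field_simp; ring
  have h := two_mul_transitionEnergy_le hρ hw (h1.comp_affine 0 hε.ne')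
    ((h2.comp_affine 0 hε.ne').const_mul ε) ((memLp_comp_affine hL1 0 hε.ne').const_mul ε)
    (((memLp_comp_affine hL2 0 hε.ne').const_mul ε).const_mul ε) (hq.ae hb)
    (hsupp.comp_homeomorph (affineHomeo 0 hε.ne')) hM (fun h' => hVM (by
      have := (quasiMeasurePreserving_affine 0 (inv_ne_zero hε.ne')).ae h'
      filter_upwards [this] with x hx
      rwa [hinv] at hx))
  refine h.trans_eq ?_
  have e := integral_comp_affine (fun x => V x + (ε * V1 x) ^ 2 + ρ * (ε * (ε * V2 x)) ^ 2) 0 hε.ne'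
  rw [e, abs_of_pos (inv_pos.2 hε), ← integral_const_mul]
  refine integral_congr_ae (ae_of_all _ fun x => ?_)
  simp only [surfaceDensity]
  field_simp

/-- The arguments on the left are the product rule for a phase field times a cutoff `z`. Young's
inequality with weight `ε` costs `1 + ε` on the leading terms; the terms with `z1` or `z2` keep a
spare factor `ε`, and `s ^ 2 ≤ s` lets the linear term absorb squares of `s`. In the constant, `2 *
D ^ 2` comes from the first derivative and `20 = 16 + 4` from the second. -/
lemma surfaceDensity_mul_le {ρ ε s p q z z1 z2 D : ℝ} (hρ : 0 < ρ) (hε : 0 < ε) (hε1 : ε ≤ 1)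
    (hs : 0 ≤ s) (hs1 : s ≤ 1) (hz : 0 ≤ z) (hz1 : z ≤ 1) (hd1 : |z1| ≤ D) (hd2 : |z2| ≤ D) :
    surfaceDensity ρ ε (s * z) (p * z + s * z1) ((q * z + p * z1) + (p * z1 + s * z2))
      ≤ (1 + (1 + 2 * D ^ 2 + 20 * ρ * D ^ 2) * ε) * surfaceDensity ρ ε s p q := by
  have hss : s ^ 2 ≤ s := by nlinarith
  have hzz : z ^ 2 ≤ 1 := by nlinarith
  have hd1' : z1 ^ 2 ≤ D ^ 2 := sq_le_sq' (abs_le.1 hd1).1 (abs_le.1 hd1).2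
  have hd2' : z2 ^ 2 ≤ D ^ 2 := sq_le_sq' (abs_le.1 hd2).1 (abs_le.1 hd2).2
  have young : ∀ x y : ℝ, (x + y) ^ 2 ≤ (1 + ε) * x ^ 2 + (1 + ε⁻¹) * y ^ 2 := by
    intro x y
    have : 0 ≤ ε⁻¹ * (ε * x - y) ^ 2 := by positivity
    have e : ε⁻¹ * (ε * x - y) ^ 2 = ε * x ^ 2 - 2 * x * y + ε⁻¹ * y ^ 2 := by
      field_simp; ring
    nlinarith
  have b1 : (s * z1) ^ 2 ≤ D ^ 2 * s := by
    calc (s * z1) ^ 2 = s ^ 2 * z1 ^ 2 := by ring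
      _ ≤ s * D ^ 2 := by gcongr
      _ = _ := by ring
  have b2 : (p * z) ^ 2 ≤ p ^ 2 := by
    calc (p * z) ^ 2 = p ^ 2 * z ^ 2 := by ring
      _ ≤ p ^ 2 * 1 := by gcongr
      _ = _ := by ring
  have b3 : (q * z) ^ 2 ≤ q ^ 2 := by
    calc (q * z) ^ 2 = q ^ 2 * z ^ 2 := by ring
      _ ≤ q ^ 2 * 1 := by gcongr
      _ = _ := by ring
  have b4 : (2 * p * z1 + s * z2) ^ 2 ≤ 8 * D ^ 2 * p ^ 2 + 2 * D ^ 2 * s := by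
    have c1 : p ^ 2 * z1 ^ 2 ≤ p ^ 2 * D ^ 2 := by gcongr
    have c2 : s ^ 2 * z2 ^ 2 ≤ s * D ^ 2 := by gcongr
    nlinarith [sq_nonneg (2 * p * z1 - s * z2)]
  have h1 : ε * (p * z + s * z1) ^ 2 ≤ (1 + ε) * (ε * p ^ 2) + (2 * D ^ 2 * ε) * (ε⁻¹ * s) := by
    calc ε * (p * z + s * z1) ^ 2 ≤ ε * ((1 + ε) * p ^ 2 + (1 + ε⁻¹) * (D ^ 2 * s)) := by
          refine mul_le_mul_of_nonneg_left ((young _ _).trans ?_) hε.le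
          gcongr
      _ = (1 + ε) * (ε * p ^ 2) + (ε + 1) * D ^ 2 * s := by field_simp
      _ ≤ (1 + ε) * (ε * p ^ 2) + (1 + 1) * D ^ 2 * s := by gcongr
      _ = _ := by field_simp; ring
  have h2 : ρ * ε ^ 3 * ((q * z + p * z1) + (p * z1 + s * z2)) ^ 2
      ≤ (1 + ε) * (ρ * ε ^ 3 * q ^ 2) + (16 * ρ * D ^ 2 * ε) * (ε * p ^ 2)
        + (4 * ρ * D ^ 2 * ε) * (ε⁻¹ * s) := by
    calc ρ * ε ^ 3 * ((q * z + p * z1) + (p * z1 + s * z2)) ^ 2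
        = ρ * ε ^ 3 * (q * z + (2 * p * z1 + s * z2)) ^ 2 := by ring
      _ ≤ ρ * ε ^ 3 * ((1 + ε) * q ^ 2 + (1 + ε⁻¹) * (8 * D ^ 2 * p ^ 2 + 2 * D ^ 2 * s)) := by
          refine mul_le_mul_of_nonneg_left ((young _ _).trans ?_) (by positivity)
          gcongr
      _ = (1 + ε) * (ρ * ε ^ 3 * q ^ 2) + ρ * ε ^ 2 * (ε + 1) * (8 * D ^ 2 * p ^ 2)
          + ρ * ε ^ 2 * (ε + 1) * (2 * D ^ 2 * s) := by
          field_simp; ring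
      _ ≤ (1 + ε) * (ρ * ε ^ 3 * q ^ 2) + ρ * ε ^ 2 * (1 + 1) * (8 * D ^ 2 * p ^ 2)
          + ρ * 1 * (1 + 1) * (2 * D ^ 2 * s) := by
          have : ε ^ 2 ≤ 1 := by nlinarith
          gcongr
      _ = _ := by field_simp; ring
  have h3 : ε⁻¹ * (s * z) ≤ ε⁻¹ * s := by
    gcongr
    nlinarith
  unfold surfaceDensity
  set A := ε⁻¹ * s
  set B := ε * p ^ 2
  set E := ρ * ε ^ 3 * q ^ 2
  have hA : 0 ≤ A := by positivity
  have hB : 0 ≤ B := by positivity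
  have hE : 0 ≤ E := by positivity
  have n1 : 0 ≤ ρ * D ^ 2 * ε := by positivity
  have n2 : 0 ≤ D ^ 2 * ε := by positivity
  linarith [mul_nonneg n1 hA, mul_nonneg n1 hB, mul_nonneg n1 hE, mul_nonneg n2 hA,
    mul_nonneg n2 hB, mul_nonneg n2 hE, mul_nonneg hε.le hA, mul_nonneg hε.le hB,
    mul_nonneg hε.le hE]

lemma MemH2.memLp_weakDeriv_weakDeriv {I : Set ℝ} {v : ℝ → ℝ} (h : MemH2 I v) :
    MemLp (weakDeriv I (weakDeriv I v)) 2 (volume.restrict I) := h.memH1_deriv.memLp_deriv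

/-- If a phase field exceeds `M` where the cutoff `ζ` equals one, then it pays for two transitions
in the support of `ζ`, up to a factor that tends to one. -/
lemma exists_two_mul_transitionEnergy_le {ρ : ℝ} (hρ : 0 < ρ) {w : ℝ → ℝ}
    (hw : IsOptimalProfile ρ w) {I J : Set ℝ} (hI : IsOpen I) (hJ : IsOpen J) (hJI : J ⊆ I)
    {ζ : ℝ → ℝ} (hζ : IsTest J ζ) (hζ01 : ∀ x, 0 ≤ ζ x ∧ ζ x ≤ 1) :
    ∃ C, 0 ≤ C ∧ ∀ (ε : ℝ), 0 < ε → ε ≤ 1 → ∀ v : ℝ → ℝ, MemH2 I v →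
      (∀ᵐ x ∂volume.restrict I, 0 ≤ v x ∧ v x ≤ 1) → ∀ J' ⊆ I, MeasurableSet J' →
      (∀ x ∈ J', ζ x = 1) → ∀ M, 0 < M → (¬ ∀ᵐ x ∂volume.restrict J', v x ≤ M) →
      ENNReal.ofReal (2 * transitionEnergy ρ w * M ^ 2) ≤ ENNReal.ofReal (1 + C * ε) *
        ∫⁻ x in J, ENNReal.ofReal (surfaceDensity ρ ε (v x) (weakDeriv I v x)
          (weakDeriv I (weakDeriv I v) x)) := by
  obtain ⟨D1, hD1, hb1⟩ := hζ.deriv.bounded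
  obtain ⟨D2, hD2, hb2⟩ := hζ.deriv.deriv.bounded
  set D := max D1 D2
  -- The constant of `surfaceDensity_mul_le`; it depends on `ρ` and the cutoff only, hence is
  -- uniform in `ε` and `v`.
  refine ⟨1 + 2 * D ^ 2 + 20 * ρ * D ^ 2, by positivity, ?_⟩
  intro ε hε hε1 v hv hv01 J' hJ'I hJ' hζJ' M hM hvM
  set C := 1 + 2 * D ^ 2 + 20 * ρ * D ^ 2
  have hζI := hζ.mono hJI
  set v1 := weakDeriv I v
  set v2 := weakDeriv I v1
  have d1 : HasWeakDeriv I v v1 := hv.memH1.hasWeakDeriv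
  have d2 : HasWeakDeriv I v1 v2 := hv.memH1_deriv.hasWeakDeriv
  have w1 := d1.mul_test hζI
  have w2 := (d2.mul_test hζI).add (d1.mul_test hζI.deriv)
  have l1 := (memLp_mul_test hI hv.memH1.memLp_deriv hζI).add
    (memLp_mul_test hI hv.memH1.memLp hζI.deriv)
  have l2 := ((memLp_mul_test hI hv.memLp_weakDeriv_weakDeriv hζI).add
    (memLp_mul_test hI hv.memH1.memLp_deriv hζI.deriv)).add
    ((memLp_mul_test hI hv.memH1.memLp_deriv hζI.deriv).add
      (memLp_mul_test hI hv.memH1.memLp hζI.deriv.deriv))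
  have hv01' := (ae_restrict_iff' hI.measurableSet).1 hv01
  have bV : ∀ᵐ x, 0 ≤ v x * ζ x ∧ v x * ζ x ≤ 1 := by
    filter_upwards [hv01'] with x hx
    by_cases hxI : x ∈ I
    · have := hx hxI
      have := hζ01 x
      constructor <;> nlinarith
    · simp [hζI.eq_zero hxI]
  have hcs : HasCompactSupport (fun x => v x * ζ x) := hζ.compact.mul_left
  have hVM : ¬ ∀ᵐ x, v x * ζ x ≤ M := by
    intro h'
    refine hvM ?_
    rw [ae_restrict_iff' hJ']
    filter_upwards [h'] with x hx hxJ
    rwa [hζJ' x hxJ, mul_one] at hx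
  have main := two_mul_transitionEnergy_le_surface hρ hw w1 w2 l1 l2 bV hcs hM hVM hε
  have hint : Integrable (fun x => v x * ζ x) := by
    simpa using hζI.integrable_mul d1.1
  set F : ℝ → ℝ := fun x => surfaceDensity ρ ε (v x * ζ x) (v1 x * ζ x + v x * deriv ζ x)
    ((v2 x * ζ x + v1 x * deriv ζ x) + (v1 x * deriv ζ x + v x * deriv (deriv ζ) x))
  have hFi : Integrable F := ((hint.const_mul _).add (l1.integrable_sq.const_mul _)).add
    (l2.integrable_sq.const_mul _)
  have hF0 : 0 ≤ᵐ[volume] F := by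
    filter_upwards [bV] with x hx
    exact surfaceDensity_nonneg hρ hε hx.1 _ _
  refine (ENNReal.ofReal_le_ofReal main).trans ?_
  rw [ofReal_integral_eq_lintegral_ofReal hFi hF0, ← lintegral_const_mul' _ _ ENNReal.ofReal_ne_top,
    ← lintegral_indicator hJ.measurableSet]
  refine lintegral_mono_ae ?_
  filter_upwards [hv01'] with x hx
  by_cases hxJ : x ∈ J
  · rw [indicator_of_mem hxJ, ← ENNReal.ofReal_mul (by positivity)]
    refine ENNReal.ofReal_le_ofReal ?_
    exact surfaceDensity_mul_le hρ hε hε1 (hx (hJI hxJ)).1 (hx (hJI hxJ)).2 (hζ01 x).1 (hζ01 x).2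
      ((hb1 x).trans (le_max_left _ _)) ((hb2 x).trans (le_max_right _ _))
  · rw [indicator_of_notMem hxJ]
    simp [F, hζ.eq_zero hxJ, hζ.deriv.eq_zero hxJ, hζ.deriv.deriv.eq_zero hxJ, surfaceDensity]

/-! ### Piecewise absolutely continuous functions -/

/-- The step function `x ↦ 1` for `x > t`, `0` otherwise. -/
def step (t : ℝ) : ℝ → ℝ := (Ioi t).indicator fun _ => 1

lemma step_of_lt {t x : ℝ} (h : t < x) : step t x = 1 :=
  indicator_of_mem (s := Ioi t) h fun _ => (1 : ℝ)

lemma step_of_le {t x : ℝ} (h : x ≤ t) : step t x = 0 :=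
  indicator_of_notMem (s := Ioi t) (not_lt.2 h) fun _ => (1 : ℝ)

lemma measurable_step (t : ℝ) : Measurable (step t) :=
  measurable_const.indicator measurableSet_Ioi

lemma locallyIntegrable_step (t : ℝ) : LocallyIntegrable (step t) := by
  refine (locallyIntegrable_const (1 : ℝ)).mono (measurable_step t).aestronglyMeasurable
    (ae_of_all _ fun x => ?_)
  by_cases hx : x ∈ Ioi t <;> simp [step, hx]

lemma integral_step_mul_deriv {I : Set ℝ} {φ : ℝ → ℝ} (hφ : IsTest I φ) (t : ℝ) :
    ∫ x in I, step t x * deriv φ x = -φ t := by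
  rw [hφ.deriv.setIntegral_eq,
    ← hφ.compact.integral_Ioi_deriv_eq (hφ.smooth.of_le (by simp)) t,
    ← integral_indicator measurableSet_Ioi]
  congr with x
  by_cases hx : x ∈ Ioi t <;> simp [step, hx]

/-- The function with absolutely continuous derivative `h` and jumps `c t` at the points `t ∈ B`. -/
def piecewisePrimitive (c₀ : ℝ) (h : ℝ → ℝ) (B : Finset ℝ) (c : ℝ → ℝ) (x : ℝ) : ℝ :=
  primitive c₀ h x + ∑ t ∈ B, c t * step t x

/-! ### Distributional derivatives concentrated at a point -/

lemma IsTest.abs_le_mul {I : Set ℝ} {θ : ℝ → ℝ} (hθ : IsTest I θ) {t D : ℝ} (ht : θ t = 0)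
    (hD : ∀ x, |_root_.deriv θ x| ≤ D) (x : ℝ) : |θ x| ≤ D * |x - t| := by
  have := convex_univ.norm_image_sub_le_of_norm_deriv_le (f := θ) (C := D) (x := t) (y := x)
    (fun y _ => hθ.smooth.differentiable (by simp) y) (fun y _ => hD y) (mem_univ _) (mem_univ _)
  simpa [ht] using this

/-- With `u` and `h` integrable, the functional contains no derivative of a Dirac mass, so `θ t = 0`
suffices. Split `θ` by a cutoff of width `1 / s n` around `t`: the outer part is a test function off
`t`, and the inner part tends to zero by dominated convergence, since `|θ x| ≤ D * |x - t|`
compensates the factor `s n` from the derivative of the cutoff. -/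
lemma integral_eq_zero_of_vanish {I Ω : Set ℝ} (hΩI : Ω ⊆ I) {u h : ℝ → ℝ}
    (hu : IntegrableOn u I) (hh : IntegrableOn h I) {t : ℝ}
    (hΛ : ∀ φ, IsTest (Ω \ {t}) φ → ∫ x in I, (u x * deriv φ x + h x * φ x) = 0)
    {θ : ℝ → ℝ} (hθ : IsTest Ω θ) (ht : θ t = 0) :
    ∫ x in I, (u x * deriv θ x + h x * θ x) = 0 := by
  obtain ⟨β, hβ, hβ01, hβ1⟩ := IsTest.exists_bump 0 (two_pos (α := ℝ))
  obtain ⟨D, hD, hDb⟩ := hθ.deriv.bounded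
  obtain ⟨E, hE, hEb⟩ := hβ.deriv.bounded
  obtain ⟨T, hT, hTb⟩ := hθ.bounded
  let s : ℕ → ℝ := fun n => (n : ℝ) + 1
  have hs : ∀ n, 0 < s n := fun n => by positivity
  let b : ℕ → ℝ → ℝ := fun n x => β (s n * (x - t))
  have hbs : ∀ n, ContDiff ℝ ∞ (b n) := fun n => hβ.smooth.comp (by fun_prop)
  have hbd : ∀ n x, HasDerivAt (b n) (deriv β (s n * (x - t)) * s n) x := by
    intro n x
    have h3 : HasDerivAt (fun y : ℝ => s n * (y - t)) (s n) x := by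
      simpa using ((hasDerivAt_id x).sub_const t).const_mul (s n)
    exact (hβ.hasDerivAt _).comp x h3
  have hT1 : ∀ n, IsTest Ω (fun x => b n x * θ x) := fun n => hθ.mul_left (hbs n)
  have hd1 : ∀ n x, deriv (fun x => b n x * θ x) x
      = deriv β (s n * (x - t)) * s n * θ x + b n x * deriv θ x := fun n x =>
    ((hbd n x).mul (hθ.hasDerivAt x)).deriv
  have hloc : ∀ φ, IsTest Ω φ →
      IntegrableOn (fun x => u x * deriv φ x + h x * φ x) I := fun φ hφ =>
    ((hφ.mono hΩI).deriv.integrable_mul hu.locallyIntegrableOn).integrableOn.add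
      ((hφ.mono hΩI).integrable_mul hh.locallyIntegrableOn).integrableOn
  have hcut : ∀ n, ∫ x in I, (u x * deriv θ x + h x * θ x)
      = ∫ x in I, (u x * deriv (fun x => b n x * θ x) x + h x * (b n x * θ x)) := by
    intro n
    have h1 : IsTest Ω (fun x => θ x - b n x * θ x) := hθ.sub (hT1 n)
    have h2 : IsTest (Ω \ {t}) (fun x => θ x - b n x * θ x) := by
      refine ⟨h1.smooth, h1.compact, fun x hx => ⟨h1.support hx, ?_⟩⟩
      rintro rfl
      refine notMem_tsupport_iff_eventuallyEq.2 ?_ hx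
      have : ∀ᶠ y in 𝓝 x, |s n * (y - x)| < 1 :=
        (Continuous.tendsto (f := fun y : ℝ => |s n * (y - x)|) (by fun_prop) x).eventually_lt_const
          (by simp)
      filter_upwards [this] with y hy
      have : b n y = 1 := hβ1 _ (by simpa using hy.le)
      simp [this]
    have h3 := hΛ _ h2
    have h4 : ∀ x, u x * deriv (fun x => θ x - b n x * θ x) x + h x * (θ x - b n x * θ x)
        = (u x * deriv θ x + h x * θ x)
          - (u x * deriv (fun x => b n x * θ x) x + h x * (b n x * θ x)) := by
      intro x
      have : deriv (fun x => θ x - b n x * θ x) x = deriv θ x - deriv (fun x => b n x * θ x) x :=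
        ((hθ.hasDerivAt x).sub ((hT1 n).hasDerivAt x)).deriv
      rw [this]; ring
    simp only [h4] at h3
    rw [integral_sub (hloc _ hθ) (hloc _ (hT1 n))] at h3
    linarith
  have hlim : Tendsto (fun n => ∫ x in I, (u x * deriv (fun x => b n x * θ x) x
      + h x * (b n x * θ x))) atTop (𝓝 (∫ _ in I, (0 : ℝ))) := by
    refine tendsto_integral_of_dominated_convergence
      (fun x => (E * (2 * D) + D) * ‖u x‖ + T * ‖h x‖) (fun n => (hloc _ (hT1 n)).1)
      ((hu.norm.const_mul _).add (hh.norm.const_mul _)) (fun n => ae_of_all _ fun x => ?_) ?_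
    · have hb1 : |b n x| ≤ 1 := by
        rw [abs_of_nonneg (hβ01 _).1]; exact (hβ01 _).2
      have hE2 : |deriv β (s n * (x - t)) * s n * θ x| ≤ E * (2 * D) := by
        by_cases hx : |s n * (x - t)| < 2
        · rw [mul_assoc, abs_mul]
          refine mul_le_mul (hEb _) ?_ (abs_nonneg _) hE.le
          rw [abs_mul, abs_of_pos (hs n)] at *
          have := hθ.abs_le_mul ht hDb x
          have h5 := mul_le_mul_of_nonneg_left this (hs n).le
          nlinarith
        · rw [hβ.deriv.eq_zero (fun h' => hx (by
            rw [abs_lt]; constructor <;> linarith [h'.1, h'.2]))]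
          simp; positivity
      refine (norm_add_le _ _).trans ?_
      rw [norm_mul, norm_mul, hd1, mul_comm ‖u x‖, mul_comm ‖h x‖]
      refine add_le_add (mul_le_mul_of_nonneg_right ?_ (norm_nonneg _))
        (mul_le_mul_of_nonneg_right ?_ (norm_nonneg _))
      · refine (norm_add_le _ _).trans (add_le_add hE2 ?_)
        rw [norm_mul]
        exact (mul_le_mul hb1 (hDb x) (abs_nonneg _) zero_le_one).trans_eq (one_mul D)
      · rw [norm_mul]
        exact (mul_le_mul hb1 (hTb x) (abs_nonneg _) zero_le_one).trans_eq (one_mul T)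
    · have hne : ∀ᵐ x ∂volume.restrict I, x ≠ t :=
        ae_restrict_of_ae (by simp [ae_iff])
      filter_upwards [hne] with x hx
      refine tendsto_const_nhds.congr' ?_
      have h0 : 0 < |x - t| := abs_pos.2 (sub_ne_zero.2 hx)
      have hsl : Tendsto (fun n : ℕ => s n * |x - t|) atTop atTop :=
        (tendsto_natCast_atTop_atTop.atTop_add tendsto_const_nhds).atTop_mul_const h0
      filter_upwards [hsl.eventually_ge_atTop 2] with n hn
      have hnot : s n * (x - t) ∉ Ioo (0 - 2 : ℝ) (0 + 2) := fun h' => by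
        rw [← abs_of_pos (hs n), ← abs_mul] at hn
        have : |s n * (x - t)| < 2 := abs_lt.2 ⟨by linarith [h'.1], by linarith [h'.2]⟩
        linarith
      rw [hd1]
      simp [b, hβ.eq_zero hnot, hβ.deriv.eq_zero hnot]
  rw [integral_zero] at hlim
  exact tendsto_nhds_unique (tendsto_const_nhds.congr hcut) hlim

/-- For a fixed bump `ζ` with `ζ t = 1`, the function `φ - φ t * ζ` vanishes at `t`, so the
functional sees `φ` only through `φ t`. -/
lemma exists_jump_of_vanish {I Ω : Set ℝ} (hΩ : IsOpen Ω) (hΩI : Ω ⊆ I) {u h : ℝ → ℝ}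
    (hu : IntegrableOn u I) (hh : IntegrableOn h I) {t : ℝ} (ht : t ∈ Ω)
    (hΛ : ∀ φ, IsTest (Ω \ {t}) φ → ∫ x in I, (u x * deriv φ x + h x * φ x) = 0) :
    ∃ c, ∀ φ, IsTest Ω φ → ∫ x in I, (u x * deriv φ x + h x * φ x) = -c * φ t := by
  obtain ⟨ζ, hζ, -, hζ1⟩ := IsTest.exists_bump_subset hΩ ht
  have hζt : ζ t = 1 := hζ1.eq_of_nhds
  refine ⟨-∫ x in I, (u x * deriv ζ x + h x * ζ x), fun φ hφ => ?_⟩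
  have hloc : ∀ φ, IsTest Ω φ →
      IntegrableOn (fun x => u x * deriv φ x + h x * φ x) I := fun φ hφ =>
    ((hφ.mono hΩI).deriv.integrable_mul hu.locallyIntegrableOn).integrableOn.add
      ((hφ.mono hΩI).integrable_mul hh.locallyIntegrableOn).integrableOn
  have h1 : IsTest Ω (fun x => φ x - φ t * ζ x) := hφ.sub (hζ.const_mul _)
  have h2 := integral_eq_zero_of_vanish hΩI hu hh hΛ h1 (by simp [hζt])
  have h4 : ∀ x, u x * deriv (fun x => φ x - φ t * ζ x) x + h x * (φ x - φ t * ζ x)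
      = (u x * deriv φ x + h x * φ x) - φ t * (u x * deriv ζ x + h x * ζ x) := by
    intro x
    have : deriv (fun x => φ x - φ t * ζ x) x = deriv φ x - φ t * deriv ζ x :=
      ((hφ.hasDerivAt x).sub ((hζ.hasDerivAt x).const_mul _)).deriv
    rw [this]; ring
  simp only [h4] at h2
  rw [integral_sub (hloc _ hφ) ((hloc _ hζ).const_mul _), integral_const_mul] at h2
  linarith

/-- A function whose distributional derivative is `h` off a finite set is piecewise a primitive. -/
lemma exists_ae_eq_piecewisePrimitive {a b : ℝ} {h : ℝ → ℝ} (hh : Integrable h) (B : Finset ℝ)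
    (hB : ∀ t ∈ B, t ∈ Ioo a b) {u : ℝ → ℝ} (hu : IntegrableOn u (Ioo a b))
    (hΛ : ∀ φ, IsTest (Ioo a b \ B) φ →
      ∫ x in Ioo a b, (u x * deriv φ x + h x * φ x) = 0) :
    ∃ c₀ c, u =ᵐ[volume.restrict (Ioo a b)] piecewisePrimitive c₀ h B c := by
  induction B using Finset.induction_on generalizing u with
  | empty =>
    simp only [Finset.coe_empty, sdiff_empty] at hΛ
    have hd : HasWeakDeriv (Ioo a b) u h := by
      refine ⟨hu.locallyIntegrableOn, hh.locallyIntegrable.locallyIntegrableOn _, fun φ hφ => ?_⟩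
      have := hΛ φ hφ
      rw [integral_add (hφ.deriv.integrable_mul hu.locallyIntegrableOn).integrableOn
        (hφ.integrable_mul (hh.locallyIntegrable.locallyIntegrableOn _)).integrableOn] at this
      linarith
    obtain ⟨c, hc⟩ := hd.exists_ae_eq_primitive isOpen_Ioo ordConnected_Ioo hh.locallyIntegrable
      (EventuallyEq.refl _ _)
    refine ⟨c, 0, hc.trans (EventuallyEq.of_eq ?_)⟩
    funext x
    simp [piecewisePrimitive]
  | insert t B htB ih =>
    have hΩ : IsOpen (Ioo a b \ (B : Set ℝ)) := isOpen_Ioo.sdiff B.finite_toSet.isClosed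
    -- On `Ioo a b \ B` the only singular point is the new `t`; subtracting `ct * step t` removes
    -- its mass and leaves a function to which the induction hypothesis for `B` applies.
    obtain ⟨ct, hct⟩ := exists_jump_of_vanish hΩ sdiff_subset hu hh.integrableOn (t := t)
      ⟨hB t (Finset.mem_insert_self _ _), by simpa using htB⟩ (fun φ hφ => hΛ φ (by
        rw [sdiff_sdiff] at hφ
        rwa [Finset.coe_insert, insert_eq, union_comm]))
    have hst : IntegrableOn (step t) (Ioo a b) :=
      ((locallyIntegrable_step t).integrableOn_isCompact isCompact_Icc).mono_set Ioo_subset_Icc_self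
    have hu' : IntegrableOn (fun x => u x - ct * step t x) (Ioo a b) := hu.sub (hst.const_mul ct)
    obtain ⟨c₀, c, hc⟩ := ih (fun s hs => hB s (Finset.mem_insert_of_mem hs)) hu' fun φ hφ => by
      have hφI : IsTest (Ioo a b) φ := hφ.mono sdiff_subset
      have h1 := hct φ hφ
      have h2 := integral_step_mul_deriv hφI t
      have h3 : ∀ x, (u x - ct * step t x) * deriv φ x + h x * φ x
          = (u x * deriv φ x + h x * φ x) - ct * (step t x * deriv φ x) := fun x => by ring
      simp only [h3]
      rw [integral_sub, integral_const_mul, h1, h2]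
      · ring
      · exact (hφI.deriv.integrable_mul hu.locallyIntegrableOn).integrableOn.add
          (hφI.integrable_mul (hh.locallyIntegrable.locallyIntegrableOn _)).integrableOn
      · exact ((hφI.deriv.integrable_mul hst.locallyIntegrableOn).integrableOn).const_mul ct
    refine ⟨c₀, Function.update c t ct, ?_⟩
    filter_upwards [hc] with x hx
    have h4 : ∑ s ∈ B, Function.update c t ct s * step s x = ∑ s ∈ B, c s * step s x :=
      Finset.sum_congr rfl fun s hs => by
        rw [Function.update_of_ne (ne_of_mem_of_not_mem hs htB)]
    rw [piecewisePrimitive, Finset.sum_insert htB, h4, Function.update_self]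
    rw [piecewisePrimitive] at hx
    linarith

/-! ### One-sided approximate limits and jumps -/

lemma hasRightApproxLim_of_tendsto {I : Set ℝ} (hI : IsOpen I) {u f : ℝ → ℝ}
    (huf : u =ᵐ[volume.restrict I] f) {x p : ℝ} (hx : x ∈ I) (hf : Tendsto f (𝓝[>] x) (𝓝 p)) :
    HasRightApproxLim u x p := by
  rw [HasRightApproxLim, Metric.tendsto_nhds]
  intro e he
  have h1 : ∀ᶠ y in 𝓝[>] x, y ∈ I ∧ |f y - p| < e / 2 := by
    filter_upwards [nhdsWithin_le_nhds (hI.mem_nhds hx), Metric.tendsto_nhds.1 hf (e / 2) (half_pos he)]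
      with y h1 h2 using ⟨h1, h2⟩
  obtain ⟨y, hy, hsub⟩ := mem_nhdsGT_iff_exists_Ioo_subset.1 h1
  have hxy : 0 < y - x := sub_pos.2 hy
  filter_upwards [Ioo_mem_nhdsGT hxy] with r hr
  have hsub' : Ioo x (x + r) ⊆ Ioo x y := Ioo_subset_Ioo_right (by linarith [hr.2])
  have h2 : ‖∫ z in Ioo x (x + r), |u z - p|‖ ≤ e / 2 * volume.real (Ioo x (x + r)) := by
    refine norm_setIntegral_le_of_norm_le_const_ae' (by simp) ?_
    filter_upwards [(ae_restrict_iff' hI.measurableSet).1 huf] with z hz hzr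
    have := hsub (hsub' hzr)
    rw [hz this.1, norm_abs_eq_norm]
    exact this.2.le
  rw [Real.volume_real_Ioo_of_le (by linarith [hr.1]), add_sub_cancel_left] at h2
  rw [dist_zero_right, norm_mul, norm_inv, Real.norm_of_nonneg hr.1.le, inv_mul_lt_iff₀ hr.1]
  nlinarith [hr.1]

lemma hasLeftApproxLim_of_tendsto {I : Set ℝ} (hI : IsOpen I) {u f : ℝ → ℝ}
    (huf : u =ᵐ[volume.restrict I] f) {x p : ℝ} (hx : x ∈ I) (hf : Tendsto f (𝓝[<] x) (𝓝 p)) :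
    HasLeftApproxLim u x p := by
  rw [HasLeftApproxLim, Metric.tendsto_nhds]
  intro e he
  have h1 : ∀ᶠ y in 𝓝[<] x, y ∈ I ∧ |f y - p| < e / 2 := by
    filter_upwards [nhdsWithin_le_nhds (hI.mem_nhds hx), Metric.tendsto_nhds.1 hf (e / 2) (half_pos he)]
      with y h1 h2 using ⟨h1, h2⟩
  obtain ⟨y, hy, hsub⟩ := mem_nhdsLT_iff_exists_Ioo_subset.1 h1
  have hxy : 0 < x - y := sub_pos.2 hy
  filter_upwards [Ioo_mem_nhdsGT hxy] with r hr
  have hsub' : Ioo (x - r) x ⊆ Ioo y x := Ioo_subset_Ioo_left (by linarith [hr.2])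
  have h2 : ‖∫ z in Ioo (x - r) x, |u z - p|‖ ≤ e / 2 * volume.real (Ioo (x - r) x) := by
    refine norm_setIntegral_le_of_norm_le_const_ae' (by simp) ?_
    filter_upwards [(ae_restrict_iff' hI.measurableSet).1 huf] with z hz hzr
    have := hsub (hsub' hzr)
    rw [hz this.1, norm_abs_eq_norm]
    exact this.2.le
  rw [Real.volume_real_Ioo_of_le (by linarith [hr.1]), sub_sub_cancel] at h2
  rw [dist_zero_right, norm_mul, norm_inv, Real.norm_of_nonneg hr.1.le, inv_mul_lt_iff₀ hr.1]
  nlinarith [hr.1]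

/-- Average `|p - q| ≤ |u - p| + |u - q|` over `A r`. The abstract `A` covers the left and the right
limit together. -/
lemma eq_of_average_tendsto {u : ℝ → ℝ} {A : ℝ → Set ℝ} {p q : ℝ}
    (hA : ∀ᶠ r in 𝓝[>] (0 : ℝ), IntegrableOn u (A r) ∧ volume.real (A r) = r ∧ volume (A r) ≠ ⊤)
    (hp : Tendsto (fun r : ℝ => r⁻¹ * ∫ y in A r, |u y - p|) (𝓝[>] 0) (𝓝 0))
    (hq : Tendsto (fun r : ℝ => r⁻¹ * ∫ y in A r, |u y - q|) (𝓝[>] 0) (𝓝 0)) : p = q := by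
  have h1 := hp.add hq
  rw [add_zero] at h1
  have h2 : |p - q| ≤ 0 := by
    refine ge_of_tendsto h1 ?_
    filter_upwards [hA, self_mem_nhdsWithin] with r hr hr0
    have hr0' : (0 : ℝ) < r := hr0
    have hc : ∀ c : ℝ, IntegrableOn (fun _ : ℝ => c) (A r) := fun c => integrableOn_const hr.2.2
    have i1 : IntegrableOn (fun y => |u y - p|) (A r) := (hr.1.sub (hc p)).abs
    have i2 : IntegrableOn (fun y => |u y - q|) (A r) := (hr.1.sub (hc q)).abs
    have h3 : ∫ _ in A r, |p - q| ≤ ∫ y in A r, (|u y - p| + |u y - q|) :=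
      integral_mono (hc _) (i1.add i2) fun y => by
        have := abs_sub_le p (u y) q
        rwa [abs_sub_comm p (u y)] at this
    rw [setIntegral_const, hr.2.1, smul_eq_mul, integral_add i1 i2] at h3
    rw [← mul_add, le_inv_mul_iff₀ hr0']
    exact h3
  exact sub_eq_zero.1 (abs_eq_zero.1 (le_antisymm h2 (abs_nonneg _)))

lemma HasRightApproxLim.unique {I : Set ℝ} (hI : IsOpen I) {u : ℝ → ℝ} (hu : IntegrableOn u I)
    {x p q : ℝ} (hx : x ∈ I) (hp : HasRightApproxLim u x p) (hq : HasRightApproxLim u x q) :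
    p = q := by
  refine eq_of_average_tendsto (A := fun r => Ioo x (x + r)) ?_ hp hq
  obtain ⟨d, hd, hsub⟩ := Metric.isOpen_iff.1 hI x hx
  rw [Real.ball_eq_Ioo] at hsub
  filter_upwards [Ioo_mem_nhdsGT hd] with r hr
  refine ⟨hu.mono_set ((Ioo_subset_Ioo (by linarith) (by linarith [hr.2])).trans hsub), ?_, by simp⟩
  rw [Real.volume_real_Ioo_of_le (by linarith [hr.1]), add_sub_cancel_left]

lemma HasLeftApproxLim.unique {I : Set ℝ} (hI : IsOpen I) {u : ℝ → ℝ} (hu : IntegrableOn u I)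
    {x p q : ℝ} (hx : x ∈ I) (hp : HasLeftApproxLim u x p) (hq : HasLeftApproxLim u x q) :
    p = q := by
  refine eq_of_average_tendsto (A := fun r => Ioo (x - r) x) ?_ hp hq
  obtain ⟨d, hd, hsub⟩ := Metric.isOpen_iff.1 hI x hx
  rw [Real.ball_eq_Ioo] at hsub
  filter_upwards [Ioo_mem_nhdsGT hd] with r hr
  refine ⟨hu.mono_set ((Ioo_subset_Ioo (by linarith [hr.2]) (by linarith)).trans hsub), ?_, by simp⟩
  rw [Real.volume_real_Ioo_of_le (by linarith [hr.1]), sub_sub_cancel]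

lemma tendsto_step_right (t x : ℝ) :
    Tendsto (step t) (𝓝[>] x) (𝓝 (if t ≤ x then 1 else 0)) := by
  split_ifs with h
  · refine tendsto_const_nhds.congr' ?_
    filter_upwards [self_mem_nhdsWithin] with y hy
    exact (step_of_lt (lt_of_le_of_lt h hy)).symm
  · refine tendsto_const_nhds.congr' ?_
    filter_upwards [nhdsWithin_le_nhds (Iio_mem_nhds (not_le.1 h))] with y hy
    exact (step_of_le (le_of_lt hy)).symm

lemma tendsto_step_left (t x : ℝ) :
    Tendsto (step t) (𝓝[<] x) (𝓝 (if t < x then 1 else 0)) := by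
  split_ifs with h
  · refine tendsto_const_nhds.congr' ?_
    filter_upwards [nhdsWithin_le_nhds (Ioi_mem_nhds h)] with y hy
    exact (step_of_lt hy).symm
  · refine tendsto_const_nhds.congr' ?_
    filter_upwards [self_mem_nhdsWithin] with y hy
    exact (step_of_le (le_of_lt (lt_of_lt_of_le hy (not_lt.1 h)))).symm

section PiecewisePrimitive

variable {a b c₀ : ℝ} {u h c : ℝ → ℝ} {B : Finset ℝ}

/-- The primitive is continuous, and among the steps only the one at `x` has different one-sided
limits. -/
lemma exists_approxLim (hh : LocallyIntegrable h)
    (hu : u =ᵐ[volume.restrict (Ioo a b)] piecewisePrimitive c₀ h B c) {x : ℝ} (hx : x ∈ Ioo a b) :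
    ∃ p q, HasRightApproxLim u x p ∧ HasLeftApproxLim u x q ∧
      p - q = if x ∈ B then c x else 0 := by
  have hc := continuous_primitive c₀ hh
  refine ⟨_, _, hasRightApproxLim_of_tendsto isOpen_Ioo hu hx
    ((hc.tendsto x).mono_left nhdsWithin_le_nhds |>.add
      (tendsto_finsetSum B fun t _ => (tendsto_step_right t x).const_mul (c t))),
    hasLeftApproxLim_of_tendsto isOpen_Ioo hu hx
    ((hc.tendsto x).mono_left nhdsWithin_le_nhds |>.add
      (tendsto_finsetSum B fun t _ => (tendsto_step_left t x).const_mul (c t))), ?_⟩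
  rw [add_sub_add_left_eq_sub, ← Finset.sum_sub_distrib, ← Finset.sum_ite_eq' B x c]
  refine Finset.sum_congr rfl fun t _ => ?_
  rcases lt_trichotomy t x with h' | rfl | h'
  · simp [h', h'.le, h'.ne]
  · simp
  · simp [not_lt.2 h'.le, not_le.2 h', h'.ne']

lemma jump_eq (hh : LocallyIntegrable h) (hui : IntegrableOn u (Ioo a b))
    (hu : u =ᵐ[volume.restrict (Ioo a b)] piecewisePrimitive c₀ h B c) {x : ℝ} (hx : x ∈ Ioo a b) :
    jump u x = if x ∈ B then c x else 0 := by
  obtain ⟨p, q, hp, hq, hpq⟩ := exists_approxLim hh hu hx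
  have hex : (∃ p, HasRightApproxLim u x p) ∧ ∃ q, HasLeftApproxLim u x q := ⟨⟨p, hp⟩, ⟨q, hq⟩⟩
  rw [jump, dif_pos hex, hex.1.choose_spec.unique isOpen_Ioo hui hx hp,
    hex.2.choose_spec.unique isOpen_Ioo hui hx hq, hpq]

/-- A zero coefficient is allowed, so `B` may be larger than the jump set. In the lower bound `B` is
the crack set, where `v` may approach `1` without any jump of `u₀`. -/
lemma mem_jumpSet_iff (hh : LocallyIntegrable h) (hui : IntegrableOn u (Ioo a b))
    (hu : u =ᵐ[volume.restrict (Ioo a b)] piecewisePrimitive c₀ h B c)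
    (hB : ∀ t ∈ B, t ∈ Ioo a b) (x : ℝ) : x ∈ jumpSet a b u ↔ x ∈ B ∧ c x ≠ 0 := by
  constructor
  · rintro ⟨hx, p, q, hp, hq, hpq⟩
    obtain ⟨p', q', hp', hq', hpq'⟩ := exists_approxLim hh hu hx
    rw [hp.unique isOpen_Ioo hui hx hp', hq.unique isOpen_Ioo hui hx hq', ← sub_ne_zero, hpq'] at hpq
    split_ifs at hpq with h1
    · exact ⟨h1, hpq⟩
    · exact absurd rfl hpq
  · rintro ⟨hxB, hcx⟩
    obtain ⟨p', q', hp', hq', hpq'⟩ := exists_approxLim hh hu (hB x hxB)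
    rw [if_pos hxB] at hpq'
    exact ⟨hB x hxB, p', q', hp', hq', sub_ne_zero.1 (hpq' ▸ hcx)⟩

lemma tsum_jump_eq (hh : LocallyIntegrable h) (hui : IntegrableOn u (Ioo a b))
    (hu : u =ᵐ[volume.restrict (Ioo a b)] piecewisePrimitive c₀ h B c)
    (hB : ∀ t ∈ B, t ∈ Ioo a b) (φ : ℝ → ℝ) :
    ∑' x : jumpSet a b u, jump u x * φ x = ∑ t ∈ B, c t * φ t := by
  rw [tsum_subtype (jumpSet a b u) (fun x => jump u x * φ x), tsum_eq_sum (s := B)]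
  · refine Finset.sum_congr rfl fun t ht => ?_
    by_cases hc : c t = 0
    · rw [indicator_of_notMem (fun h' => ((mem_jumpSet_iff hh hui hu hB t).1 h').2 hc), hc, zero_mul]
    · rw [indicator_of_mem ((mem_jumpSet_iff hh hui hu hB t).2 ⟨ht, hc⟩),
        jump_eq hh hui hu (hB t ht), if_pos ht]
  · intro t ht
    exact indicator_of_notMem (fun h' => ht ((mem_jumpSet_iff hh hui hu hB t).1 h').1) _

lemma hasSBVDeriv_of_piecewisePrimitive (hh : Integrable h) (hui : IntegrableOn u (Ioo a b))
    (hu : u =ᵐ[volume.restrict (Ioo a b)] piecewisePrimitive c₀ h B c)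
    (hB : ∀ t ∈ B, t ∈ Ioo a b) : (jumpSet a b u).Finite ∧ HasSBVDeriv a b u h := by
  have hl := hh.locallyIntegrable
  have hfin : (jumpSet a b u).Finite :=
    B.finite_toSet.subset fun x hx => ((mem_jumpSet_iff hl hui hu hB x).1 hx).1
  have : Finite (jumpSet a b u) := hfin
  refine ⟨hfin, hui, hh.integrableOn, Summable.of_finite, fun φ hφ => ?_⟩
  rw [tsum_jump_eq hl hui hu hB]
  have e : ∫ x in Ioo a b, u x * deriv φ x
      = ∫ x in Ioo a b, piecewisePrimitive c₀ h B c x * deriv φ x :=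
    integral_congr_ae (hu.mul (EventuallyEq.refl _ (deriv φ)))
  have hP := (hasWeakDeriv_primitive c₀ hl).mono (subset_univ (Ioo a b))
  have hi : ∀ t, IntegrableOn (fun x => c t * (step t x * deriv φ x)) (Ioo a b) := fun t =>
    ((hφ.deriv.integrable_mul ((locallyIntegrable_step t).locallyIntegrableOn _)).integrableOn).const_mul _
  rw [e]
  simp only [piecewisePrimitive, add_mul, Finset.sum_mul, mul_assoc]
  rw [integral_add (hφ.deriv.integrable_mul hP.1).integrableOn
    (integrable_finsetSum _ fun t _ => hi t), hP.3 φ hφ, integral_finsetSum _ fun t _ => hi t]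
  simp only [integral_const_mul, integral_step_mul_deriv hφ]
  simp only [mul_neg, Finset.sum_neg_distrib]
  ring

lemma HasSBVDeriv.unique {g g' : ℝ → ℝ} (hg : HasSBVDeriv a b u g) (hg' : HasSBVDeriv a b u g') :
    g =ᵐ[volume.restrict (Ioo a b)] g' := by
  have := ae_eq_zero_of_integral_test isOpen_Ioo (f := fun x => g x - g' x)
    (hg.integrable_density.sub hg'.integrable_density).locallyIntegrableOn fun φ hφ => by
    have h1 := hg.byParts φ hφ
    have h2 := hg'.byParts φ hφ
    simp only [sub_mul]
    rw [integral_sub (hφ.integrable_mul hg.2.locallyIntegrableOn).integrableOn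
      (hφ.integrable_mul hg'.2.locallyIntegrableOn).integrableOn]
    linarith
  filter_upwards [this] with x hx
  simpa [sub_eq_zero] using hx

lemma HasSBVDeriv.sbvDensity_ae_eq {g : ℝ → ℝ} (hg : HasSBVDeriv a b u g) :
    sbvDensity a b u =ᵐ[volume.restrict (Ioo a b)] g := by
  have hex : ∃ g, HasSBVDeriv a b u g := ⟨g, hg⟩
  rw [sbvDensity, dif_pos hex]
  exact hex.choose_spec.unique hg

/-- A function in `SBV²` is a piecewise primitive of its density. -/
lemma MemSBV2.exists_piecewisePrimitive (hu : MemSBV2 a b u) :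
    IntegrableOn u (Ioo a b) ∧ MemLp ((Ioo a b).indicator (sbvDensity a b u)) 2 ∧ ∃ c₀,
      u =ᵐ[volume.restrict (Ioo a b)] piecewisePrimitive c₀
        ((Ioo a b).indicator (sbvDensity a b u)) hu.finite_jumpSet.toFinset (jump u) := by
  have hS : HasSBVDeriv a b u (sbvDensity a b u) := by
    rw [sbvDensity, dif_pos hu.memSBV]
    exact hu.memSBV.choose_spec
  set g := sbvDensity a b u
  set h := (Ioo a b).indicator g
  have hh : Integrable h := (integrable_indicator_iff measurableSet_Ioo).2 hS.integrable_density
  set B := hu.finite_jumpSet.toFinset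
  have hB : ∀ t ∈ B, t ∈ Ioo a b := fun t ht => (hu.finite_jumpSet.mem_toFinset.1 ht).1
  have hgh : ∀ φ : ℝ → ℝ, ∫ x in Ioo a b, h x * φ x = ∫ x in Ioo a b, g x * φ x := fun φ =>
    setIntegral_congr_fun measurableSet_Ioo fun x hx => by simp [h, hx]
  obtain ⟨c₀, c, hc⟩ := exists_ae_eq_piecewisePrimitive hh B hB hS.integrable fun φ hφ => by
    have hφI : IsTest (Ioo a b) φ := hφ.mono sdiff_subset
    have h1 := hS.byParts φ hφI
    have h2 : ∑' x : jumpSet a b u, jump u x * φ x = 0 := by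
      rw [← tsum_zero (α := ℝ) (β := jumpSet a b u)]
      congr with x
      rw [hφ.eq_zero (fun h' => h'.2 (by simp [B])), mul_zero]
    rw [integral_add (hφI.deriv.integrable_mul hS.integrable.locallyIntegrableOn).integrableOn
      (hφI.integrable_mul (hh.locallyIntegrable.locallyIntegrableOn _)).integrableOn, hgh, h1, h2]
    ring
  refine ⟨hS.integrable, (memLp_indicator_iff_restrict measurableSet_Ioo).2 hu.memLp_density, c₀, ?_⟩
  filter_upwards [hc] with x hx
  rw [hx, piecewisePrimitive, piecewisePrimitive]
  congr 1
  refine Finset.sum_congr rfl fun t ht => ?_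
  rw [jump_eq hh.locallyIntegrable hS.integrable hc (hB t ht), if_pos ht]

end PiecewisePrimitive

/-! ### Weak limits along an ultrafilter -/

/-- Weak compactness of balls: each bounded real family `⟪H n, f⟫` converges along `U`, the limit is
linear in `f` and bounded by `R * ‖f‖`, and the Riesz theorem represents it. -/
lemma exists_weak_limit {E : Type*} [NormedAddCommGroup E] [InnerProductSpace ℝ E]
    [CompleteSpace E] (U : Ultrafilter ℕ) {H : ℕ → E} {R : ℝ} (hR : ∀ᶠ n in U, ‖H n‖ ≤ R) :
    ∃ h : E, ∀ f, Tendsto (fun n => inner ℝ (H n) f) U (𝓝 (inner ℝ h f)) := by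
  have hR0 : 0 ≤ R := by
    obtain ⟨n, hn⟩ := hR.exists
    exact (norm_nonneg _).trans hn
  have hbd : ∀ f, ∀ᶠ n in U, inner ℝ (H n) f ∈ Icc (-(R * ‖f‖)) (R * ‖f‖) := fun f => by
    filter_upwards [hR] with n hn
    rw [mem_Icc, ← abs_le]
    exact (abs_real_inner_le_norm _ _).trans (by gcongr)
  have hex : ∀ f, ∃ l ∈ Icc (-(R * ‖f‖)) (R * ‖f‖),
      Tendsto (fun n => inner ℝ (H n) f) U (𝓝 l) := fun f =>
    isCompact_Icc.ultrafilter_le_nhds (U.map fun n => inner ℝ (H n) f)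
      (le_principal_iff.2 (hbd f))
  choose L hL hLt using hex
  let T : E →ₗ[ℝ] ℝ :=
    { toFun := L
      map_add' := fun f g => tendsto_nhds_unique (hLt (f + g)) (by
        simpa only [inner_add_right] using (hLt f).add (hLt g))
      map_smul' := fun c f => tendsto_nhds_unique (hLt (c • f)) (by
        simpa only [inner_smul_right, RingHom.id_apply, smul_eq_mul] using! (hLt f).const_mul c) }
  let T' : E →L[ℝ] ℝ := T.mkContinuous R fun f => abs_le.2 (hL f)
  refine ⟨(InnerProductSpace.toDual ℝ E).symm T', fun f => ?_⟩
  rw [InnerProductSpace.toDual_symm_apply]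
  exact hLt f

lemma tendsto_integral_mul {a b : ℝ} {ι : Type*} {l : Filter ι} {f : ι → L1 a b} {f₀ : L1 a b}
    (hf : Tendsto f l (𝓝 f₀)) {φ : ℝ → ℝ} (hφ : Continuous φ) {C : ℝ} (hC : ∀ x, |φ x| ≤ C) :
    Tendsto (fun i => ∫ x in Ioo a b, f i x * φ x) l (𝓝 (∫ x in Ioo a b, f₀ x * φ x)) := by
  have hi : ∀ g : L1 a b, Integrable (fun x => g x * φ x) (volume.restrict (Ioo a b)) := fun g =>
    (L1.integrable_coeFn g).mul_bdd hφ.aestronglyMeasurable (ae_of_all _ hC)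
  rw [tendsto_iff_dist_tendsto_zero] at hf ⊢
  refine squeeze_zero (fun _ => dist_nonneg) (fun i => ?_)
    (by simpa using hf.const_mul C)
  rw [Real.dist_eq, ← integral_sub (hi _) (hi _), dist_eq_norm, L1.norm_eq_integral_norm,
    ← integral_const_mul]
  refine abs_integral_le_integral_abs.trans (integral_mono_ae ((hi _).sub (hi _)).abs
    ((L1.integrable_coeFn _).norm.const_mul C) ?_)
  filter_upwards [Lp.coeFn_sub (f i) f₀] with x hx
  rw [hx, Pi.sub_apply, ← sub_mul, abs_mul, mul_comm, Real.norm_eq_abs]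
  exact mul_le_mul_of_nonneg_right (hC x) (abs_nonneg _)

/-! ### Lower bounds for the elastic energy -/

section Elastic

variable {a b κ η : ℝ} {u v : ℝ → ℝ}

lemma memLp_degraded_strain (hu : MemH1 (Ioo a b) u)
    (hv : AEStronglyMeasurable v (volume.restrict (Ioo a b)))
    (h01 : ∀ᵐ x ∂volume.restrict (Ioo a b), 0 ≤ v x ∧ v x ≤ 1) :
    MemLp (fun x => (1 - v x) * weakDeriv (Ioo a b) u x) 2 (volume.restrict (Ioo a b)) := by
  refine hu.memLp_deriv.of_le ((aestronglyMeasurable_const.sub hv).mul hu.memLp_deriv.1) ?_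
  filter_upwards [h01] with x hx
  rw [norm_mul, Real.norm_of_nonneg (by linarith [hx.2])]
  exact mul_le_of_le_one_left (norm_nonneg _) (by linarith [hx.1])

/-- In tension `(1 - v) ^ 2` is at most the degradation function, in compression it is at most `1`,
so the bound holds pointwise in both cases. -/
lemma ofReal_integral_degraded_le_elasticEnergy (hκ : 0 < κ) (hη : 0 ≤ η)
    (hu : MemH1 (Ioo a b) u) (hv : AEStronglyMeasurable v (volume.restrict (Ioo a b)))
    (h01 : ∀ᵐ x ∂volume.restrict (Ioo a b), 0 ≤ v x ∧ v x ≤ 1) :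
    ENNReal.ofReal (κ * ∫ x in Ioo a b, ((1 - v x) * weakDeriv (Ioo a b) u x) ^ 2)
      ≤ elasticEnergy a b κ η u v := by
  rw [← integral_const_mul, ofReal_integral_eq_lintegral_ofReal
    ((memLp_degraded_strain hu hv h01).integrable_sq.const_mul κ)
    (ae_of_all _ fun x => by positivity)]
  refine lintegral_mono_ae ?_
  filter_upwards [h01] with x hx
  refine ENNReal.ofReal_le_ofReal ?_
  set g := weakDeriv (Ioo a b) u x
  rw [mul_assoc, ← mul_add]
  refine mul_le_mul_of_nonneg_left ?_ hκ.le
  unfold degradation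
  rcases le_total 0 g with hg | hg
  · rw [max_eq_left hg, max_eq_right (by linarith)]
    nlinarith [mul_nonneg hη (sq_nonneg g)]
  · rw [max_eq_right hg, max_eq_left (by linarith)]
    have h2 : (1 - v x) ^ 2 ≤ 1 := by nlinarith [hx.1, hx.2]
    nlinarith [sq_nonneg g]

/-- Compression carries no degradation factor, so the energy controls it in L² whatever `v` does.
This later excludes negative jumps. -/
lemma ofReal_integral_negPart_le_elasticEnergy (hκ : 0 < κ) (hη : 0 ≤ η)
    (hu : MemH1 (Ioo a b) u) :
    MemLp (fun x => max (-weakDeriv (Ioo a b) u x) 0) 2 (volume.restrict (Ioo a b)) ∧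
    ENNReal.ofReal (κ * ∫ x in Ioo a b, max (-weakDeriv (Ioo a b) u x) 0 ^ 2)
      ≤ elasticEnergy a b κ η u v := by
  have hm : MemLp (fun x => max (-weakDeriv (Ioo a b) u x) 0) 2 (volume.restrict (Ioo a b)) := by
    refine hu.memLp_deriv.of_le
      (hu.memLp_deriv.1.neg.sup (aestronglyMeasurable_const (b := (0 : ℝ)))) (ae_of_all _ fun x => ?_)
    rw [Real.norm_of_nonneg (le_max_right _ _), Real.norm_eq_abs]
    exact max_le (neg_le_abs _) (abs_nonneg _)
  refine ⟨hm, ?_⟩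
  rw [← integral_const_mul, ofReal_integral_eq_lintegral_ofReal (hm.integrable_sq.const_mul κ)
    (ae_of_all _ fun x => by positivity)]
  refine lintegral_mono fun x => ENNReal.ofReal_le_ofReal ?_
  have : 0 ≤ κ * degradation η (v x) * max (weakDeriv (Ioo a b) u x) 0 ^ 2 := by
    unfold degradation
    positivity
  linarith

end Elastic

/-- Only the term `ε⁻¹ v` is used. Both bounds need this: it forces `v → 0`, and it shows that the
recovery phase fields converge. -/
lemma norm_le_of_surfaceIntegral_le {a b ρ ε S : ℝ} (hρ : 0 < ρ) (hε : 0 < ε) (hS : 0 ≤ S)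
    {v : L1 a b} (h01 : ∀ᵐ x ∂volume.restrict (Ioo a b), 0 ≤ v x ∧ v x ≤ 1)
    (h : surfaceIntegral a b ρ ε v ≤ ENNReal.ofReal S) : ‖v‖ ≤ ε * S := by
  have h1 : ENNReal.ofReal (∫ x in Ioo a b, ε⁻¹ * v x) ≤ ENNReal.ofReal S := by
    rw [ofReal_integral_eq_lintegral_ofReal ((L1.integrable_coeFn v).const_mul _)]
    · refine (lintegral_mono fun x => ENNReal.ofReal_le_ofReal ?_).trans h
      have : 0 ≤ ε * weakDeriv (Ioo a b) v x ^ 2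
        + ρ * ε ^ 3 * weakDeriv (Ioo a b) (weakDeriv (Ioo a b) v) x ^ 2 := by positivity
      linarith
    · filter_upwards [h01] with x hx
      have := hx.1
      simp only [Pi.zero_apply]
      positivity
  rw [ENNReal.ofReal_le_ofReal_iff hS, integral_const_mul, inv_mul_le_iff₀ hε] at h1
  refine le_trans (le_of_eq ?_) h1
  rw [L1.norm_eq_integral_norm]
  refine integral_congr_ae ?_
  filter_upwards [h01] with x hx
  rw [Real.norm_of_nonneg hx.1]

/-! ### Sequences with bounded energy -/

/-- A sequence whose elastic energy and surface integral converge along an ultrafilter. -/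
structure BoundedEnergy (a b κ ρ : ℝ) (ε η : ℕ → ℝ) (U : Ultrafilter ℕ) (u v : ℕ → L1 a b)
    (u₀ : L1 a b) (e s : ℝ≥0∞) : Prop where
  ε_pos : ∀ n, 0 < ε n
  ε_tendsto : Tendsto ε U (𝓝 0)
  η_nonneg : ∀ n, 0 ≤ η n
  u_tendsto : Tendsto u U (𝓝 u₀)
  memH1 : ∀ᶠ n in U, MemH1 (Ioo a b) (u n)
  memH2 : ∀ᶠ n in U, MemH2 (Ioo a b) (v n)
  mem_Icc : ∀ᶠ n in U, ∀ᵐ x ∂volume.restrict (Ioo a b), 0 ≤ v n x ∧ v n x ≤ 1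
  elastic : Tendsto (fun n => elasticEnergy a b κ (η n) (u n) (v n)) U (𝓝 e)
  surface : Tendsto (fun n => surfaceIntegral a b ρ (ε n) (v n)) U (𝓝 s)
  e_ne_top : e ≠ ⊤
  s_ne_top : s ≠ ⊤

/-- The points around which the phase field approaches `1`. -/
def crackSet (a b : ℝ) (U : Ultrafilter ℕ) (v : ℕ → L1 a b) : Set ℝ :=
  {t | t ∈ Ioo a b ∧ ∀ r, 0 < r → ∀ M, 0 < M → M < 1 →
    ∀ᶠ n in U, ¬ ∀ᵐ x ∂volume.restrict (Ioo (t - r) (t + r) ∩ Ioo a b), v n x ≤ M}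

lemma eventually_disjoint_Ioo {a b : ℝ} (B : Finset ℝ) (hB : ∀ t ∈ B, t ∈ Ioo a b) :
    ∀ᶠ r in 𝓝[>] (0 : ℝ), (∀ t ∈ B, Ioo (t - r) (t + r) ⊆ Ioo a b) ∧
      ∀ t ∈ B, ∀ t' ∈ B, t ≠ t' → Disjoint (Ioo (t - r) (t + r)) (Ioo (t' - r) (t' + r)) := by
  have h1 : ∀ d : ℝ, 0 < d → ∀ᶠ r in 𝓝[>] (0 : ℝ), r < d := fun d hd =>
    nhdsWithin_le_nhds (Iio_mem_nhds hd)
  refine ((Filter.eventually_all_finset B).2 fun t ht => ?_).and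
    ((Filter.eventually_all_finset B).2 fun t ht => (Filter.eventually_all_finset B).2 fun t' ht' => ?_)
  · filter_upwards [h1 _ (sub_pos.2 (hB t ht).1), h1 _ (sub_pos.2 (hB t ht).2)] with r h2 h3
    exact Ioo_subset_Ioo (by linarith) (by linarith)
  · rcases eq_or_ne t t' with rfl | hne
    · exact Eventually.of_forall fun r h => absurd rfl h
    · filter_upwards [h1 _ (half_pos (abs_pos.2 (sub_ne_zero.2 hne)))] with r hr _
      rw [Set.disjoint_left]
      rintro x ⟨hx1, hx2⟩ ⟨hx3, hx4⟩
      have : |t - t'| < 2 * r := abs_lt.2 ⟨by linarith, by linarith⟩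
      linarith

namespace BoundedEnergy

variable {a b κ ρ : ℝ} {ε η : ℕ → ℝ} {U : Ultrafilter ℕ} {u v : ℕ → L1 a b} {u₀ : L1 a b}
  {e s : ℝ≥0∞}

lemma norm_v_tendsto (h : BoundedEnergy a b κ ρ ε η U u v u₀ e s) (hρ : 0 < ρ) :
    Tendsto (fun n => ‖v n‖) U (𝓝 0) := by
  have h1 : ∀ᶠ n in U, surfaceIntegral a b ρ (ε n) (v n) ≤ ENNReal.ofReal (s.toReal + 1) := by
    refine (h.surface.eventually_lt_const (u := ENNReal.ofReal (s.toReal + 1)) ?_).mono fun n => le_of_lt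
    rw [ENNReal.lt_ofReal_iff_toReal_lt h.s_ne_top]
    linarith
  refine squeeze_zero' (Eventually.of_forall fun _ => norm_nonneg _) ?_
    (by simpa using h.ε_tendsto.mul_const (s.toReal + 1))
  filter_upwards [h1, h.mem_Icc] with n hn h01
  exact norm_le_of_surfaceIntegral_le hρ (h.ε_pos n) (by positivity) h01 hn

/-- Each point of the crack set carries the energy of two transitions. -/
lemma card_mul_le (h : BoundedEnergy a b κ ρ ε η U u v u₀ e s) (hρ : 0 < ρ) {w : ℝ → ℝ}
    (hw : IsOptimalProfile ρ w) (B : Finset ℝ) (hB : ↑B ⊆ crackSet a b U v) :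
    (B.card : ℝ≥0∞) * ENNReal.ofReal (2 * transitionEnergy ρ w) ≤ s := by
  -- A common radius with disjoint neighbourhoods inside the interval, so that the energies of the
  -- transitions add up.
  obtain ⟨r, ⟨hrI, hrd⟩, hr0⟩ := ((eventually_disjoint_Ioo (a := a) (b := b) B
    fun t ht => (hB ht).1).and self_mem_nhdsWithin).exists
  have hr : 0 < r := hr0
  choose ζ hζ hζ01 hζ1 using fun t => IsTest.exists_bump t hr
  have hC : ∀ t : ℝ, ∃ C, 0 ≤ C ∧ (t ∈ B → ∀ (ε : ℝ), 0 < ε → ε ≤ 1 → ∀ v : ℝ → ℝ,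
      MemH2 (Ioo a b) v →
      (∀ᵐ x ∂volume.restrict (Ioo a b), 0 ≤ v x ∧ v x ≤ 1) → ∀ J' ⊆ Ioo a b, MeasurableSet J' →
      (∀ x ∈ J', ζ t x = 1) → ∀ M, 0 < M → (¬ ∀ᵐ x ∂volume.restrict J', v x ≤ M) →
      ENNReal.ofReal (2 * transitionEnergy ρ w * M ^ 2) ≤ ENNReal.ofReal (1 + C * ε) *
        ∫⁻ x in Ioo (t - r) (t + r), ENNReal.ofReal (surfaceDensity ρ ε (v x)
          (weakDeriv (Ioo a b) v x) (weakDeriv (Ioo a b) (weakDeriv (Ioo a b) v) x))) := by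
    intro t
    by_cases ht : t ∈ B
    · obtain ⟨C, hC0, hC⟩ := exists_two_mul_transitionEnergy_le hρ hw isOpen_Ioo isOpen_Ioo (hrI t ht)
        (hζ t) (hζ01 t)
      exact ⟨C, hC0, fun _ => hC⟩
    · exact ⟨0, le_rfl, fun h' => absurd h' ht⟩
  choose C hC0 hC using hC
  set C' := ∑ t ∈ B, C t
  have hle : ∀ M, 0 < M → M < 1 →
      (B.card : ℝ≥0∞) * ENNReal.ofReal (2 * transitionEnergy ρ w * M ^ 2) ≤ s := by
    intro M hM hM1
    have hlim : Tendsto (fun n => ENNReal.ofReal (1 + C' * ε n) *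
        surfaceIntegral a b ρ (ε n) (v n)) U (𝓝 (ENNReal.ofReal (1 + C' * 0) * s)) :=
      ENNReal.Tendsto.mul ((ENNReal.continuous_ofReal.tendsto _).comp
        ((h.ε_tendsto.const_mul C').const_add 1)) (Or.inl (by simp)) h.surface (Or.inr (by simp))
    rw [mul_zero, add_zero, ENNReal.ofReal_one, one_mul] at hlim
    refine ge_of_tendsto hlim ?_
    -- Radius `r / 2`, where the cutoff `ζ t` equals one.
    have hbad : ∀ᶠ n in U, ∀ t ∈ B, ¬ ∀ᵐ x ∂volume.restrict
        (Ioo (t - r / 2) (t + r / 2) ∩ Ioo a b), v n x ≤ M :=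
      (Filter.eventually_all_finset B).2 fun t ht => (hB ht).2 (r / 2) (half_pos hr) M hM hM1
    filter_upwards [hbad, h.memH2, h.mem_Icc, h.ε_tendsto.eventually_le_const zero_lt_one]
      with n hn hn2 hn01 hε1
    have h1 : ∀ t ∈ B, ENNReal.ofReal (2 * transitionEnergy ρ w * M ^ 2)
        ≤ ENNReal.ofReal (1 + C' * ε n) *
          ∫⁻ x in Ioo (t - r) (t + r), ENNReal.ofReal (surfaceDensity ρ (ε n) (v n x)
          (weakDeriv (Ioo a b) (v n) x) (weakDeriv (Ioo a b) (weakDeriv (Ioo a b) (v n)) x)) := by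
      intro t ht
      refine (hC t ht (ε n) (h.ε_pos n) hε1 (v n) hn2 hn01 _ inter_subset_right
        (measurableSet_Ioo.inter measurableSet_Ioo) (fun x hx => hζ1 t x ?_) M hM (hn t ht)).trans ?_
      · rw [abs_le]; constructor <;> linarith [hx.1.1, hx.1.2]
      · gcongr
        · exact (h.ε_pos n).le
        · exact Finset.single_le_sum (fun i _ => hC0 i) ht
    have h2 := Finset.sum_le_sum h1
    rw [Finset.sum_const, nsmul_eq_mul, ← Finset.mul_sum, ← lintegral_biUnion_finset] at h2
    · refine h2.trans (mul_le_mul_right ?_ _)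
      exact lintegral_mono_set (iUnion₂_subset hrI)
    · exact fun t ht t' ht' hne => hrd t ht t' ht' hne
    · exact fun _ _ => measurableSet_Ioo
  have hlim : Tendsto (fun M : ℝ => (B.card : ℝ≥0∞) * ENNReal.ofReal (2 * transitionEnergy ρ w * M ^ 2))
      (𝓝[<] 1) (𝓝 ((B.card : ℝ≥0∞) * ENNReal.ofReal (2 * transitionEnergy ρ w))) := by
    refine ENNReal.Tendsto.const_mul ?_ (Or.inr (by simp))
    refine (ENNReal.continuous_ofReal.tendsto _).comp ?_
    have : Continuous fun M : ℝ => 2 * transitionEnergy ρ w * M ^ 2 := by fun_prop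
    simpa using (this.tendsto 1).mono_left nhdsWithin_le_nhds
  refine le_of_tendsto hlim ?_
  filter_upwards [Ioo_mem_nhdsLT (zero_lt_one (α := ℝ))] with M hM using hle M hM.1 hM.2

/-- Each point costs the same positive amount, and the total is at most `s < ∞`. -/
lemma finite_crackSet (h : BoundedEnergy a b κ ρ ε η U u v u₀ e s) (hρ : 0 < ρ) {w : ℝ → ℝ}
    (hw : IsOptimalProfile ρ w) (hw0 : 0 < transitionEnergy ρ w) : (crackSet a b U v).Finite := by
  by_contra hinf
  obtain ⟨N, hN⟩ := ENNReal.exists_nat_mul_gt (a := ENNReal.ofReal (2 * transitionEnergy ρ w))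
    (by simpa using hw0) h.s_ne_top
  obtain ⟨B, hB, hBc⟩ := Set.Infinite.exists_subset_card_eq hinf N
  have := h.card_mul_le hρ hw B hB
  rw [hBc] at this
  exact absurd hN (not_lt.2 this)

/-- Along an ultrafilter the failure of "eventually not" is "eventually", so each point off the
crack set has a neighbourhood with a bound `M < 1` on `v n`. Finitely many of them cover `K`, and
the largest `M` is still below `1`. -/
lemma exists_bound_of_isCompact {K : Set ℝ} (hK : IsCompact K)
    (hKs : K ⊆ Ioo a b \ crackSet a b U v) :
    ∃ M, 0 < M ∧ M < 1 ∧ ∀ᶠ n in U, ∀ᵐ x ∂volume.restrict (Ioo a b), x ∈ K → v n x ≤ M := by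
  refine hK.induction_on (p := fun K => ∃ M, 0 < M ∧ M < 1 ∧
    ∀ᶠ n in U, ∀ᵐ x ∂volume.restrict (Ioo a b), x ∈ K → v n x ≤ M) ?_ ?_ ?_ ?_
  · exact ⟨1 / 2, by norm_num, by norm_num, by simp⟩
  · rintro s t hst ⟨M, h0, h1, hM⟩
    refine ⟨M, h0, h1, hM.mono fun n hn => hn.mono fun x hx hxs => hx (hst hxs)⟩
  · rintro s t ⟨M, h0, h1, hM⟩ ⟨M', h0', h1', hM'⟩
    refine ⟨max M M', lt_max_of_lt_left h0, max_lt h1 h1', ?_⟩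
    filter_upwards [hM, hM'] with n hn hn'
    filter_upwards [hn, hn'] with x hx hx' hxst
    rcases hxst with h | h
    · exact (hx h).trans (le_max_left _ _)
    · exact (hx' h).trans (le_max_right _ _)
  · intro t ht
    obtain ⟨htI, htc⟩ := hKs ht
    have : ∃ r, 0 < r ∧ ∃ M, 0 < M ∧ M < 1 ∧ ¬ ∀ᶠ n in U,
        ¬ ∀ᵐ x ∂volume.restrict (Ioo (t - r) (t + r) ∩ Ioo a b), v n x ≤ M := by
      by_contra h'
      refine htc ⟨htI, fun r hr M h0 h1 => ?_⟩
      by_contra h''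
      exact h' ⟨r, hr, M, h0, h1, h''⟩
    obtain ⟨r, hr, M, h0, h1, hM⟩ := this
    rw [Ultrafilter.eventually_not, not_not] at hM
    refine ⟨Ioo (t - r) (t + r), nhdsWithin_le_nhds (Ioo_mem_nhds (by linarith) (by linarith)),
      M, h0, h1, ?_⟩
    filter_upwards [hM] with n hn
    rw [ae_restrict_iff' (measurableSet_Ioo.inter measurableSet_Ioo)] at hn
    rw [ae_restrict_iff' measurableSet_Ioo]
    filter_upwards [hn] with x hx hxI hxt using hx ⟨hxt, hxI⟩

/-- The weak limit of the degraded strains is the strain of the limit off the crack set. -/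
lemma exists_strain (h : BoundedEnergy a b κ ρ ε η U u v u₀ e s) (hκ : 0 < κ) (hρ : 0 < ρ) :
    ∃ g, MemLp g 2 (volume.restrict (Ioo a b)) ∧
      ENNReal.ofReal (κ * ∫ x in Ioo a b, g x ^ 2) ≤ e ∧
      ∀ φ, IsTest (Ioo a b \ crackSet a b U v) φ →
        ∫ x in Ioo a b, u₀ x * deriv φ x = -∫ x in Ioo a b, g x * φ x := by
  set μ := volume.restrict (Ioo a b)
  have hv : ∀ n, AEStronglyMeasurable (v n) μ := fun n => (Lp.memLp (v n)).1
  -- The degraded strains as elements of L²; they are available only for `U`-most `n`, hence the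
  -- choice.
  obtain ⟨H, hH⟩ := Filter.Eventually.choice (r := fun n (H : Lp ℝ 2 μ) =>
      H =ᵐ[μ] (fun x => (1 - v n x) * weakDeriv (Ioo a b) (u n) x) ∧
      ENNReal.ofReal (κ * ‖H‖ ^ 2) ≤ elasticEnergy a b κ (η n) (u n) (v n)) (l := (U : Filter ℕ)) (by
    filter_upwards [h.memH1, h.mem_Icc] with n h1 h01
    have hm := memLp_degraded_strain h1 (hv n) h01
    refine ⟨hm.toLp _, hm.coeFn_toLp, ?_⟩
    rw [norm_toLp_sq]
    exact ofReal_integral_degraded_le_elasticEnergy hκ (h.η_nonneg n) h1 (hv n) h01)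
  have hE : Tendsto (fun n => (elasticEnergy a b κ (η n) (u n) (v n)).toReal) U (𝓝 e.toReal) :=
    (ENNReal.tendsto_toReal h.e_ne_top).comp h.elastic
  have hfin : ∀ᶠ n in U, elasticEnergy a b κ (η n) (u n) (v n) ≠ ⊤ :=
    (h.elastic.eventually_lt_const h.e_ne_top.lt_top).mono fun n => ne_of_lt
  have hHn : ∀ᶠ n in U, κ * ‖H n‖ ^ 2 ≤ (elasticEnergy a b κ (η n) (u n) (v n)).toReal := by
    filter_upwards [hH, hfin] with n hn hf
    exact (ENNReal.ofReal_le_iff_le_toReal hf).1 hn.2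
  set R := √((e.toReal + 1) / κ)
  have hR : ∀ᶠ n in U, ‖H n‖ ≤ R := by
    filter_upwards [hHn, hE.eventually_le_const (lt_add_one _)] with n h1 h2
    refine Real.le_sqrt_of_sq_le ?_
    rw [le_div_iff₀ hκ]
    linarith
  obtain ⟨g, hg⟩ := exists_weak_limit U hR
  have hgm : MemLp g 2 μ := Lp.memLp g
  have hgn : ‖g‖ ^ 2 = ∫ x, g x ^ 2 ∂μ := by
    rw [← norm_toLp_sq hgm, Lp.toLp_coeFn]
  refine ⟨g, hgm, ?_, fun φ hφ => ?_⟩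
  · rw [← hgn]
    refine ENNReal.ofReal_le_of_le_toReal ?_
    -- Weak lower semicontinuity of the norm, by passing to the limit in `⟪H, g⟫ ≤ (‖H‖ ^ 2 + ‖g‖ ^
    -- 2) / 2`.
    have h1 : ∀ᶠ n in U, inner ℝ (H n) g
        ≤ ((elasticEnergy a b κ (η n) (u n) (v n)).toReal / κ + ‖g‖ ^ 2) / 2 := by
      filter_upwards [hHn] with n hn
      have h2 := real_inner_le_norm (H n) g
      have h3 : ‖H n‖ ^ 2 ≤ (elasticEnergy a b κ (η n) (u n) (v n)).toReal / κ := by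
        rw [le_div_iff₀ hκ]; linarith
      nlinarith [sq_nonneg (‖H n‖ - ‖g‖)]
    have h2 := le_of_tendsto_of_tendsto (hg g) (((hE.div_const κ).add_const _).div_const 2) h1
    rw [real_inner_self_eq_norm_sq] at h2
    have h3 : ‖g‖ ^ 2 ≤ e.toReal / κ := by linarith
    rw [le_div_iff₀ hκ] at h3
    linarith
  · have hφI : IsTest (Ioo a b) φ := hφ.mono sdiff_subset
    obtain ⟨T, hT, hTb⟩ := hφ.bounded
    obtain ⟨T', -, hTb'⟩ := hφ.deriv.bounded
    obtain ⟨M, hM0, hM1, hM⟩ := exists_bound_of_isCompact hφ.compact hφ.support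
    have hφm : MemLp φ 2 μ := (hφ.memLp 2).restrict _
    have lim1 := tendsto_integral_mul h.u_tendsto hφ.deriv.continuous hTb'
    have lim2 := hg (hφm.toLp φ)
    have e2 : inner ℝ g (hφm.toLp φ) = ∫ x, g x * φ x ∂μ := by
      rw [← inner_toLp hgm hφm, Lp.toLp_coeFn]
    rw [e2] at lim2
    -- On the support of `φ`, where `v ≤ M`, replacing `u'` by `(1 - v) u'` makes an error `v |u'| ≤
    -- (1 - M)⁻¹ v |(1 - v) u'|`. By Cauchy–Schwarz and `v ^ 2 ≤ v` its integral is of order `√‖v‖`,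
    -- which tends to zero.
    have key : ∀ᶠ n in U, ‖(∫ x, u n x * deriv φ x ∂μ) + inner ℝ (H n) (hφm.toLp φ)‖
        ≤ T * (1 - M)⁻¹ * (√‖v n‖ * R) := by
      filter_upwards [hH, hR, h.memH1, h.mem_Icc, hM] with n hHn hRn h1 h01 hMn
      have d := h1.hasWeakDeriv
      set p := weakDeriv (Ioo a b) (u n)
      have hvm : MemLp (v n) 2 μ := MemLp.of_bound (hv n) 1 (by
        filter_upwards [h01] with x hx
        rw [Real.norm_of_nonneg hx.1]; exact hx.2)
      have hm := memLp_degraded_strain h1 (hv n) h01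
      have hma : MemLp (fun x => |(1 - v n x) * p x|) 2 μ := hm.abs
      have e3 : inner ℝ (H n) (hφm.toLp φ) = ∫ x, ((1 - v n x) * p x) * φ x ∂μ := by
        rw [← inner_toLp hm hφm]
        congr 1
        exact Lp.ext (hHn.1.trans hm.coeFn_toLp.symm)
      have e4 : ‖H n‖ = √(∫ x, ((1 - v n x) * p x) ^ 2 ∂μ) := by
        rw [← norm_toLp_eq_sqrt hm]
        congr 1
        exact Lp.ext (hHn.1.trans hm.coeFn_toLp.symm)
      have i1 : Integrable (fun x => p x * φ x) μ := (hφI.integrable_mul d.2).integrableOn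
      have i2 : Integrable (fun x => ((1 - v n x) * p x) * φ x) μ := hm.integrable_mul hφm
      have i3 : Integrable (fun x => v n x * |(1 - v n x) * p x|) μ :=
        hvm.integrable_mul hma
      have hab : ∀ᵐ x ∂μ, |((1 - v n x) * p x) * φ x - p x * φ x|
          ≤ T * (1 - M)⁻¹ * (v n x * |(1 - v n x) * p x|) := by
        filter_upwards [h01, hMn] with x hx hxM
        have e5 : ((1 - v n x) * p x) * φ x - p x * φ x = -(v n x * p x * φ x) := by ring
        rw [e5, abs_neg, abs_mul, abs_mul, abs_mul, abs_of_nonneg hx.1,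
          abs_of_nonneg (sub_nonneg.2 hx.2)]
        by_cases hxK : x ∈ tsupport φ
        · have h3 : 1 ≤ (1 - M)⁻¹ * (1 - v n x) := by
            rw [le_inv_mul_iff₀ (by linarith)]
            linarith [hxM hxK]
          have h4 : 0 ≤ v n x * |p x| := mul_nonneg hx.1 (abs_nonneg _)
          calc v n x * |p x| * |φ x| ≤ v n x * |p x| * T := by gcongr; exact hTb x
            _ ≤ v n x * |p x| * T * ((1 - M)⁻¹ * (1 - v n x)) :=
                le_mul_of_one_le_right (by positivity) h3
            _ = _ := by ring
        · rw [image_eq_zero_of_notMem_tsupport hxK, abs_zero, mul_zero]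
          have : 0 ≤ (1 - M)⁻¹ := inv_nonneg.2 (by linarith)
          have := hx.1
          have := sub_nonneg.2 hx.2
          positivity
      rw [e3, d.3 φ hφI, Real.norm_eq_abs, neg_add_eq_sub, ← integral_sub i2 i1]
      refine abs_integral_le_integral_abs.trans
        ((integral_mono_ae (i2.sub i1).abs (i3.const_mul _) hab).trans ?_)
      rw [integral_const_mul]
      have hpos : 0 ≤ T * (1 - M)⁻¹ := mul_nonneg hT.le (inv_nonneg.2 (by linarith))
      refine mul_le_mul_of_nonneg_left ?_ hpos
      refine (le_abs_self _).trans ((abs_integral_mul_le_sqrt hvm hma).trans ?_)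
      simp only [sq_abs]
      rw [← e4]
      refine mul_le_mul (Real.sqrt_le_sqrt ?_) hRn (norm_nonneg _) (Real.sqrt_nonneg _)
      rw [L1.norm_eq_integral_norm]
      refine integral_mono_ae hvm.integrable_sq (L1.integrable_coeFn _).norm ?_
      filter_upwards [h01] with x hx
      rw [Real.norm_of_nonneg hx.1]
      nlinarith [hx.1, hx.2]
    have lim0 : Tendsto (fun n => T * (1 - M)⁻¹ * (√‖v n‖ * R)) U (𝓝 0) := by
      have h1 := ((Real.continuous_sqrt.tendsto _).comp (h.norm_v_tendsto hρ))
      simpa using (h1.mul_const R).const_mul (T * (1 - M)⁻¹)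
    have lim3 := squeeze_zero_norm' key lim0
    have := tendsto_nhds_unique (lim1.add lim2) lim3
    linarith

/-- The singular part of the derivative of the limit is nonnegative. -/
lemma exists_integral_mul_deriv_le (h : BoundedEnergy a b κ ρ ε η U u v u₀ e s) (hκ : 0 < κ) :
    ∃ R, ∀ φ, IsTest (Ioo a b) φ → (∀ x, 0 ≤ φ x) →
      ∫ x in Ioo a b, u₀ x * deriv φ x ≤ R * √(∫ x in Ioo a b, φ x ^ 2) := by
  refine ⟨√((e.toReal + 1) / κ), fun φ hφ hφ0 => ?_⟩
  obtain ⟨T', -, hTb'⟩ := hφ.deriv.bounded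
  refine le_of_tendsto (tendsto_integral_mul h.u_tendsto hφ.deriv.continuous hTb') ?_
  have hfin : ∀ᶠ n in U, elasticEnergy a b κ (η n) (u n) (v n) ≤ ENNReal.ofReal (e.toReal + 1) := by
    refine (h.elastic.eventually_lt_const ?_).mono fun n => le_of_lt
    rw [ENNReal.lt_ofReal_iff_toReal_lt h.e_ne_top]
    linarith
  filter_upwards [h.memH1, hfin] with n h1 hn
  have hφm : MemLp φ 2 (volume.restrict (Ioo a b)) := (hφ.memLp 2).restrict _
  obtain ⟨hm, hle⟩ := ofReal_integral_negPart_le_elasticEnergy (v := v n) hκ (h.η_nonneg n) h1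
  have h2 := hle.trans hn
  rw [ENNReal.ofReal_le_ofReal_iff (by positivity)] at h2
  rw [h1.hasWeakDeriv.3 φ hφ, ← integral_neg]
  -- Because `φ ≥ 0`, only the compressive part of the strain contributes to the upper bound.
  have h3 : ∫ x in Ioo a b, -(weakDeriv (Ioo a b) (u n) x * φ x)
      ≤ ∫ x in Ioo a b, max (-weakDeriv (Ioo a b) (u n) x) 0 * φ x := by
    refine integral_mono (hφ.integrable_mul h1.hasWeakDeriv.2).integrableOn.neg
      (hm.integrable_mul hφm) fun x => ?_
    rw [← neg_mul]
    exact mul_le_mul_of_nonneg_right (le_max_left _ _) (hφ0 x)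
  refine h3.trans ((le_abs_self _).trans ((abs_integral_mul_le_sqrt hm hφm).trans ?_))
  refine mul_le_mul_of_nonneg_right (Real.sqrt_le_sqrt ?_) (Real.sqrt_nonneg _)
  rw [le_div_iff₀ hκ]
  linarith

/-- Test `exists_integral_mul_deriv_le` with bumps of radius `r` at `t`. The left side contains `-c
t`, while every other term is bounded by the L² norm of the bump, at most `√(2 * r)`; let `r → 0`.
-/
lemma jump_coeff_nonneg (h : BoundedEnergy a b κ ρ ε η U u v u₀ e s) (hκ : 0 < κ)
    {g : ℝ → ℝ} (hgm : MemLp g 2) (hg : Integrable g) {B : Finset ℝ} (hB : ∀ t ∈ B, t ∈ Ioo a b)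
    {c₀ : ℝ} {c : ℝ → ℝ} (hu : u₀ =ᵐ[volume.restrict (Ioo a b)] piecewisePrimitive c₀ g B c)
    {t : ℝ} (ht : t ∈ B) : 0 ≤ c t := by
  obtain ⟨R, hR⟩ := h.exists_integral_mul_deriv_le hκ
  have hui : IntegrableOn u₀ (Ioo a b) := L1.integrable_coeFn u₀
  obtain ⟨-, hS⟩ := hasSBVDeriv_of_piecewisePrimitive hg hui hu hB
  set G := √(∫ x in Ioo a b, g x ^ 2)
  have hev : ∀ᶠ r in 𝓝[>] (0 : ℝ), -c t ≤ (max R 0 + G) * √(2 * r) := by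
    filter_upwards [eventually_disjoint_Ioo B hB, self_mem_nhdsWithin] with r hr hr0
    have hr0' : 0 < r := hr0
    obtain ⟨ζ, hζ, hζ01, hζ1⟩ := IsTest.exists_bump t hr0'
    have hζI := hζ.mono (hr.1 t ht)
    have hζm : MemLp ζ 2 (volume.restrict (Ioo a b)) := (hζ.memLp 2).restrict _
    have h1 := hR ζ hζI fun x => (hζ01 x).1
    have hsum : ∑ s ∈ B, c s * ζ s = c t := by
      rw [Finset.sum_eq_single t]
      · rw [hζ1 t (by simp; positivity), mul_one]
      · intro s hs hst
        rw [hζ.eq_zero, mul_zero]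
        exact Set.disjoint_left.1 (hr.2 s hs t ht hst) ⟨by linarith, by linarith⟩
      · exact fun h' => absurd ht h'
    rw [hS.byParts ζ hζI, tsum_jump_eq hg.locallyIntegrable hui hu hB, hsum] at h1
    have h2 : √(∫ x in Ioo a b, ζ x ^ 2) ≤ √(2 * r) := by
      refine Real.sqrt_le_sqrt ?_
      have h3 : ∫ x in Ioo a b, ζ x ^ 2 ≤ ∫ x in Ioo a b, (Ioo (t - r) (t + r)).indicator 1 x := by
        refine integral_mono hζm.integrable_sq
          ((integrable_indicator_iff measurableSet_Ioo).2 (integrableOn_const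
            (ne_top_of_le_ne_top (by simp) (Measure.restrict_apply_le _ _)))) fun x => ?_
        by_cases hx : x ∈ Ioo (t - r) (t + r)
        · simp only [indicator_of_mem hx, Pi.one_apply]
          nlinarith [(hζ01 x).1, (hζ01 x).2]
        · simp [indicator_of_notMem hx, hζ.eq_zero hx]
      refine h3.trans_eq ?_
      rw [setIntegral_indicator measurableSet_Ioo, inter_eq_self_of_subset_right (hr.1 t ht)]
      simp only [Pi.one_apply]
      rw [setIntegral_const, Real.volume_real_Ioo_of_le (by linarith)]
      simp; ring
    have h4 := neg_abs_le (∫ x in Ioo a b, g x * ζ x)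
    have h5 := abs_integral_mul_le_sqrt (hgm.restrict (Ioo a b)) hζm
    have h6 : |∫ x in Ioo a b, g x * ζ x| ≤ G * √(2 * r) :=
      h5.trans (mul_le_mul_of_nonneg_left h2 (Real.sqrt_nonneg _))
    have h7 : R * √(∫ x in Ioo a b, ζ x ^ 2) ≤ max R 0 * √(2 * r) :=
      mul_le_mul (le_max_left _ _) h2 (Real.sqrt_nonneg _) (le_max_right _ _)
    have h8 := le_abs_self (∫ x in Ioo a b, g x * ζ x)
    rw [add_mul]
    linarith
  have hlim : Tendsto (fun r : ℝ => (max R 0 + G) * √(2 * r)) (𝓝[>] 0) (𝓝 0) := by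
    have : Continuous fun r : ℝ => (max R 0 + G) * √(2 * r) := by fun_prop
    simpa using (this.tendsto 0).mono_left nhdsWithin_le_nhds
  have := ge_of_tendsto hlim hev
  linarith

end BoundedEnergy

/-! ### The lower bound -/

/-- Zero energy would make the profile vanish, against its value `1` at `0`. -/
lemma IsOptimalProfile.transitionEnergy_pos {ρ : ℝ} (hρ : 0 < ρ) {w : ℝ → ℝ}
    (hw : IsOptimalProfile ρ w) : 0 < transitionEnergy ρ w := by
  obtain ⟨Q, hQ, he⟩ := hw.1.exists_isProfileData (ρ := ρ)
  refine lt_of_le_of_ne (transitionEnergy_nonneg hρ hw.1) fun h0 => ?_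
  rw [he, eq_comm, setIntegral_eq_zero_iff_of_nonneg_ae (by
    filter_upwards [ae_restrict_mem measurableSet_Ioi] with x hx
    exact hQ.density_nonneg hρ hx) hQ.integrableOn] at h0
  have h1 : profile Q =ᵐ[volume.restrict (Ioi 0)] fun _ => 0 := by
    filter_upwards [h0, ae_restrict_mem measurableSet_Ioi] with x hx hx0
    have h2 := (hQ.mem_Icc x hx0).1
    simp only [profileDensity, Pi.zero_apply] at hx
    nlinarith [sq_nonneg (primitive 0 Q x), mul_nonneg hρ.le (sq_nonneg (Q x))]
  have h3 := eqOn_Ici_of_ae_eq h1 (continuous_profile hQ.locallyIntegrable).continuousOn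
    continuousOn_const self_mem_Ici
  simp [profile] at h3

lemma BoundedEnergy.sharpCrackEnergy_le {a b κ ρ Gc : ℝ} {ε η : ℕ → ℝ} {U : Ultrafilter ℕ}
    {u v : ℕ → L1 a b} {u₀ v₀ : L1 a b} {e s : ℝ≥0∞} (h : BoundedEnergy a b κ ρ ε η U u v u₀ e s)
    (hκ : 0 < κ) (hρ : 0 < ρ) (hGc : 0 < Gc) {w : ℝ → ℝ} (hw : IsOptimalProfile ρ w)
    (hv₀ : v₀ = 0) :
    sharpCrackEnergy a b κ Gc (u₀, v₀)
      ≤ e + ENNReal.ofReal (Gc / (2 * transitionEnergy ρ w)) * s := by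
  have hK := hw.transitionEnergy_pos hρ
  have hfin := h.finite_crackSet hρ hw hK
  obtain ⟨g, hgm, hge, hgt⟩ := h.exists_strain hκ hρ
  set g' := (Ioo a b).indicator g
  have hgm' : MemLp g' 2 := (memLp_indicator_iff_restrict measurableSet_Ioo).2 hgm
  have hgi : Integrable g' := (integrable_indicator_iff measurableSet_Ioo).2
    (hgm.integrable (by norm_num))
  have hgg : g' =ᵐ[volume.restrict (Ioo a b)] g := indicator_ae_eq_restrict measurableSet_Ioo
  set B := hfin.toFinset
  have hBc : (B : Set ℝ) = crackSet a b U v := hfin.coe_toFinset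
  have hB : ∀ t ∈ B, t ∈ Ioo a b := fun t ht => (hfin.mem_toFinset.1 ht).1
  have hui : IntegrableOn u₀ (Ioo a b) := L1.integrable_coeFn u₀
  obtain ⟨c₀, c, hc⟩ := exists_ae_eq_piecewisePrimitive hgi B hB hui fun φ hφ => by
    have hφI : IsTest (Ioo a b) φ := hφ.mono sdiff_subset
    rw [hBc] at hφ
    have e1 : ∫ x in Ioo a b, g' x * φ x = ∫ x in Ioo a b, g x * φ x :=
      integral_congr_ae (hgg.mul (EventuallyEq.refl _ φ))
    rw [integral_add (hφI.deriv.integrable_mul hui.locallyIntegrableOn).integrableOn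
      (hφI.integrable_mul (hgi.locallyIntegrable.locallyIntegrableOn _)).integrableOn, e1,
      hgt φ hφ]
    ring
  obtain ⟨hJfin, hS⟩ := hasSBVDeriv_of_piecewisePrimitive hgi hui hc hB
  have hmem := mem_jumpSet_iff hgi.locallyIntegrable hui hc hB
  have hd := hS.sbvDensity_ae_eq.trans hgg
  have hcond : MemSBV2 a b u₀ ∧ (∀ x ∈ jumpSet a b u₀, 0 < jump u₀ x) ∧
      ∀ᵐ x ∂volume.restrict (Ioo a b), v₀ x = 0 := by
    refine ⟨⟨⟨g', hS⟩, hgm.ae_eq hd.symm, hJfin⟩, fun x hx => ?_, ?_⟩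
    · obtain ⟨hxB, hcx⟩ := (hmem x).1 hx
      rw [jump_eq hgi.locallyIntegrable hui hc (hB x hxB), if_pos hxB]
      -- Nonnegative on the whole crack set, and nonzero at an actual jump.
      exact lt_of_le_of_ne (h.jump_coeff_nonneg hκ hgm' hgi hB hc hxB) hcx.symm
    · subst hv₀
      exact Lp.coeFn_zero ℝ 1 _
  rw [sharpCrackEnergy, if_pos hcond]
  refine add_le_add ?_ ?_
  · refine (lintegral_mono_set sdiff_subset).trans (le_trans (le_of_eq ?_) hge)
    rw [← integral_const_mul, ofReal_integral_eq_lintegral_ofReal (hgm.integrable_sq.const_mul κ)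
      (ae_of_all _ fun x => by positivity)]
    refine lintegral_congr_ae ?_
    filter_upwards [hd] with x hx
    rw [hx]
  · have h1 := h.card_mul_le hρ hw B hBc.subset
    have h2 : ((jumpSet a b u₀).encard : ℝ≥0∞) ≤ (B.card : ℝ≥0∞) := by
      have h3 : (jumpSet a b u₀).encard ≤ (B.card : ℕ∞) := by
        rw [← Set.encard_coe_eq_coe_finsetCard]
        -- Jumps occur only in the crack set, so counting crack points bounds the number of jumps
        -- from above.
        exact encard_le_encard fun x hx => ((hmem x).1 hx).1
      simpa using ENat.toENNReal_mono h3
    calc ENNReal.ofReal Gc * ((jumpSet a b u₀).encard : ℝ≥0∞)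
        ≤ ENNReal.ofReal (Gc / (2 * transitionEnergy ρ w) * (2 * transitionEnergy ρ w)) * B.card := by
          rw [div_mul_cancel₀ _ (by positivity)]
          gcongr
      _ = ENNReal.ofReal (Gc / (2 * transitionEnergy ρ w)) *
          (B.card * ENNReal.ofReal (2 * transitionEnergy ρ w)) := by
          rw [ENNReal.ofReal_mul (by positivity), mul_assoc, mul_comm (B.card : ℝ≥0∞)]
      _ ≤ _ := by gcongr

/-- For `C` above the liminf, take an ultrafilter finer than `atTop` that contains the set of
indices with energy below `C`. Compactness of `ℝ≥0∞` then provides separate limits of the elastic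
and the surface part. -/
theorem sharpCrackEnergy_le_liminf {a b κ ρ Gc : ℝ} (hκ : 0 < κ) (hρ : 0 < ρ) (hGc : 0 < Gc)
    {w : ℝ → ℝ} (hw : IsOptimalProfile ρ w) {ε η : ℕ → ℝ} (hε : ∀ n, 0 < ε n)
    (hε0 : Tendsto ε atTop (𝓝 0)) (hη : ∀ n, 0 ≤ η n) {x : L1 a b × L1 a b}
    {y : ℕ → L1 a b × L1 a b} (hy : Tendsto y atTop (𝓝 x)) :
    sharpCrackEnergy a b κ Gc x ≤ liminf (fun n =>
      phaseFieldEnergy a b κ Gc ρ (2 * transitionEnergy ρ w) (ε n) (η n) (y n)) atTop := by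
  set F := fun n => phaseFieldEnergy a b κ Gc ρ (2 * transitionEnergy ρ w) (ε n) (η n) (y n)
  refine le_of_forall_gt_imp_ge_of_dense fun C hC => ?_
  rcases eq_or_ne C ⊤ with rfl | hCtop
  · exact le_top
  have hK := hw.transitionEnergy_pos hρ
  have hfreq : ∃ᶠ n in atTop, n ∈ {n | F n < C} := frequently_lt_of_liminf_lt (by isBoundedDefault) hC
  have : NeBot (atTop ⊓ 𝓟 {n | F n < C}) := frequently_mem_iff_neBot.1 hfreq
  set U : Ultrafilter ℕ := Ultrafilter.of (atTop ⊓ 𝓟 {n | F n < C})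
  have hUle : (U : Filter ℕ) ≤ atTop := (Ultrafilter.of_le _).trans inf_le_left
  have hUF : ∀ᶠ n in U, F n < C := ((Ultrafilter.of_le _).trans inf_le_right) (mem_principal_self _)
  have hst : ∀ᶠ n in U, (MemH1 (Ioo a b) (y n).1 ∧ MemH2 (Ioo a b) (y n).2 ∧
      ∀ᵐ x ∂volume.restrict (Ioo a b), 0 ≤ (y n).2 x ∧ (y n).2 x ≤ 1) ∧
      elasticEnergy a b κ (η n) (y n).1 (y n).2
        + ENNReal.ofReal (Gc / (2 * transitionEnergy ρ w)) * surfaceIntegral a b ρ (ε n) (y n).2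
        ≤ C := by
    filter_upwards [hUF] with n hn
    simp only [F, phaseFieldEnergy] at hn
    split_ifs at hn with h1
    · exact ⟨h1, hn.le⟩
    · exact absurd hn not_top_lt
  obtain ⟨e, -, he⟩ := isCompact_univ.ultrafilter_le_nhds
    (U.map fun n => elasticEnergy a b κ (η n) (y n).1 (y n).2) (by simp)
  obtain ⟨s, -, hs⟩ := isCompact_univ.ultrafilter_le_nhds
    (U.map fun n => surfaceIntegral a b ρ (ε n) (y n).2) (by simp)
  have hes : e + ENNReal.ofReal (Gc / (2 * transitionEnergy ρ w)) * s ≤ C :=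
    le_of_tendsto (Tendsto.add he (ENNReal.Tendsto.const_mul hs (Or.inr ENNReal.ofReal_ne_top)))
      (hst.mono fun n hn => hn.2)
  have hs_lt : s ≠ ⊤ := by
    rintro rfl
    rw [ENNReal.mul_top (by simp; positivity)] at hes
    exact hCtop (top_le_iff.1 (le_trans (by simp) hes))
  have hB : BoundedEnergy a b κ ρ ε η U (fun n => (y n).1) (fun n => (y n).2) x.1 e s :=
    { ε_pos := hε
      ε_tendsto := hε0.mono_left hUle
      η_nonneg := hη
      u_tendsto := ((continuous_fst.tendsto x).comp hy).mono_left hUle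
      memH1 := hst.mono fun n hn => hn.1.1
      memH2 := hst.mono fun n hn => hn.1.2.1
      mem_Icc := hst.mono fun n hn => hn.1.2.2
      elastic := he
      surface := hs
      e_ne_top := ne_top_of_le_ne_top hCtop (le_self_add.trans hes)
      s_ne_top := hs_lt }
  have hv0 : x.2 = 0 := by
    have h1 := (((continuous_snd.tendsto x).comp hy).mono_left hUle).norm
    exact norm_eq_zero.1 (tendsto_nhds_unique h1 (hB.norm_v_tendsto hρ))
  exact (hB.sharpCrackEnergy_le (v₀ := x.2) hκ hρ hGc hw hv0).trans hes

/-! ### Recovery of the phase field -/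

lemma memLp_of_continuous {f : ℝ → ℝ} (hf : Continuous f) (a b : ℝ) (p : ℝ≥0∞) :
    MemLp f p (volume.restrict (Ioo a b)) := by
  obtain ⟨C, hC⟩ := (isCompact_Icc (a := a) (b := b)).exists_bound_of_continuousOn hf.continuousOn
  refine MemLp.of_bound hf.aestronglyMeasurable C ?_
  filter_upwards [ae_restrict_mem measurableSet_Ioo] with x hx
  exact hC x (Ioo_subset_Icc_self hx)

lemma memH2_of_hasWeakDeriv {I : Set ℝ} (hI : IsOpen I) {v v1 v2 : ℝ → ℝ}
    (h0 : MemLp v 2 (volume.restrict I)) (h1 : MemLp v1 2 (volume.restrict I))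
    (h2 : MemLp v2 2 (volume.restrict I)) (d1 : HasWeakDeriv I v v1) (d2 : HasWeakDeriv I v1 v2) :
    MemH2 I v ∧ weakDeriv I v =ᵐ[volume.restrict I] v1 ∧
      weakDeriv I (weakDeriv I v) =ᵐ[volume.restrict I] v2 := by
  have e1 := d1.weakDeriv_ae_eq hI
  refine ⟨⟨MemH1.of_hasWeakDeriv hI h0 h1 d1, (MemH1.of_hasWeakDeriv hI h1 h2 d2).congr e1.symm⟩,
    e1, ?_⟩
  rw [weakDeriv_congr e1]
  exact d2.weakDeriv_ae_eq hI

lemma primitive_eq_of_nonpos {Q : ℝ → ℝ} (hQ : ∀ x ≤ 0, Q x = 0) (c : ℝ) {x : ℝ} (hx : x ≤ 0) :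
    primitive c Q x = c := by
  rw [primitive, intervalIntegral.integral_congr (g := fun _ => 0)]
  · simp
  · intro t ht
    rw [uIcc_of_ge hx] at ht
    exact hQ t ht.2

/-- Two back-to-back copies of a profile, at scale `ε`, glued to a plateau of half-width `δ`. -/
lemma IsProfileData.exists_transition {ρ : ℝ} (hρ : 0 < ρ) {Q : ℝ → ℝ} (hQ : IsProfileData ρ Q)
    {ε δ : ℝ} (hε : 0 < ε) (hδ : 0 < δ) (t : ℝ) :
    ∃ V V1 V2 : ℝ → ℝ, HasWeakDeriv univ V V1 ∧ HasWeakDeriv univ V1 V2 ∧ Continuous V ∧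
      Continuous V1 ∧ MemLp V2 2 ∧ (∀ x, 0 ≤ V x ∧ V x ≤ 1) ∧ (∀ x, |x - t| ≤ δ → V x = 1) ∧
      ∫⁻ x, ENNReal.ofReal (surfaceDensity ρ ε (V x) (V1 x) (V2 x))
        ≤ ENNReal.ofReal (2 * (∫ x in Ioi 0, profileDensity ρ Q x) + 2 * δ / ε) := by
  have hl := hQ.locallyIntegrable
  set P := primitive 0 Q
  set W := profile Q
  have hP0 : ∀ x ≤ 0, P x = 0 := fun x hx => primitive_eq_of_nonpos hQ.eq_zero 0 hx
  have hW0 : ∀ x ≤ 0, W x = 1 := fun x hx => primitive_eq_of_nonpos hP0 1 hx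
  have hW : ∀ x, 0 ≤ W x ∧ W x ≤ 1 := fun x => by
    rcases le_or_gt x 0 with hx | hx
    · rw [hW0 x hx]; norm_num
    · exact hQ.mem_Icc x hx
  have hWc : Continuous W := continuous_profile hl
  have hPc : Continuous P := continuous_primitive 0 hl
  have dW : HasWeakDeriv univ W P := hasWeakDeriv_profile hl
  have dP : HasWeakDeriv univ P Q := hasWeakDeriv_primitive 0 hl
  have hi : (ε⁻¹ : ℝ) ≠ 0 := inv_ne_zero hε.ne'
  have hi' : -(ε⁻¹ : ℝ) ≠ 0 := neg_ne_zero.2 hi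
  set p := -((t + δ) / ε)
  set q := (t - δ) / ε
  have hp : ∀ x, ε⁻¹ * x + p = (x - t - δ) / ε := fun x => by simp only [p]; field_simp; ring
  have hq : ∀ x, -ε⁻¹ * x + q = (-(x - t) - δ) / ε := fun x => by simp only [q]; field_simp; ring
  -- The two arguments are never both positive, and `W = 1` on the nonpositive axis. So in `W + W -
  -- 1` one summand cancels the `-1`, and at each point only one profile is active.
  have hneg : ∀ x, -ε⁻¹ * x + q ≤ 0 ∨ ε⁻¹ * x + p ≤ 0 := fun x => by
    rw [hp, hq]
    rcases le_total 0 (x - t) with h | h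
    · exact Or.inl (div_nonpos_of_nonpos_of_nonneg (by linarith) hε.le)
    · exact Or.inr (div_nonpos_of_nonpos_of_nonneg (by linarith) hε.le)
  have hplat : ∀ x, |x - t| ≤ δ ↔ -ε⁻¹ * x + q ≤ 0 ∧ ε⁻¹ * x + p ≤ 0 := fun x => by
    rw [hp, hq, div_le_iff₀ hε, div_le_iff₀ hε, zero_mul, abs_le]
    constructor
    · rintro ⟨h1, h2⟩; constructor <;> linarith
    · rintro ⟨h1, h2⟩; constructor <;> linarith
  let D : ℝ → ℝ≥0∞ := (Ioi (0 : ℝ)).indicator fun y => ENNReal.ofReal (profileDensity ρ Q y)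
  have hDi : ∫⁻ y, D y = ENNReal.ofReal (∫ x in Ioi 0, profileDensity ρ Q x) := by
    rw [lintegral_indicator measurableSet_Ioi, ofReal_integral_eq_lintegral_ofReal hQ.integrableOn]
    filter_upwards [ae_restrict_mem measurableSet_Ioi] with x hx using hQ.density_nonneg hρ hx
  have hDm : AEMeasurable D := by
    refine (aemeasurable_indicator_iff measurableSet_Ioi).2 ?_
    exact hQ.integrableOn.1.aemeasurable.ennreal_ofReal
  refine ⟨fun x => (W (ε⁻¹ * x + p) + W (-ε⁻¹ * x + q)) - 1,
    fun x => ((ε⁻¹ * P (ε⁻¹ * x + p)) + (-ε⁻¹ * P (-ε⁻¹ * x + q))) - 0,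
    fun x => ((ε⁻¹ * (ε⁻¹ * Q (ε⁻¹ * x + p))) + (-ε⁻¹ * (-ε⁻¹ * Q (-ε⁻¹ * x + q)))) - 0,
    ((dW.comp_affine p hi).add (dW.comp_affine q hi')).sub (hasWeakDeriv_const 1),
    (((dP.comp_affine p hi).const_mul _).add ((dP.comp_affine q hi').const_mul _)).sub
      (hasWeakDeriv_const 0), by fun_prop, by fun_prop, ?_, fun x => ?_, fun x hx => ?_, ?_⟩
  · simp only [sub_zero]
    exact (((memLp_comp_affine hQ.memLp p hi).const_mul _).const_mul _).add
      (((memLp_comp_affine hQ.memLp q hi').const_mul _).const_mul _)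
  · dsimp only
    rcases hneg x with h | h
    · rw [hW0 _ h]; simpa using hW _
    · rw [hW0 _ h]; simpa using hW _
  · obtain ⟨h1, h2⟩ := (hplat x).1 hx
    dsimp only
    rw [hW0 _ h1, hW0 _ h2]; norm_num
  · have hpt : ∀ x, ENNReal.ofReal (surfaceDensity ρ ε ((W (ε⁻¹ * x + p) + W (-ε⁻¹ * x + q)) - 1)
        (((ε⁻¹ * P (ε⁻¹ * x + p)) + (-ε⁻¹ * P (-ε⁻¹ * x + q))) - 0)
        (((ε⁻¹ * (ε⁻¹ * Q (ε⁻¹ * x + p))) + (-ε⁻¹ * (-ε⁻¹ * Q (-ε⁻¹ * x + q)))) - 0))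
        ≤ (Icc (t - δ) (t + δ)).indicator (fun _ => ENNReal.ofReal ε⁻¹) x
          + (ENNReal.ofReal ε⁻¹ * D (ε⁻¹ * x + p) + ENNReal.ofReal ε⁻¹ * D (-ε⁻¹ * x + q)) := by
      intro x
      by_cases hx : |x - t| ≤ δ
      · obtain ⟨h1, h2⟩ := (hplat x).1 hx
        have hx' : x ∈ Icc (t - δ) (t + δ) := by
          rw [abs_le] at hx; constructor <;> linarith [hx.1, hx.2]
        rw [indicator_of_mem hx', hW0 _ h1, hW0 _ h2, hP0 _ h1, hP0 _ h2, hQ.eq_zero _ h1,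
          hQ.eq_zero _ h2]
        refine le_trans (le_of_eq ?_) le_self_add
        simp [surfaceDensity]
      · refine le_trans ?_ le_add_self
        rcases hneg x with h | h
        · have h' : 0 < ε⁻¹ * x + p := by
            by_contra h'
            exact hx ((hplat x).2 ⟨h, not_lt.1 h'⟩)
          refine le_trans ?_ le_self_add
          rw [show D (ε⁻¹ * x + p) = ENNReal.ofReal (profileDensity ρ Q (ε⁻¹ * x + p)) from
            indicator_of_mem (s := Ioi (0 : ℝ)) h' _, ← ENNReal.ofReal_mul (by positivity), hW0 _ h,
            hP0 _ h, hQ.eq_zero _ h]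
          refine ENNReal.ofReal_le_ofReal (le_of_eq ?_)
          simp only [surfaceDensity, profileDensity, W, P]
          field_simp; ring
        · have h' : 0 < -ε⁻¹ * x + q := by
            by_contra h'
            exact hx ((hplat x).2 ⟨not_lt.1 h', h⟩)
          refine le_trans ?_ le_add_self
          rw [show D (-ε⁻¹ * x + q) = ENNReal.ofReal (profileDensity ρ Q (-ε⁻¹ * x + q)) from
            indicator_of_mem (s := Ioi (0 : ℝ)) h' _, ← ENNReal.ofReal_mul (by positivity), hW0 _ h,
            hP0 _ h, hQ.eq_zero _ h]
          refine ENNReal.ofReal_le_ofReal (le_of_eq ?_)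
          simp only [surfaceDensity, profileDensity, W, P]
          field_simp; ring
    refine (lintegral_mono hpt).trans ?_
    have hm1 : AEMeasurable (fun x => D (ε⁻¹ * x + p)) :=
      hDm.comp_quasiMeasurePreserving (quasiMeasurePreserving_affine p hi)
    have hone : ENNReal.ofReal ε⁻¹ * ENNReal.ofReal ε = 1 := by
      rw [← ENNReal.ofReal_mul (by positivity), inv_mul_cancel₀ hε.ne', ENNReal.ofReal_one]
    rw [lintegral_add_left (measurable_const.indicator measurableSet_Icc),
      lintegral_add_left' (hm1.const_mul _), lintegral_indicator measurableSet_Icc,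
      lintegral_const_mul' _ _ ENNReal.ofReal_ne_top, lintegral_const_mul' _ _ ENNReal.ofReal_ne_top,
      lintegral_comp_affine D p hi, lintegral_comp_affine D q hi', setLIntegral_const,
      Real.volume_Icc, hDi, inv_neg, inv_inv, abs_neg, abs_of_pos hε, ← mul_assoc, hone, one_mul,
      ← ENNReal.ofReal_mul (by positivity)]
    have hK0 : 0 ≤ ∫ x in Ioi 0, profileDensity ρ Q x :=
      setIntegral_nonneg measurableSet_Ioi fun x hx => hQ.density_nonneg hρ hx
    have hδε : 0 ≤ ε⁻¹ * (t + δ - (t - δ)) := by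
      have : t + δ - (t - δ) = 2 * δ := by ring
      rw [this]; positivity
    rw [← ENNReal.ofReal_add hK0 hK0, ← ENNReal.ofReal_add hδε (by positivity)]
    refine ENNReal.ofReal_le_ofReal (le_of_eq ?_)
    field_simp; ring

/-- One transition at each point of `B`, times a cutoff so that the supports are disjoint and at
most one summand is active anywhere. The cutoff accounts for the factor `1 + C * ε`, through
`surfaceDensity_mul_le`. -/
lemma exists_phaseField {a b ρ : ℝ} (hρ : 0 < ρ) {w : ℝ → ℝ} (hw : IsOptimalProfile ρ w)
    (B : Finset ℝ) (hB : ∀ t ∈ B, t ∈ Ioo a b) :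
    ∃ r C : ℝ, 0 < r ∧ 0 ≤ C ∧ ∀ ε δ : ℝ, 0 < ε → ε ≤ 1 → 0 < δ → δ ≤ r →
      ∃ v : L1 a b, MemH2 (Ioo a b) v ∧ (∀ᵐ x ∂volume.restrict (Ioo a b), 0 ≤ v x ∧ v x ≤ 1) ∧
        (∀ᵐ x ∂volume.restrict (Ioo a b), ∀ t ∈ B, x ∈ Ioc t (t + δ) → v x = 1) ∧
        surfaceIntegral a b ρ ε v
          ≤ ENNReal.ofReal (B.card * ((1 + C * ε) * (2 * transitionEnergy ρ w + 2 * δ / ε))) := by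
  obtain ⟨Q, hQ, hQe⟩ := hw.1.exists_isProfileData (ρ := ρ)
  obtain ⟨r, ⟨hrI, hrd⟩, hr0⟩ := ((eventually_disjoint_Ioo B hB).and self_mem_nhdsWithin).exists
  have hr : 0 < r := hr0
  choose ζ hζ hζ01 hζ1 using fun t => IsTest.exists_bump t hr
  choose D1 hD1 hb1 using fun t => (hζ t).deriv.bounded
  choose D2 hD2 hb2 using fun t => (hζ t).deriv.deriv.bounded
  set D := ∑ t ∈ B, (D1 t + D2 t)
  have hDt : ∀ t ∈ B, D1 t + D2 t ≤ D := fun t ht =>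
    Finset.single_le_sum (f := fun t => D1 t + D2 t) (fun i _ => (add_pos (hD1 i) (hD2 i)).le) ht
  set C := 1 + 2 * D ^ 2 + 20 * ρ * D ^ 2
  -- The cutoff equals one within `r / 2`, so a plateau of half-width `δ ≤ r / 2` survives it.
  refine ⟨r / 2, C, half_pos hr, by positivity, fun ε δ hε hε1 hδ hδr => ?_⟩
  choose V V1 V2 dV dV1 hVc hV1c hV2 hV01 hV1 hVe using
    fun t => hQ.exists_transition hρ hε hδ t
  rw [← hQe] at hVe
  set Z : ℝ → ℝ → ℝ := fun t x => V t x * ζ t x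
  set Z1 : ℝ → ℝ → ℝ := fun t x => V1 t x * ζ t x + V t x * deriv (ζ t) x
  set Z2 : ℝ → ℝ → ℝ := fun t x =>
    (V2 t x * ζ t x + V1 t x * deriv (ζ t) x) + (V1 t x * deriv (ζ t) x + V t x * deriv (deriv (ζ t)) x)
  have dZ : ∀ t, HasWeakDeriv univ (Z t) (Z1 t) := fun t =>
    ((dV t).mono (subset_univ _)).mul_test (hζ t)
  have dZ1 : ∀ t, HasWeakDeriv univ (Z1 t) (Z2 t) := fun t =>
    (((dV1 t).mono (subset_univ _)).mul_test (hζ t)).add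
      (((dV t).mono (subset_univ _)).mul_test (hζ t).deriv)
  have mV := fun t => memLp_of_continuous (hVc t) (t - r) (t + r) 2
  have mV1 := fun t => memLp_of_continuous (hV1c t) (t - r) (t + r) 2
  have mZ : ∀ t, MemLp (Z t) 2 := fun t => memLp_mul_test isOpen_Ioo (mV t) (hζ t)
  have mZ1 : ∀ t, MemLp (Z1 t) 2 := fun t => (memLp_mul_test isOpen_Ioo (mV1 t) (hζ t)).add
    (memLp_mul_test isOpen_Ioo (mV t) (hζ t).deriv)
  have mZ2 : ∀ t, MemLp (Z2 t) 2 := fun t =>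
    ((memLp_mul_test isOpen_Ioo ((hV2 t).restrict _) (hζ t)).add
    (memLp_mul_test isOpen_Ioo (mV1 t) (hζ t).deriv)).add
    ((memLp_mul_test isOpen_Ioo (mV1 t) (hζ t).deriv).add
    (memLp_mul_test isOpen_Ioo (mV t) (hζ t).deriv.deriv))
  have hsupp : ∀ t x, x ∉ Ioo (t - r) (t + r) → Z t x = 0 ∧ Z1 t x = 0 ∧ Z2 t x = 0 := by
    intro t x hx
    simp [Z, Z1, Z2, (hζ t).eq_zero hx, (hζ t).deriv.eq_zero hx, (hζ t).deriv.deriv.eq_zero hx]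
  have hZ01 : ∀ t x, 0 ≤ Z t x ∧ Z t x ≤ 1 := fun t x =>
    ⟨mul_nonneg (hV01 t x).1 (hζ01 t x).1, mul_le_one₀ (hV01 t x).2 (hζ01 t x).1 (hζ01 t x).2⟩
  have hsum : ∀ x, ∀ t ∈ B, x ∈ Ioo (t - r) (t + r) → ∑ i ∈ B, Z i x = Z t x ∧
      ∑ i ∈ B, Z1 i x = Z1 t x ∧ ∑ i ∈ B, Z2 i x = Z2 t x := by
    intro x t ht hx
    have hne : ∀ i ∈ B, i ≠ t → x ∉ Ioo (i - r) (i + r) := fun i hi hit hxi =>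
      Set.disjoint_left.1 (hrd i hi t ht hit) hxi hx
    exact ⟨Finset.sum_eq_single_of_mem t ht fun i hi hit => (hsupp i x (hne i hi hit)).1,
      Finset.sum_eq_single_of_mem t ht fun i hi hit => (hsupp i x (hne i hi hit)).2.1,
      Finset.sum_eq_single_of_mem t ht fun i hi hit => (hsupp i x (hne i hi hit)).2.2⟩
  have hv01 : ∀ x, 0 ≤ ∑ i ∈ B, Z i x ∧ ∑ i ∈ B, Z i x ≤ 1 := by
    intro x
    by_cases h : ∃ t ∈ B, x ∈ Ioo (t - r) (t + r)
    · obtain ⟨t, ht, hx⟩ := h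
      rw [(hsum x t ht hx).1]
      exact hZ01 t x
    · push Not at h
      rw [Finset.sum_eq_zero fun i hi => (hsupp i x (h i hi)).1]
      norm_num
  have hdens : ∀ x, ENNReal.ofReal (surfaceDensity ρ ε (∑ i ∈ B, Z i x) (∑ i ∈ B, Z1 i x)
      (∑ i ∈ B, Z2 i x)) ≤ ∑ t ∈ B, ENNReal.ofReal (1 + C * ε) *
        ENNReal.ofReal (surfaceDensity ρ ε (V t x) (V1 t x) (V2 t x)) := by
    intro x
    by_cases h : ∃ t ∈ B, x ∈ Ioo (t - r) (t + r)
    · obtain ⟨t, ht, hx⟩ := h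
      obtain ⟨e0, e1, e2⟩ := hsum x t ht hx
      rw [e0, e1, e2]
      refine le_trans ?_ (Finset.single_le_sum (fun i _ => zero_le) ht)
      rw [← ENNReal.ofReal_mul (by positivity)]
      refine ENNReal.ofReal_le_ofReal (surfaceDensity_mul_le hρ hε hε1 (hV01 t x).1 (hV01 t x).2
        (hζ01 t x).1 (hζ01 t x).2 ((hb1 t x).trans ?_) ((hb2 t x).trans ?_))
      · linarith [hDt t ht, hD2 t]
      · linarith [hDt t ht, hD1 t]
    · push Not at h
      rw [Finset.sum_eq_zero fun i hi => (hsupp i x (h i hi)).1,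
        Finset.sum_eq_zero fun i hi => (hsupp i x (h i hi)).2.1,
        Finset.sum_eq_zero fun i hi => (hsupp i x (h i hi)).2.2]
      simp [surfaceDensity]
  have mS : ∀ {f : ℝ → ℝ → ℝ}, (∀ t, MemLp (f t) 2) →
      MemLp (fun x => ∑ i ∈ B, f i x) 2 (volume.restrict (Ioo a b)) := fun hf =>
    (memLp_finsetSum B fun i _ => hf i).restrict _
  have mv := mS mZ
  have mv1 : MemLp (fun x => ∑ i ∈ B, Z i x) 1 (volume.restrict (Ioo a b)) :=
    mv.mono_exponent (by norm_num)
  have hae := mv1.coeFn_toLp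
  have d1 := ((HasWeakDeriv.sum B fun t _ => dZ t).mono (subset_univ (Ioo a b))).congr hae.symm
    (EventuallyEq.refl _ _)
  obtain ⟨hH2, w1, w2⟩ := memH2_of_hasWeakDeriv isOpen_Ioo (mv.ae_eq hae.symm) (mS mZ1) (mS mZ2) d1
    ((HasWeakDeriv.sum B fun t _ => dZ1 t).mono (subset_univ (Ioo a b)))
  refine ⟨mv1.toLp _, hH2, ?_, ?_, ?_⟩
  · filter_upwards [hae] with x hx
    rw [hx]
    exact hv01 x
  · filter_upwards [hae] with x hx t ht hxt
    have hx1 : |x - t| ≤ δ := by rw [abs_le]; constructor <;> linarith [hxt.1, hxt.2]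
    rw [hx, (hsum x t ht ⟨by linarith [hxt.1], by linarith [hxt.2]⟩).1]
    simp only [Z]
    rw [hV1 t x hx1, hζ1 t x (hx1.trans hδr), one_mul]
  · have e1 : surfaceIntegral a b ρ ε (mv1.toLp _)
        = ∫⁻ x in Ioo a b, ENNReal.ofReal (surfaceDensity ρ ε (∑ i ∈ B, Z i x) (∑ i ∈ B, Z1 i x)
          (∑ i ∈ B, Z2 i x)) := by
      refine lintegral_congr_ae ?_
      filter_upwards [hae, w1, w2] with x h0 h1 h2
      rw [h0, h1, h2, surfaceDensity]
    rw [e1]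
    refine (setLIntegral_le_lintegral _ _).trans ((lintegral_mono hdens).trans ?_)
    rw [lintegral_finsetSum']
    · refine (Finset.sum_le_sum fun t _ => ?_).trans_eq
        (b := ∑ t ∈ B, ENNReal.ofReal ((1 + C * ε) * (2 * transitionEnergy ρ w + 2 * δ / ε))) ?_
      · rw [lintegral_const_mul' _ _ ENNReal.ofReal_ne_top, ENNReal.ofReal_mul (by positivity)]
        gcongr
        exact hVe t
      · rw [Finset.sum_const, nsmul_eq_mul, ENNReal.ofReal_mul (Nat.cast_nonneg _),
          ENNReal.ofReal_natCast]
    · intro t _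
      refine AEMeasurable.const_mul (AEMeasurable.ennreal_ofReal ?_) _
      exact (((hVc t).aemeasurable.const_mul _).add (((hV1c t).aemeasurable.pow_const 2).const_mul _)).add
        (((hV2 t).1.aemeasurable.pow_const 2).const_mul _)

/-! ### Recovery of the displacement -/

/-- The density of a linear ramp of height `1` on `(t, t + δ]`. -/
def rampDensity (t δ : ℝ) : ℝ → ℝ := (Ioc t (t + δ)).indicator fun _ => δ⁻¹

/-- The linear ramp of height `1` on `(t, t + δ]`. -/
def ramp (t δ x : ℝ) : ℝ := ∫ y in t..x, rampDensity t δ y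

lemma memLp_rampDensity (t δ : ℝ) (p : ℝ≥0∞) : MemLp (rampDensity t δ) p :=
  memLp_indicator_const p measurableSet_Ioc _ (Or.inr (by simp))

lemma locallyIntegrable_rampDensity (t δ : ℝ) : LocallyIntegrable (rampDensity t δ) :=
  (memLp_one_iff_integrable.1 (memLp_rampDensity t δ 1)).locallyIntegrable

lemma ramp_eq_primitive (t δ : ℝ) :
    ramp t δ = primitive (∫ y in t..0, rampDensity t δ y) (rampDensity t δ) := by
  funext x
  have h := intervalIntegrable_of_locallyIntegrable (locallyIntegrable_rampDensity t δ)
  exact (intervalIntegral.integral_add_adjacent_intervals (h t 0) (h 0 x)).symm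

/-- The two differ only on the ramp, of length `δ`, which makes the L¹ error of the displacement of
order `δ`. -/
lemma abs_ramp_sub_step_le (t : ℝ) {δ : ℝ} (hδ : 0 < δ) (x : ℝ) :
    |ramp t δ x - step t x| ≤ (Ioc t (t + δ)).indicator (fun _ => 1) x := by
  rcases le_or_gt x t with hx | hx
  · have h1 : ramp t δ x = 0 := by
      rw [ramp, intervalIntegral.integral_of_ge hx, setIntegral_eq_zero_of_forall_eq_zero, neg_zero]
      exact fun y hy => indicator_of_notMem (fun h' => not_lt.2 hy.2 h'.1) _
    rw [h1, step_of_le hx, sub_zero, abs_zero]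
    exact indicator_nonneg (fun _ _ => zero_le_one) _
  · have h1 : ramp t δ x = (min x (t + δ) - t) * δ⁻¹ := by
      rw [ramp, intervalIntegral.integral_of_le hx.le, rampDensity,
        setIntegral_indicator measurableSet_Ioc, Ioc_inter_Ioc, sup_idem, setIntegral_const,
        Real.volume_real_Ioc_of_le (le_min hx.le (by linarith)), smul_eq_mul]
    rw [h1, step_of_lt hx]
    rcases le_or_gt x (t + δ) with hx' | hx'
    · rw [indicator_of_mem (show x ∈ Ioc t (t + δ) from ⟨hx, hx'⟩), min_eq_left hx', ← div_eq_mul_inv,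
        abs_le]
      have h2 : 0 ≤ (x - t) / δ := div_nonneg (by linarith) hδ.le
      have h3 : (x - t) / δ ≤ 1 := (div_le_one hδ).2 (by linarith)
      constructor <;> linarith
    · rw [min_eq_right hx'.le, add_sub_cancel_left, mul_inv_cancel₀ hδ.ne', sub_self, abs_zero]
      exact indicator_nonneg (fun _ _ => zero_le_one) _

/-- `S` is the strain of the ramps. It is present only where `v = 1`, so its tension pays just the
residual `η`; and since `S ≥ 0`, the compressive part of `g + S` does not exceed that of `g`. This
is where the positivity of the jumps enters. -/
lemma elastic_density_le {κ η v g S : ℝ} (hκ : 0 < κ) (hη : 0 ≤ η) (hv0 : 0 ≤ v) (hv1 : v ≤ 1)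
    (hS : 0 ≤ S) (hSv : S ≠ 0 → v = 1) :
    κ * degradation η v * max (g + S) 0 ^ 2 + κ * max (-(g + S)) 0 ^ 2
      ≤ κ * (1 + 2 * η) * g ^ 2 + 2 * κ * η * S ^ 2 := by
  have h1 : max (g + S) 0 ^ 2 ≤ 2 * g ^ 2 + 2 * S ^ 2 := by
    rcases le_total 0 (g + S) with h | h
    · rw [max_eq_left h]; nlinarith [sq_nonneg (g - S)]
    · rw [max_eq_right h]; nlinarith [sq_nonneg g, sq_nonneg S]
  have hsplit : κ * degradation η v * max (g + S) 0 ^ 2 + κ * max (-(g + S)) 0 ^ 2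
      = κ * ((v - 1) ^ 2 * max (g + S) 0 ^ 2 + max (-(g + S)) 0 ^ 2) + κ * η * max (g + S) 0 ^ 2 := by
    unfold degradation; ring
  have h2 : (v - 1) ^ 2 * max (g + S) 0 ^ 2 + max (-(g + S)) 0 ^ 2 ≤ g ^ 2 := by
    rcases eq_or_ne S 0 with rfl | hS0
    · rw [add_zero]
      have hv2 : (v - 1) ^ 2 ≤ 1 := by nlinarith
      rcases le_total 0 g with h | h
      · rw [max_eq_left h, max_eq_right (by linarith)]; nlinarith [sq_nonneg g]
      · rw [max_eq_right h, max_eq_left (by linarith)]; nlinarith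
    · rw [hSv hS0]
      rcases le_total 0 (g + S) with h | h
      · rw [max_eq_right (by linarith : -(g + S) ≤ 0)]; nlinarith [sq_nonneg g]
      · rw [max_eq_left (by linarith : 0 ≤ -(g + S))]; nlinarith
  have h3 := mul_le_mul_of_nonneg_left h2 hκ.le
  have h4 := mul_le_mul_of_nonneg_left h1 (mul_nonneg hκ.le hη)
  rw [hsplit]
  linarith

/-- A ramp of height `c t` and width `δ` has squared strain of integral `c t ^ 2 / δ`, which the
residual stiffness weights by `η`. The factor `B.card` comes from Cauchy–Schwarz for the sum, as the
ramps are not assumed disjoint. -/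
lemma exists_displacement {a b : ℝ} {u₀ : L1 a b} {c₀ : ℝ} {g c : ℝ → ℝ} (hg : MemLp g 2)
    (B : Finset ℝ) (hc : ∀ t ∈ B, 0 < c t)
    (hu : u₀ =ᵐ[volume.restrict (Ioo a b)] piecewisePrimitive c₀ g B c) {δ : ℝ} (hδ : 0 < δ) :
    ∃ u : L1 a b, MemH1 (Ioo a b) u ∧ ‖u - u₀‖ ≤ (∑ t ∈ B, c t) * δ ∧
      ∀ κ η : ℝ, 0 < κ → 0 ≤ η → ∀ v : ℝ → ℝ,
        (∀ᵐ x ∂volume.restrict (Ioo a b), 0 ≤ v x ∧ v x ≤ 1) →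
        (∀ᵐ x ∂volume.restrict (Ioo a b), ∀ t ∈ B, x ∈ Ioc t (t + δ) → v x = 1) →
        elasticEnergy a b κ η u v ≤ ENNReal.ofReal (κ * (1 + 2 * η) * (∫ x in Ioo a b, g x ^ 2)
          + 2 * κ * (η / δ) * (B.card * ∑ t ∈ B, c t ^ 2)) := by
  have hgl : LocallyIntegrable g := hg.locallyIntegrable (by norm_num)
  set S : ℝ → ℝ := fun x => ∑ t ∈ B, c t * rampDensity t δ x
  set f : ℝ → ℝ := fun x => primitive c₀ g x + ∑ t ∈ B, c t * ramp t δ x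
  have hramp : ∀ t, Continuous (ramp t δ) := fun t => by
    rw [ramp_eq_primitive]; exact continuous_primitive _ (locallyIntegrable_rampDensity t δ)
  have hfc : Continuous f := (continuous_primitive c₀ hgl).add
    (continuous_finsetSum B fun t _ => (hramp t).const_mul (c t))
  have hSm : MemLp S 2 := memLp_finsetSum B fun t _ => (memLp_rampDensity t δ 2).const_mul (c t)
  have hd : HasWeakDeriv univ f (fun x => g x + S x) :=
    (hasWeakDeriv_primitive c₀ hgl).add (HasWeakDeriv.sum B fun t _ => by
      rw [ramp_eq_primitive]
      exact (hasWeakDeriv_primitive _ (locallyIntegrable_rampDensity t δ)).const_mul (c t))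
  have hf1 := memLp_of_continuous hfc a b 1
  have hae := hf1.coeFn_toLp
  have hd' := (hd.mono (subset_univ (Ioo a b))).congr hae.symm (EventuallyEq.refl _ _)
  have hw := hd'.weakDeriv_ae_eq isOpen_Ioo
  refine ⟨hf1.toLp f, MemH1.of_hasWeakDeriv isOpen_Ioo
    ((memLp_of_continuous hfc a b 2).ae_eq hae.symm) ((hg.add hSm).restrict _) hd', ?_, ?_⟩
  · rw [L1.norm_eq_integral_norm]
    have hi : ∀ t, Integrable ((Ioc t (t + δ)).indicator (fun _ => (1 : ℝ))) := fun t =>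
      (integrable_indicator_iff measurableSet_Ioc).2 (integrableOn_const (by simp))
    have h1 : ∫ x in Ioo a b, ‖(hf1.toLp f - u₀) x‖
        ≤ ∫ x in Ioo a b, ∑ t ∈ B, c t * (Ioc t (t + δ)).indicator (fun _ => (1 : ℝ)) x := by
      refine integral_mono_ae (L1.integrable_coeFn _).norm
        (integrable_finsetSum B fun t _ => ((hi t).integrableOn).const_mul (c t)) ?_
      filter_upwards [Lp.coeFn_sub (hf1.toLp f) u₀, hae, hu] with x h1 h2 h3
      rw [h1, Pi.sub_apply, h2, h3, piecewisePrimitive]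
      simp only [f]
      rw [add_sub_add_left_eq_sub, ← Finset.sum_sub_distrib]
      refine (norm_sum_le _ _).trans (Finset.sum_le_sum fun t ht => ?_)
      rw [← mul_sub, norm_mul, Real.norm_of_nonneg (hc t ht).le]
      exact mul_le_mul_of_nonneg_left (abs_ramp_sub_step_le t hδ x) (hc t ht).le
    refine h1.trans ?_
    rw [integral_finsetSum]
    · rw [Finset.sum_mul]
      refine Finset.sum_le_sum fun t ht => ?_
      rw [integral_const_mul]
      refine mul_le_mul_of_nonneg_left ?_ (hc t ht).le
      rw [setIntegral_indicator measurableSet_Ioc, setIntegral_const, smul_eq_mul, mul_one]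
      refine (measureReal_mono inter_subset_right (by simp)).trans_eq ?_
      rw [Real.volume_real_Ioc_of_le (by linarith), add_sub_cancel_left]
    · exact fun t _ => ((hi t).integrableOn).const_mul (c t)
  · intro κ η hκ hη v hv01 hv1
    have hS0 : ∀ x, 0 ≤ S x := fun x => Finset.sum_nonneg fun t ht =>
      mul_nonneg (hc t ht).le (indicator_nonneg (fun _ _ => (inv_pos.2 hδ).le) x)
    have i1 : IntegrableOn (fun x => κ * (1 + 2 * η) * g x ^ 2) (Ioo a b) :=
      (hg.restrict _).integrable_sq.const_mul _
    have i2 : Integrable (fun x => 2 * κ * η * S x ^ 2) := hSm.integrable_sq.const_mul _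
    have hle : elasticEnergy a b κ η (hf1.toLp f) v
        ≤ ∫⁻ x in Ioo a b, ENNReal.ofReal (κ * (1 + 2 * η) * g x ^ 2 + 2 * κ * η * S x ^ 2) := by
      refine lintegral_mono_ae ?_
      filter_upwards [hw, hv01, hv1] with x hx h01 h1
      rw [hx]
      refine ENNReal.ofReal_le_ofReal (elastic_density_le hκ hη h01.1 h01.2 (hS0 x) fun hne => ?_)
      obtain ⟨t, ht, hne⟩ := Finset.exists_ne_zero_of_sum_ne_zero hne
      exact h1 t ht (by_contra fun h' => hne (by
        rw [rampDensity, indicator_of_notMem h', mul_zero]))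
    refine hle.trans ?_
    have i12 : IntegrableOn (fun x => κ * (1 + 2 * η) * g x ^ 2 + 2 * κ * η * S x ^ 2) (Ioo a b) :=
      i1.add i2.integrableOn
    rw [← ofReal_integral_eq_lintegral_ofReal i12 (ae_of_all _ fun x => by
      simp only [Pi.zero_apply]; positivity), integral_add i1 i2.integrableOn, integral_const_mul,
      integral_const_mul]
    refine ENNReal.ofReal_le_ofReal (add_le_add_right ?_ _)
    have h1 : ∫ x in Ioo a b, S x ^ 2 ≤ ∫ x, S x ^ 2 :=
      setIntegral_le_integral hSm.integrable_sq (ae_of_all _ fun x => sq_nonneg _)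
    have h2 : ∫ x, S x ^ 2 ≤ B.card * ((∑ t ∈ B, c t ^ 2) * δ⁻¹) := by
      have i3 : ∀ t, Integrable fun x => (c t * rampDensity t δ x) ^ 2 := fun t =>
        ((memLp_rampDensity t δ 2).const_mul (c t)).integrable_sq
      calc ∫ x, S x ^ 2 ≤ ∫ x, B.card * ∑ t ∈ B, (c t * rampDensity t δ x) ^ 2 :=
            integral_mono hSm.integrable_sq
              ((integrable_finsetSum B fun t _ => i3 t).const_mul _) fun x => sq_sum_le_card_mul_sum_sq
        _ = B.card * ((∑ t ∈ B, c t ^ 2) * δ⁻¹) := by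
            rw [integral_const_mul, integral_finsetSum B fun t _ => i3 t, Finset.sum_mul]
            congr 1
            refine Finset.sum_congr rfl fun t _ => ?_
            have e : ∀ x, (c t * rampDensity t δ x) ^ 2
                = (Ioc t (t + δ)).indicator (fun _ => c t ^ 2 * (δ⁻¹) ^ 2) x := fun x => by
              by_cases hx : x ∈ Ioc t (t + δ)
              · simp only [rampDensity, indicator_of_mem hx]; ring
              · simp [rampDensity, indicator_of_notMem hx]
            simp only [e]
            rw [integral_indicator measurableSet_Ioc, setIntegral_const,
              Real.volume_real_Ioc_of_le (by linarith), smul_eq_mul]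
            field_simp
            ring
    calc 2 * κ * η * ∫ x in Ioo a b, S x ^ 2
        ≤ 2 * κ * η * (B.card * ((∑ t ∈ B, c t ^ 2) * δ⁻¹)) := by gcongr; exact h1.trans h2
      _ = _ := by ring

/-! ### The upper bound and the theorem -/

theorem exists_recovery {a b κ ρ Gc : ℝ} (hκ : 0 < κ) (hρ : 0 < ρ) (hGc : 0 < Gc)
    {w : ℝ → ℝ} (hw : IsOptimalProfile ρ w) {ε η : ℕ → ℝ} (hε : ∀ n, 0 < ε n)
    (hε0 : Tendsto ε atTop (𝓝 0)) (hη : ∀ n, 0 ≤ η n)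
    (hηε : Tendsto (fun n => η n / ε n) atTop (𝓝 0)) (x : L1 a b × L1 a b) :
    ∃ y : ℕ → L1 a b × L1 a b, Tendsto y atTop (𝓝 x) ∧ limsup (fun n =>
      phaseFieldEnergy a b κ Gc ρ (2 * transitionEnergy ρ w) (ε n) (η n) (y n)) atTop
        ≤ sharpCrackEnergy a b κ Gc x := by
  obtain ⟨u₀, v₀⟩ := x
  by_cases hcond : MemSBV2 a b u₀ ∧ (∀ x ∈ jumpSet a b u₀, 0 < jump u₀ x) ∧
      ∀ᵐ x ∂volume.restrict (Ioo a b), v₀ x = 0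
  swap
  · refine ⟨fun _ => (u₀, v₀), tendsto_const_nhds, ?_⟩
    rw [sharpCrackEnergy, if_neg hcond]
    exact le_top
  rw [sharpCrackEnergy, if_pos hcond]
  obtain ⟨hSBV, hpos, hv₀⟩ := hcond
  have hv₀' : v₀ = 0 := Lp.ext (EventuallyEq.trans hv₀ (Lp.coeFn_zero ℝ 1 _).symm)
  obtain ⟨-, hg2, c₀, hu⟩ := hSBV.exists_piecewisePrimitive
  set g := (Ioo a b).indicator (sbvDensity a b u₀)
  set B := hSBV.finite_jumpSet.toFinset
  have hBmem : ∀ t, t ∈ B ↔ t ∈ jumpSet a b u₀ := fun t => hSBV.finite_jumpSet.mem_toFinset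
  have hK := hw.transitionEnergy_pos hρ
  set K := transitionEnergy ρ w
  obtain ⟨r, C, hr, hC, hphase⟩ := exists_phaseField hρ hw B fun t ht => ((hBmem t).1 ht).1
  -- The width must satisfy `η ≪ δ ≪ ε`. The first summand is the geometric mean of `η` and `ε`; the
  -- second keeps `δ` positive when `η = 0`.
  set δ : ℕ → ℝ := fun n => ε n * (√(η n / ε n) + ε n)
  have hsq : Tendsto (fun n => √(η n / ε n)) atTop (𝓝 0) := by
    simpa [Function.comp_def] using (Real.continuous_sqrt.tendsto 0).comp hηε
  have hδpos : ∀ n, 0 < δ n := fun n =>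
    mul_pos (hε n) (add_pos_of_nonneg_of_pos (Real.sqrt_nonneg _) (hε n))
  have hδε : Tendsto (fun n => δ n / ε n) atTop (𝓝 0) := by
    have := hsq.add hε0
    rw [add_zero] at this
    exact this.congr fun n => by simp only [δ]; rw [mul_div_cancel_left₀ _ (hε n).ne']
  have hδ0 : Tendsto δ atTop (𝓝 0) := by
    simpa using hε0.mul (hsq.add hε0)
  have hηδ : Tendsto (fun n => η n / δ n) atTop (𝓝 0) := by
    refine squeeze_zero (fun n => div_nonneg (hη n) (hδpos n).le) (fun n => ?_) hsq
    rw [div_le_iff₀ (hδpos n)]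
    have h1 : η n = ε n * (√(η n / ε n) * √(η n / ε n)) := by
      rw [Real.mul_self_sqrt (div_nonneg (hη n) (hε n).le), mul_div_cancel₀ _ (hε n).ne']
    have h2 : 0 ≤ ε n * (√(η n / ε n) * ε n) := by
      have := hε n
      positivity
    simp only [δ]
    nlinarith
  have hη0 : Tendsto η atTop (𝓝 0) := by
    have := hηε.mul hε0
    rw [zero_mul] at this
    exact this.congr fun n => div_mul_cancel₀ _ (hε n).ne'
  set A : ℕ → ℝ := fun n => κ * (1 + 2 * η n) * (∫ x in Ioo a b, g x ^ 2)
    + 2 * κ * (η n / δ n) * (B.card * ∑ t ∈ B, jump u₀ t ^ 2)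
  set S : ℕ → ℝ := fun n => B.card * ((1 + C * ε n) * (2 * K + 2 * δ n / ε n))
  have hS0 : ∀ n, 0 ≤ S n := fun n => by
    have := hε n
    have := hδpos n
    positivity
  have hAlim : Tendsto A atTop (𝓝 (κ * ∫ x in Ioo a b, g x ^ 2)) := by
    have := (((hη0.const_mul 2).const_add 1).const_mul κ).mul_const (∫ x in Ioo a b, g x ^ 2)
    have h2 := (hηδ.const_mul (2 * κ)).mul_const (B.card * ∑ t ∈ B, jump u₀ t ^ 2)
    simpa using this.add h2
  have hSlim : Tendsto S atTop (𝓝 (B.card * (2 * K))) := by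
    have h1 := (hε0.const_mul C).const_add 1
    have h2 := (hδε.const_mul 2).const_add (2 * K)
    have h3 := (h1.mul h2).const_mul (B.card : ℝ)
    simp only [mul_zero, add_zero, one_mul] at h3
    exact h3.congr fun n => by simp only [S, mul_div_assoc]
  -- The construction requires `ε n ≤ 1` and `δ n ≤ r`, hence only large `n`.
  have hev : ∀ᶠ n in atTop, ∃ y : L1 a b × L1 a b, ‖y.1 - u₀‖ ≤ (∑ t ∈ B, jump u₀ t) * δ n ∧
      ‖y.2‖ ≤ ε n * S n ∧ phaseFieldEnergy a b κ Gc ρ (2 * K) (ε n) (η n) y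
        ≤ ENNReal.ofReal (A n) + ENNReal.ofReal (Gc / (2 * K)) * ENNReal.ofReal (S n) := by
    filter_upwards [hε0.eventually_le_const zero_lt_one, hδ0.eventually_le_const hr] with n h1 h2
    obtain ⟨v, hvH, hv01, hv1, hvS⟩ := hphase (ε n) (δ n) (hε n) h1 (hδpos n) h2
    obtain ⟨u, huH, hun, huE⟩ := exists_displacement hg2 B
      (fun t ht => hpos t ((hBmem t).1 ht)) hu (hδpos n)
    refine ⟨(u, v), hun, norm_le_of_surfaceIntegral_le hρ (hε n) (hS0 n) hv01 hvS, ?_⟩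
    rw [phaseFieldEnergy, if_pos ⟨huH, hvH, hv01⟩]
    gcongr
    exact huE κ (η n) hκ (hη n) v hv01 hv1
  obtain ⟨y, hy⟩ := hev.choice
  refine ⟨y, ?_, ?_⟩
  · rw [nhds_prod_eq, hv₀']
    refine Tendsto.prodMk ?_ ?_
    · rw [tendsto_iff_norm_sub_tendsto_zero]
      refine squeeze_zero' (Eventually.of_forall fun _ => norm_nonneg _) (hy.mono fun n hn => hn.1) ?_
      simpa using hδ0.const_mul (∑ t ∈ B, jump u₀ t)
    · rw [tendsto_zero_iff_norm_tendsto_zero]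
      refine squeeze_zero' (Eventually.of_forall fun _ => norm_nonneg _) (hy.mono fun n hn => hn.2.1) ?_
      simpa using hε0.mul hSlim
  · have hlim : Tendsto (fun n => ENNReal.ofReal (A n)
        + ENNReal.ofReal (Gc / (2 * K)) * ENNReal.ofReal (S n)) atTop
        (𝓝 (ENNReal.ofReal (κ * ∫ x in Ioo a b, g x ^ 2)
          + ENNReal.ofReal (Gc / (2 * K)) * ENNReal.ofReal (B.card * (2 * K)))) :=
      ((ENNReal.continuous_ofReal.tendsto _).comp hAlim).add (ENNReal.Tendsto.const_mul
        ((ENNReal.continuous_ofReal.tendsto _).comp hSlim) (Or.inr ENNReal.ofReal_ne_top))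
    refine (limsup_le_limsup (hy.mono fun n hn => hn.2.2)).trans ?_
    rw [hlim.limsup_eq]
    refine add_le_add ?_ ?_
    · have hnull : volume (jumpSet a b u₀) = 0 := hSBV.finite_jumpSet.measure_zero _
      have hgi := (hg2.restrict (Ioo a b)).integrable_sq.const_mul κ
      rw [← integral_const_mul, ofReal_integral_eq_lintegral_ofReal hgi
        (ae_of_all _ fun x => by positivity),
        setLIntegral_congr (sdiff_null_ae_eq_self hnull)]
      refine le_of_eq (setLIntegral_congr_fun measurableSet_Ioo fun x hx => ?_)
      simp only [g, indicator_of_mem hx]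
    · rw [← ENNReal.ofReal_mul (by positivity)]
      have e : Gc / (2 * K) * (B.card * (2 * K)) = Gc * B.card := by field_simp
      rw [e, ENNReal.ofReal_mul hGc.le, ENNReal.ofReal_natCast]
      have hB : ((jumpSet a b u₀).encard : ℝ≥0∞) = B.card := by
        rw [show jumpSet a b u₀ = (B : Set ℝ) from hSBV.finite_jumpSet.coe_toFinset.symm,
          Set.encard_coe_eq_coe_finsetCard]
        simp
      rw [hB]

end PhaseField

end

theorem theorem2p2 (a b κ Gc ρ : ℝ) (hab : a < b) (hκ : 0 < κ) (hGc : 0 < Gc) (hρ : 0 < ρ)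
    (η : ℝ → ℝ) (hη : ∀ ε, 0 < ε → 0 ≤ η ε)
    (hηo : Asymptotics.IsLittleO (𝓝[>] (0 : ℝ)) η (fun ε : ℝ => ε)) :
    (∃ w, PhaseField.IsOptimalProfile ρ w) ∧
    ∀ w, PhaseField.IsOptimalProfile ρ w →
      ∀ c : ℝ, c = 2 * PhaseField.transitionEnergy ρ w →
        PhaseField.GammaConverges
          (fun ε : ℝ => PhaseField.phaseFieldEnergy a b κ Gc ρ c ε (η ε))
          (PhaseField.sharpCrackEnergy a b κ Gc) := by
  refine ⟨PhaseField.exists_isOptimalProfile hρ, fun w hw c hc ε hε hε0 => ?_⟩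
  subst hc
  have hηn : ∀ n, 0 ≤ η (ε n) := fun n => hη _ (hε n)
  have hε0' : Tendsto ε atTop (𝓝[>] 0) :=
    tendsto_nhdsWithin_iff.2 ⟨hε0, Eventually.of_forall hε⟩
  -- The relation `η = o(ε)` enters only the upper bound; the lower bound uses `η ≥ 0` alone.
  exact ⟨fun _ _ hy => PhaseField.sharpCrackEnergy_le_liminf hκ hρ hGc hw hε hε0 hηn hy,
    PhaseField.exists_recovery hκ hρ hGc hw hε hε0 hηn (hηo.tendsto_div_nhds_zero.comp hε0')⟩
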